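/- **Parameters.** Let $1\le k\le d/3-1$ be integers, $n=\lceil d/4\rceil$, $\delta=d^{-3}$, $\eta=2/d^3$, $\gamma_1=12\sqrt{\log d/d}$, $\gamma_2=\gamma_1/(4d)$, and let $p_{max}$ be the largest natural number that is at most $\min\{(c_1d-1)/k,\ c_2(d/k)^{1/3}-1\}$, where $c_1=1/(90^2\log^2 d)$ and $c_2=1/(81\log^{2/3}d)$ (with $p_{max}=0$ if there is none). Let $B$ be the closed unit ball of $\mathbb R^d$. Fix a partition of the sphere $S^{d-1}$ into finitely many measurable cells of equal area and diameter at most $\delta$, with one representative in each cell; $\mathcal D_\delta$ is the set of representatives and $\phi_\delta(y)$ is the representative of the cell of $y$. For vectors $x_1,\dots,x_r$ with Gram–Schmidt orthonormalization $b_1,\dots,b_r$, let $\mathcal L(x_1,\dots,x_r)$ be the law of $\phi_\delta(y)$ for $y$ uniform on $S^{d-1}\cap\{z:|b_i^\top z|\le d^{-3}\ \forall i\le r\}$. **Functions.** For $A\in\{\pm1\}^{n\times d}$ with rows $a_i$, let $g_A(x)$ be the first row with $|a_i^\top x|=\|Ax\|_\infty$, and $\tilde g_A(x)=\mathrm{sign}(g_A(x)^\top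 x)\,g_A(x)$. Given $v_0$ and vectors $v_{p,l}$ constructed so far, let $$F(x)=\max\Big\{\|Ax\|_\infty-\eta,\ \eta v_0^\top x,\ \eta\max_{(p,l)}\big(v_{p,l}^\top x-p\gamma_1-l\gamma_2\big)\Big\},$$ and let $F_A$ be the same function without the third term. The subgradient $\partial F(x)$ is $\tilde g_A(x)$ if $F(x)=\|Ax\|_\infty-\eta$; otherwise $\eta v_0$ if $F(x)=\eta v_0^\top x$; otherwise $\eta v_{p,l}$ for the lexicographically first maximizing $(p,l)$. **Algorithms.** An $M$-bit algorithm is given by functions $\psi_{query}:\{0,1\}^M\to B$ and $\psi_{update}:\{0,1\}^M\times B\times(\mathbb R\times\mathbb R^d)\to\{0,1\}^M$. It starts with memory $0^M$; at each iteration it queries $\psi_{query}$ of its memory, receives a response, and updates its memory by $\psi_{update}$. It may stop after any query, by an arbitrary deterministic rule depending on the transcript; its last query is its final answer. **Optimization procedure.** Sample independently $A$ uniform on $\{\pm1\}^{n\times d}$ and $v_0$ uniform on $\mathcal D_\delta$. Start with $p=1$, $l=0$ and an empty list of exploratory queries of the current period. As long as the construction has not ended, the query $x_t$ is treated as follows.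 * If $t>d^2$, the construction ends. * Otherwise, if $F_A(x_t)>\eta$, the response is $(\|Ax_t\|_\infty-\eta,\tilde g_A(x_t))$ and nothing changes. * Otherwise let $F$ be the current function. If there are fewer than $k$ exploratory queries in this period, $F(x_t)\le-\eta\gamma_1/2$, and the distance of $x_t$ to the span of these queries is at least $\frac{\gamma_2}{4}\|x_t\|$, append $x_t$ to their list. Then, if $F(x_t)<-\eta(p\gamma_1+l\gamma_2+\gamma_2/2)$: * if the list (after this update) has fewer than $k$ elements, sample $v_{p,l+1}$ from $\mathcal L$ of the list and increase $l$ by one; * if it has $k$ elements and $p+1\le p_{max}$, a new period begins: sample $v_{p+1,1}$ from $\mathcal L(x_t)$, increase $p$ by one, set $l=1$, and let $x_t$ be the only exploratory query of the new period; * otherwise the construction ends. The response is $(F(x_t),\partial F(x_t))$ for the function $F$ after this step. Once the construction has ended (including at the iteration at which it ends), responses are $(F(x_t),\partial F(x_t))$ for the final function $F$. An algorithm is successful with accuracy $\epsilon$ if its final answer $x^\star$ satisfies $F(x^\star)\le\min_{x\in B}F(x)+\epsilon$, where $F$ is the function constructed when it stops. **Orthogonal Vector Game with Hints**, with parameters $(d,k,m,M,\alpha,\beta)$.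 1. The oracle samples $A$ uniformly on $\{\pm1\}^{n\times d}$, and the player observes $A$. 2. For $l=1,\dots,d$: based on $A$ and the previous queries and responses, the player submits at most $k$ vectors, and the oracle returns a sample $v_l$ of $\mathcal L$ of these vectors. 3. Based on $A$ and all queries and responses, the player stores a message in $\{0,1\}^M$ and submits a function $g:B\to(\{a_j:j\le n\}\cup\{v_l:l\le d\})\times\{1,\dots,d^2\}$. 4. For $i=1,\dots,m$: based only on the message and on the previous queries and responses of this phase, the player submits $z_i\in B$ and receives $g(z_i)$. 5. Based only on the message and on the queries and responses of step 4, the player returns $y_1,\dots,y_k\in\mathbb R^d$. The player wins if for all $i\le k$: $\|y_i\|=1$, $\|Ay_i\|_\infty\le\alpha$ and $\|P_{\mathrm{Span}(y_1,\dots,y_{i-1})^\perp}(y_i)\|\ge\beta$. **Proposition.** There is a universal constant $C>0$ such that the following holds for all $d,k,M$ and all partitions as above, and all $m\le d$. Suppose that some $M$-bit algorithm run on the optimization procedure, with probability at least $q$, stops after at most $m\,p_{max}$ queries and is successful with accuracy $\eta/(2\sqrt d)$. Then there is a (deterministic) strategy of the player for the Orthogonal Vector Game with Hints with parameters $\left(d,k,m,M,\alpha=\frac{2\eta}{\gamma_1},\beta=\frac{\gamma_2}{4}\right)$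 which wins with probability at least $$q-C\,\frac{\sqrt{\log d}}{d}.$$ -/

import Mathlib

open MeasureTheory

namespace HintGame

noncomputable section

/-- `ℝ^d` with its Euclidean norm. -/
abbrev Vec (d : ℕ) : Type := EuclideanSpace ℝ (Fin d)

/-- The closed unit ball `B_d(0,1)`. -/
abbrev Ball (d : ℕ) : Type := Metric.closedBall (0 : Vec d) 1

/-- The unit sphere `S^{d-1}`. -/
abbrev Sphere (d : ℕ) : Type := Metric.sphere (0 : Vec d) 1

/-- Surface measure on the unit sphere (not normalized). -/
abbrev surface (d : ℕ) : Measure (Sphere d) := (volume : Measure (Vec d)).toSphere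

/-! ### Parameters -/

/-- Number of rows, `n = ⌈d/4⌉`. -/
def numRows (d : ℕ) : ℕ := ⌈(d : ℝ) / 4⌉₊

def eta (d : ℕ) : ℝ := 2 / (d : ℝ) ^ 3

def gamma1 (d : ℕ) : ℝ := 12 * √(Real.log d / d)

def gamma2 (d : ℕ) : ℝ := gamma1 d / (4 * d)

/-- The mesh of the discretization of the sphere. -/
def mesh (d : ℕ) : ℝ := 1 / (d : ℝ) ^ 3

/-- The number of periods: the largest natural number that is at most
`min ((c₁ d - 1) / k) (c₂ (d / k)^(1/3) - 1)` with `c₁ = 1 / (90² log² d)` and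
`c₂ = 1 / (81 log^(2/3) d)` (and `0` if there is none). -/
def pMax (d k : ℕ) : ℕ :=
  ⌊min ((1 / (90 ^ 2 * Real.log d ^ 2) * d - 1) / k)
      (1 / (81 * Real.log d ^ (2 / 3 : ℝ)) * ((d : ℝ) / k) ^ (1 / 3 : ℝ) - 1)⌋₊

/-! ### Discretization of the sphere and the law of the sampled vectors -/

/-- A partition of `S^{d-1}` into finitely many measurable cells of equal area and of diameter
at most `δ`, with a representative in each cell. -/
structure Discretization (d : ℕ) (δ : ℝ) where
  numCells : ℕ
  numCells_pos : 0 < numCells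
  cell : Fin numCells → Set (Sphere d)
  measurableSet_cell : ∀ i, MeasurableSet (cell i)
  disjoint_cell : Pairwise fun i j => Disjoint (cell i) (cell j)
  iUnion_cell : ⋃ i, cell i = Set.univ
  equal_area : ∀ i j, surface d (cell i) = surface d (cell j)
  dist_le : ∀ i, ∀ x ∈ cell i, ∀ y ∈ cell i, dist x y ≤ δ
  rep : Fin numCells → Sphere d
  rep_mem : ∀ i, rep i ∈ cell i

instance {d : ℕ} {δ : ℝ} (D : Discretization d δ) : Nonempty (Fin D.numCells) :=
  ⟨⟨0, D.numCells_pos⟩⟩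

/-- The law of a uniformly random element of the set of representatives `𝒟_δ`. -/
def Discretization.uniform {d : ℕ} {δ : ℝ} (D : Discretization d δ) : PMF (Vec d) :=
  (PMF.uniformOfFintype (Fin D.numCells)).map fun i => (D.rep i : Vec d)

/-- `S^{d-1} ∩ {z : |b_r ⬝ z| ≤ d⁻³ for all r}`, where `b_1, b_2, …` is the Gram-Schmidt
orthonormalization of the list `xs`. -/
def band (d : ℕ) (xs : List (Vec d)) : Set (Sphere d) :=
  {z | ∀ r : Fin xs.length,
    |inner ℝ (InnerProductSpace.gramSchmidtNormed ℝ xs.get r) (z : Vec d)| ≤ 1 / (d : ℝ) ^ 3}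

theorem sum_cond_cell {d : ℕ} {δ : ℝ} (D : Discretization d δ) {s : Set (Sphere d)}
    (hs : surface d s ≠ 0) :
    ∑ i, ProbabilityTheory.cond (surface d) s (D.cell i) = 1 := by
  have := ProbabilityTheory.cond_isProbabilityMeasure (μ := surface d) hs
  rw [← tsum_fintype (L := .unconditional _),
    ← measure_iUnion D.disjoint_cell D.measurableSet_cell, D.iUnion_cell]
  exact measure_univ

open Classical in
/-- The law of `φ_δ(y)` for `y` uniform on `band d xs`: the representative of a cell is drawn with
the probability that `y` lies in this cell. The band has positive area whenever `xs` has fewer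
than `d` entries; the second branch is never reached then. -/
def hintLaw {d : ℕ} {δ : ℝ} (D : Discretization d δ) (xs : List (Vec d)) : PMF (Vec d) :=
  if h : surface d (band d xs) ≠ 0 then
    (PMF.ofFintype (fun i => ProbabilityTheory.cond (surface d) (band d xs) (D.cell i))
      (sum_cond_cell D h)).map fun i => (D.rep i : Vec d)
  else D.uniform

/-! ### Sign matrices and the functions to be minimized -/

/-- The set `{±1}^{n × d}`. -/
abbrev SignMatrix (d : ℕ) : Type := Matrix (Fin (numRows d)) (Fin d) ℤˣ

/-- The row `a_i` as a vector. -/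
def row {d : ℕ} (A : SignMatrix d) (i : Fin (numRows d)) : Vec d :=
  WithLp.toLp 2 fun j => ((A i j : ℤ) : ℝ)

/-- `‖A x‖_∞` (the norm of a function on `Fin n` is the sup norm). -/
def supNorm {d : ℕ} (A : SignMatrix d) (x : Vec d) : ℝ :=
  ‖fun i : Fin (numRows d) => inner ℝ (row A i) x‖

open Classical in
/-- `g_A(x)`: the first row `a_i` with `|a_i ⬝ x| = ‖A x‖_∞`. -/
def rowArg {d : ℕ} (A : SignMatrix d) (x : Vec d) : Vec d :=
  (((List.finRange (numRows d)).find? fun i =>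
    decide (|inner ℝ (row A i) x| = supNorm A x)).map (row A)).getD 0

/-- The subgradient `± g_A(x)` of `x ↦ ‖A x‖_∞`. -/
def rowSubgrad {d : ℕ} (A : SignMatrix d) (x : Vec d) : Vec d :=
  Real.sign (inner ℝ (rowArg A x) x) • rowArg A x

/-- A constructed vector `v_{p,l}` together with its indices. -/
structure Cut (d : ℕ) where
  p : ℕ
  l : ℕ
  v : Vec d

/-- `η (v_{p,l} ⬝ x - p γ₁ - l γ₂)`. -/
def Cut.value {d : ℕ} (c : Cut d) (x : Vec d) : ℝ :=
  eta d * (inner ℝ c.v x - c.p * gamma1 d - c.l * gamma2 d)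

/-- `max {‖A x‖_∞ - η, η v₀ ⬝ x, η max_{(p,l)} (v_{p,l} ⬝ x - p γ₁ - l γ₂)}`, where `(p,l)` runs
over the list `cuts` (with no third term if the list is empty). -/
def objective {d : ℕ} (A : SignMatrix d) (v₀ : Vec d) (cuts : List (Cut d)) (x : Vec d) : ℝ :=
  (cuts.map fun c => c.value x).foldr max (max (supNorm A x - eta d) (eta d * inner ℝ v₀ x))

open Classical in
/-- The chosen subgradient of `objective A v₀ cuts`: rows of `A` are preferred to `v₀`, and `v₀` to
the `v_{p,l}`; ties between the latter are broken by their order in the list (which will be the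
order of construction, that is, the lexicographic order of the indices). -/
def subgrad {d : ℕ} (A : SignMatrix d) (v₀ : Vec d) (cuts : List (Cut d)) (x : Vec d) : Vec d :=
  if objective A v₀ cuts x = supNorm A x - eta d then rowSubgrad A x
  else if objective A v₀ cuts x = eta d * inner ℝ v₀ x then eta d • v₀
  else ((cuts.find? fun c => decide (c.value x = objective A v₀ cuts x)).map
    fun c => eta d • c.v).getD 0

/-- `‖P_{Span(xs)^⊥}(x)‖`. -/
def distToSpan {d : ℕ} (xs : List (Vec d)) (x : Vec d) : ℝ :=
  ‖(Submodule.span ℝ {y | y ∈ xs})ᗮ.starProjection x‖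

/-! ### Memory-constrained algorithms -/

/-- A deterministic algorithm with `M` bits of memory, queries in `S` and responses in `R`.
It may stop after any query. The decision to stop may depend on the whole transcript (in
particular on the memory or on the number of queries): no memory constraint is put on it. -/
structure MemoryAlgorithm (M : ℕ) (S R : Type) where
  query : (Fin M → Bool) → S
  update : (Fin M → Bool) → S → R → (Fin M → Bool)
  halts : List (S × R) → Bool

/-- Algorithms for convex optimization over the unit ball with a first-order oracle. -/
abbrev OptAlgorithm (d M : ℕ) : Type := MemoryAlgorithm M (Ball d) (ℝ × Vec d)

/-! ### The optimization procedure -/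

/-- The state of the procedure: current period `p`, number `l` of vectors constructed in this
period, the exploratory queries of this period (in order), all vectors constructed so far (in
order), and whether the construction has ended. -/
structure ProcState (d : ℕ) where
  p : ℕ
  l : ℕ
  expl : List (Vec d)
  cuts : List (Cut d)
  ended : Bool

def ProcState.init (d : ℕ) : ProcState d := ⟨1, 0, [], [], false⟩

open Classical in
/-- The list of exploratory queries of the period after the informative query `x`. -/
def newExpl {d : ℕ} (k : ℕ) (A : SignMatrix d) (v₀ : Vec d) (s : ProcState d) (x : Vec d) :
    List (Vec d) :=
  if s.expl.length < k ∧ objective A v₀ s.cuts x ≤ -(eta d * gamma1 d / 2) ∧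
      gamma2 d / 4 ≤ distToSpan s.expl x / ‖x‖
  then s.expl ++ [x] else s.expl

open Classical in
/-- The change of the state at iteration `t` (counted from `1`) on the query `x`. -/
def procStep {d : ℕ} (D : Discretization d (mesh d)) (k : ℕ) (A : SignMatrix d) (v₀ : Vec d)
    (t : ℕ) (s : ProcState d) (x : Vec d) : PMF (ProcState d) :=
  if s.ended = true ∨ d ^ 2 < t then
    pure { s with ended := true }
  else if eta d < objective A v₀ [] x then
    pure s
  else
    let e := newExpl k A v₀ s x
    if objective A v₀ s.cuts x < -(eta d * (s.p * gamma1 d + s.l * gamma2 d + gamma2 d / 2)) then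
      if e.length < k then do
        let v ← hintLaw D e
        pure ⟨s.p, s.l + 1, e, s.cuts ++ [⟨s.p, s.l + 1, v⟩], false⟩
      else if s.p + 1 ≤ pMax d k then do
        let v ← hintLaw D [x]
        pure ⟨s.p + 1, 1, [x], s.cuts ++ [⟨s.p + 1, 1, v⟩], false⟩
      else
        pure ⟨s.p, s.l, e, s.cuts, true⟩
    else
      pure ⟨s.p, s.l, e, s.cuts, false⟩

open Classical in
/-- The response to the query `x`, where `s` is the state after the query was processed. -/
def procResponse {d : ℕ} (A : SignMatrix d) (v₀ : Vec d) (s : ProcState d) (x : Vec d) :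
    ℝ × Vec d :=
  if s.ended = false ∧ eta d < objective A v₀ [] x then (supNorm A x - eta d, rowSubgrad A x)
  else (objective A v₀ s.cuts x, subgrad A v₀ s.cuts x)

/-- The joint state of the procedure and of an algorithm that is run on it: the transcript lists
the queries and responses in chronological order. -/
structure RunState (d M : ℕ) where
  proc : ProcState d
  mem : Fin M → Bool
  transcript : List (Ball d × (ℝ × Vec d))
  stopped : Bool

/-- One query of the algorithm, or nothing if the algorithm has stopped. -/
def runStep {d M : ℕ} (D : Discretization d (mesh d)) (k : ℕ) (alg : OptAlgorithm d M)
    (A : SignMatrix d) (v₀ : Vec d) (s : RunState d M) : PMF (RunState d M) :=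
  if s.stopped = true then pure s
  else do
    let x := alg.query s.mem
    let proc ← procStep D k A v₀ (s.transcript.length + 1) s.proc x
    let resp := procResponse A v₀ proc x
    let tr := s.transcript ++ [(x, resp)]
    pure ⟨proc, alg.update s.mem x resp, tr, alg.halts tr⟩

/-- The law of the run after at most `T` queries, for fixed `A` and `v₀`. -/
def run {d M : ℕ} (D : Discretization d (mesh d)) (k : ℕ) (alg : OptAlgorithm d M)
    (A : SignMatrix d) (v₀ : Vec d) : ℕ → PMF (RunState d M)
  | 0 => pure ⟨ProcState.init d, fun _ => false, [], false⟩
  | T + 1 => do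
    let s ← run D k alg A v₀ T
    runStep D k alg A v₀ s

/-- The algorithm has stopped, and its last query minimizes the constructed function over the
unit ball up to `ε`. -/
def Succeeds {d M : ℕ} (A : SignMatrix d) (v₀ : Vec d) (ε : ℝ) (s : RunState d M) : Prop :=
  s.stopped = true ∧ ∃ e ∈ s.transcript.getLast?,
    ∀ y : Ball d, objective A v₀ s.proc.cuts e.1 ≤ objective A v₀ s.proc.cuts y + ε

/-- The law of `(A, v₀, run)`, with `A` uniform on `{±1}^{n × d}` and `v₀` uniform on `𝒟_δ`. -/
def procLaw {d M : ℕ} (D : Discretization d (mesh d)) (k : ℕ) (alg : OptAlgorithm d M) (T : ℕ) :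
    PMF (SignMatrix d × Vec d × RunState d M) := do
  let A ← PMF.uniformOfFintype (SignMatrix d)
  let v₀ ← D.uniform
  let s ← run D k alg A v₀ T
  pure (A, v₀, s)

/-- The probability that the algorithm stops after at most `T` queries to the optimization
procedure with an answer of accuracy `ε`. -/
def successProb {d M : ℕ} (D : Discretization d (mesh d)) (k : ℕ) (alg : OptAlgorithm d M)
    (T : ℕ) (ε : ℝ) : ℝ :=
  ((procLaw D k alg T).toOuterMeasure {ω | Succeeds ω.1 ω.2.1 ε ω.2.2}).toReal

/-! ### The Orthogonal Vector Game with Hints -/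

/-- The set `({a_j, j ≤ n} ∪ {v_l, l ≤ d}) × {1, …, d²}`. -/
def answerSet {d : ℕ} (A : SignMatrix d) (vs : List (Vec d)) : Set (Vec d × ℕ) :=
  (Set.range (row A) ∪ {v | v ∈ vs}) ×ˢ Set.Icc 1 (d ^ 2)

/-- A (deterministic) strategy of the player. As the strategy is deterministic, its previous
queries of the first phase are determined by `A` and the previous responses. -/
structure Strategy (d k M : ℕ) where
  /-- The vectors submitted in the first phase, given `A` and the previous responses. -/
  hintQuery : SignMatrix d → List (Vec d) → List (Vec d)
  length_hintQuery : ∀ A vs, (hintQuery A vs).length ≤ k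
  /-- The message, given `A` and all responses of the first phase. -/
  message : SignMatrix d → List (Vec d) → (Fin M → Bool)
  /-- The function submitted to the oracle, given `A` and all responses of the first phase. -/
  submit : (A : SignMatrix d) → (vs : List (Vec d)) → Ball d → answerSet A vs
  /-- The next query of the second phase, given the message and the transcript of this phase. -/
  query : (Fin M → Bool) → List (Ball d × (Vec d × ℕ)) → Ball d
  /-- The returned vectors, given the message and the transcript of the second phase. -/
  output : (Fin M → Bool) → List (Ball d × (Vec d × ℕ)) → Fin k → Vec d

/-- The law of the first `l` responses of the oracle in the first phase. -/
def hints {d k M : ℕ} (D : Discretization d (mesh d)) (σ : Strategy d k M) (A : SignMatrix d) :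
    ℕ → PMF (List (Vec d))
  | 0 => pure []
  | l + 1 => do
    let vs ← hints D σ A l
    let v ← hintLaw D (σ.hintQuery A vs)
    pure (vs ++ [v])

/-- The queries and responses of the first `i` rounds of the second phase. -/
def phaseTwo {d k M : ℕ} (σ : Strategy d k M) (A : SignMatrix d) (vs : List (Vec d)) :
    ℕ → List (Ball d × (Vec d × ℕ))
  | 0 => []
  | i + 1 =>
    let h := phaseTwo σ A vs i
    let z := σ.query (σ.message A vs) h
    h ++ [(z, (σ.submit A vs z : Vec d × ℕ))]

/-- The returned vectors are unit vectors, approximately orthogonal to the rows of `A`, and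
robustly independent. -/
def Wins {d k : ℕ} (A : SignMatrix d) (α β : ℝ) (y : Fin k → Vec d) : Prop :=
  ∀ i, ‖y i‖ = 1 ∧ supNorm A (y i) ≤ α ∧
    β ≤ ‖(Submodule.span ℝ (y '' Set.Iio i))ᗮ.starProjection (y i)‖

/-- The law of the matrix and of the `d` responses of the first phase. -/
def gameLaw {d k M : ℕ} (D : Discretization d (mesh d)) (σ : Strategy d k M) :
    PMF (SignMatrix d × List (Vec d)) := do
  let A ← PMF.uniformOfFintype (SignMatrix d)
  let vs ← hints D σ A d
  pure (A, vs)

/-- The probability that the player wins the game with `m` queries in the second phase. -/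
def winProb {d k M : ℕ} (D : Discretization d (mesh d)) (m : ℕ) (α β : ℝ)
    (σ : Strategy d k M) : ℝ :=
  ((gameLaw D σ).toOuterMeasure
    {ω | Wins ω.1 α β (σ.output (σ.message ω.1 ω.2) (phaseTwo σ ω.1 ω.2 m))}).toReal

end

end HintGame

open HintGame

/-!
The player of the game simulates the optimization procedure. The rows of `A` are known to the
player, and the responses `v_l` of the first phase, submitted lists being those prescribed by the
procedure, have exactly the law of the vectors `v₀`, `v_{1,1}`, `v_{1,2}`, … . Hence the run of the
algorithm and the first phase of the game can be coupled (`toOuterMeasure_runFrom_le`): the player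
runs the algorithm in mind, and asks for a hint whenever the procedure samples a vector.

On the event that all hints are good (`AllOK`) the procedure has the following properties.

* A new cut does not change the answers to earlier queries (`Inv.value_le`), so that the final
  function answers all queries of the run. Moreover a query that triggers a new vector has made the
  list of exploratory queries grow since the previous vector (`Inv.l_lt_length`). So a period uses
  at most `k` vectors, and at most `pMax * k + 1` vectors, fewer than `d`, are sampled in all.
* The final function has a deep minimum (`exists_deep_point`): minus the sum of the Gram-Schmidt
  orthonormalization of the vectors, projected orthogonally to the rows of `A`, is negatively
  correlated with all vectors. An algorithm that is successful must therefore have ended the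
  construction, that is, completed all `pMax` periods (`Inv.ended_of_accurate`).

With at most `m * pMax` queries, some period took at most `m` queries. The message of the player is
the memory of the algorithm at the beginning of that period, and the submitted function encodes the
first-order oracle of the final function (`encode`, `decode`). In the second phase the player can
thus replay the period and extract its `k` exploratory queries from the answers; normalized, they
win the game (`wins_normalized`, `exists_message_wins`).

Each hint is good except with probability `3 / d³` (`toOuterMeasure_not_stepOK_le`), which gives the
loss `3 / d² ≤ 3 √(log d) / d`. Two estimates enter: a hint is unlikely to be correlated with a
given vector (`hintLaw_tail`), and unlikely to have a short projection to a given space of large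
dimension
(`hintLaw_small_projection`). Both are proved by bounding volumes of cones: the first by averaging a
cap over all directions orthogonal to the submitted list, the second by a linear map that stretches
the given space.

When `pMax = 0` the algorithm may not make any query, and the claim is trivial.
-/

namespace HintGame

/-! ### Volumes of cones and bands -/

section Cones

open Module Metric
open scoped Pointwise

variable {E : Type*} [NormedAddCommGroup E] [InnerProductSpace ℝ E] [FiniteDimensional ℝ E]

theorem det_id_add_smul_starProjection (V : Submodule ℝ E) (c : ℝ) :
    LinearMap.det (LinearMap.id + c • (V.starProjection : E →L[ℝ] E).toLinearMap) =
      (1 + c) ^ finrank ℝ V := by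
  let e := V.prodEquivOfIsCompl _ V.isCompl_orthogonal
  let b := (finBasis ℝ V).prod (finBasis ℝ Vᗮ)
  have h1 : ∀ x : V, V.starProjection (x : E) = x := fun x =>
    Submodule.starProjection_eq_self_iff.2 x.2
  have h2 : ∀ x : Vᗮ, V.starProjection (x : E) = 0 := fun x =>
    (Submodule.starProjection_apply_eq_zero_iff V).2 x.2
  have : LinearMap.toMatrix b b (e.symm ∘ₗ
      (LinearMap.id + c • (V.starProjection : E →L[ℝ] E).toLinearMap) ∘ₗ e.symm.symm) =
      Matrix.fromBlocks ((1 + c) • 1) 0 0 1 := by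
    ext (i | i) (j | j) <;>
    simp [LinearMap.toMatrix_apply, b, Matrix.one_apply, Finsupp.single_apply, e, eq_comm, h1, h2]
    split_ifs <;> simp
  rw [← LinearMap.det_conj _ e.symm, ← LinearMap.det_toMatrix b, this,
    Matrix.det_fromBlocks_zero₂₁, Matrix.det_one, mul_one, Matrix.det_smul, Fintype.card_fin,
    Matrix.det_one, mul_one]

variable [MeasurableSpace E] [BorelSpace E]

/-- The cone over a spherical cap of height `1 - t` lies in a ball of radius `√(1 - t²)`. -/
theorem volume_cap_le (w : E) {t : ℝ} (ht0 : 0 ≤ t) (ht : t ^ 2 ≤ 1 / 2) :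
    volume {u : E | u ∈ ball (0 : E) 1 ∧ t * ‖w‖ * ‖u‖ < inner ℝ w u} ≤
      ENNReal.ofReal (√(1 - t ^ 2) ^ finrank ℝ E) * volume (ball (0 : E) 1) := by
  rcases eq_or_ne w 0 with rfl | hw
  · simp
  have hw' : 0 < ‖w‖ := norm_pos_iff.2 hw
  rw [← Measure.addHaar_closedBall volume ((t / ‖w‖) • w) (Real.sqrt_nonneg _)]
  refine measure_mono ?_
  rintro u ⟨hu, hlt⟩
  rw [mem_ball_zero_iff] at hu
  rw [mem_closedBall, dist_eq_norm]
  refine Real.le_sqrt_of_sq_le ?_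
  rw [@norm_sub_sq_real, norm_smul, inner_smul_right, real_inner_comm, Real.norm_eq_abs,
    abs_of_nonneg (by positivity : (0 : ℝ) ≤ t / ‖w‖)]
  have e1 : t / ‖w‖ * ‖w‖ = t := by field_simp
  have e2 : t * ‖u‖ ≤ inner ℝ w u / ‖w‖ := by rw [le_div_iff₀ hw']; linarith
  have e3 : t / ‖w‖ * inner ℝ w u = t * (inner ℝ w u / ‖w‖) := by ring
  rw [e1, e3]
  have e4 : t * (t * ‖u‖) ≤ t * (inner ℝ w u / ‖w‖) := mul_le_mul_of_nonneg_left e2 ht0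
  nlinarith [norm_nonneg u, mul_nonneg (norm_nonneg u) (sub_nonneg.2 hu.le)]

/-- The cone of points whose direction lies in the band `|⟪b i, ·⟫| ≤ ε`, cut off at the open unit
ball. -/
def bandCone {ι : Type*} (b : ι → E) (ε : ℝ) : Set E :=
  {z | z ∈ ball (0 : E) 1 ∧ ∀ i, |inner ℝ (b i) z| ≤ ε * ‖z‖}

omit [FiniteDimensional ℝ E] in
theorem measurableSet_bandCone {ι : Type*} [Countable ι] (b : ι → E) (ε : ℝ) :
    MeasurableSet (bandCone b ε) := by
  have h : bandCone b ε = ball (0 : E) 1 ∩ ⋂ i, {z | |inner ℝ (b i) z| ≤ ε * ‖z‖} := by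
    ext; simp [bandCone]
  rw [h]
  refine measurableSet_ball.inter (MeasurableSet.iInter fun i => ?_)
  exact (isClosed_le (by fun_prop) (by fun_prop)).measurableSet

/-- A linear isometry that fixes the vectors `b i` preserves the band cone, and two directions
orthogonal to all `b i` are exchanged by a reflection of this kind. -/
theorem volume_bandCone_cap_eq {ι : Type*} [Countable ι] (b : ι → E) (ε t : ℝ) {u v : E}
    (hu : ∀ i, inner ℝ (b i) u = 0) (hv : ∀ i, inner ℝ (b i) v = 0) (hu0 : u ≠ 0) (hv0 : v ≠ 0) :
    volume {z | z ∈ bandCone b ε ∧ t * ‖z‖ * ‖u‖ < inner ℝ z u} =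
      volume {z | z ∈ bandCone b ε ∧ t * ‖z‖ * ‖v‖ < inner ℝ z v} := by
  have hun : 0 < ‖u‖ := norm_pos_iff.2 hu0
  have hvn : 0 < ‖v‖ := norm_pos_iff.2 hv0
  set u' := (‖u‖⁻¹) • u with hu'
  set v' := (‖v‖⁻¹) • v with hv'
  have hn : ‖u'‖ = ‖v'‖ := by
    rw [hu', hv', norm_smul, norm_smul, norm_inv, norm_inv, norm_norm, norm_norm,
      inv_mul_cancel₀ hun.ne', inv_mul_cancel₀ hvn.ne']
  set R := (Submodule.span ℝ {u' - v'})ᗮ.reflection with hR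
  have hRu : R u' = v' := Submodule.reflection_sub hn
  have hRR : ∀ z, R (R z) = z := fun z => Submodule.reflection_reflection _ z
  have hRb : ∀ i, R (b i) = b i := by
    intro i
    refine Submodule.reflection_mem_subspace_eq_self ?_
    rw [Submodule.mem_orthogonal_singleton_iff_inner_left, inner_sub_right, hu', hv',
      inner_smul_right, inner_smul_right, hu, hv]
    simp
  have key : {z | z ∈ bandCone b ε ∧ t * ‖z‖ * ‖v‖ < inner ℝ z v} =
      R ⁻¹' {z | z ∈ bandCone b ε ∧ t * ‖z‖ * ‖u‖ < inner ℝ z u} := by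
    ext z
    have h1 : ∀ i, inner ℝ (b i) (R z) = inner ℝ (b i) z := fun i => by
      conv_lhs => rw [← hRb i]
      exact R.inner_map_map _ _
    have h2 : inner ℝ (R z) u' = inner ℝ z v' := by
      rw [← hRu, ← R.inner_map_map z (R u'), hRR]
    have h3 : (t * ‖z‖ * ‖u‖ < inner ℝ (R z) u) ↔ t * ‖z‖ < inner ℝ (R z) u' := by
      rw [hu', inner_smul_right, ← div_eq_inv_mul, lt_div_iff₀ hun]
    have h4 : (t * ‖z‖ * ‖v‖ < inner ℝ z v) ↔ t * ‖z‖ < inner ℝ z v' := by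
      rw [hv', inner_smul_right, ← div_eq_inv_mul, lt_div_iff₀ hvn]
    simp only [bandCone, Set.mem_ofPred_eq, Set.mem_preimage, mem_ball_zero_iff,
      LinearIsometryEquiv.norm_map, h1]
    rw [h3, h4, h2]
  rw [key]
  refine (R.measurePreserving.measure_preimage_emb R.toMeasurableEquiv.measurableEmbedding _).symm

/-- By `volume_bandCone_cap_eq` the measure of the cap does not depend on the direction `u ∈ W`, so
it is an average over all directions in `W`. Exchanging the order of integration leaves, for each
point of the band cone, a cap in the space `W`. -/
theorem volume_bandCone_cap_le {ι : Type*} [Countable ι] (b : ι → E) (ε : ℝ) {t : ℝ}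
    (ht0 : 0 ≤ t) (ht : t ^ 2 ≤ 1 / 2) (W : Submodule ℝ E)
    (hW : ∀ w ∈ W, ∀ i, inner ℝ (b i) w = 0) {u : E} (hu : u ∈ W) (hu0 : u ≠ 0) :
    volume {z | z ∈ bandCone b ε ∧ t * ‖z‖ * ‖u‖ < inner ℝ z u} ≤
      ENNReal.ofReal (√(1 - t ^ 2) ^ finrank ℝ W) * volume (bandCone b ε) := by
  have hnt : Nontrivial W := ⟨⟨⟨u, hu⟩, 0, fun h => hu0 (congrArg Subtype.val h)⟩⟩
  set S : Set (E × W) := {p | p.1 ∈ bandCone b ε ∧ p.2 ∈ ball (0 : W) 1 ∧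
    t * ‖p.1‖ * ‖p.2‖ < inner ℝ p.1 (p.2 : E)} with hS
  have hSm : MeasurableSet S := by
    have h : S = (Prod.fst ⁻¹' bandCone b ε) ∩ ((Prod.snd ⁻¹' ball (0 : W) 1) ∩
      {p : E × W | t * ‖p.1‖ * ‖p.2‖ < inner ℝ p.1 (p.2 : E)}) := rfl
    rw [h]
    refine (measurable_fst (measurableSet_bandCone b ε)).inter
      ((measurable_snd measurableSet_ball).inter ?_)
    exact (isOpen_lt (by fun_prop) (by fun_prop)).measurableSet
  set m := volume {z | z ∈ bandCone b ε ∧ t * ‖z‖ * ‖u‖ < inner ℝ z u} with hm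
  set c := ENNReal.ofReal (√(1 - t ^ 2) ^ finrank ℝ W) with hc
  set B := volume (ball (0 : W) 1) with hB
  have hB0 : B ≠ 0 := (measure_ball_pos _ _ one_pos).ne'
  have hBt : B ≠ ⊤ := measure_ball_lt_top.ne
  have h1 : (volume.prod volume : Measure (E × W)) S = m * B := by
    rw [Measure.prod_apply_symm hSm]
    have : ∀ᵐ w : W, volume ((fun x => (x, w)) ⁻¹' S) =
        (ball (0 : W) 1).indicator (fun _ => m) w := by
      have h0 : ∀ᵐ w : W, w ≠ 0 := by
        rw [ae_iff]; simp
      filter_upwards [h0] with w hw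
      by_cases hwB : w ∈ ball (0 : W) 1
      · rw [Set.indicator_of_mem hwB, hm, volume_bandCone_cap_eq b ε t (hW u hu) (hW w w.2) hu0
          (fun h => hw (Subtype.ext h))]
        congr 1
        ext z
        simp only [hS, Set.mem_preimage, Set.mem_ofPred_eq, hwB, true_and]
        rfl
      · rw [Set.indicator_of_notMem hwB]
        convert measure_empty (μ := (volume : Measure E))
        ext z
        simp only [hS, Set.mem_preimage, Set.mem_ofPred_eq, hwB, false_and, and_false,
          Set.mem_empty_iff_false]
    rw [lintegral_congr_ae this, lintegral_indicator measurableSet_ball, setLIntegral_const]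
  have h2 : (volume.prod volume : Measure (E × W)) S ≤ c * B * volume (bandCone b ε) := by
    rw [Measure.prod_apply hSm]
    have : ∀ z : E, volume (Prod.mk z ⁻¹' S) ≤ (bandCone b ε).indicator (fun _ => c * B) z := by
      intro z
      by_cases hz : z ∈ bandCone b ε
      · rw [Set.indicator_of_mem hz]
        refine le_trans (measure_mono ?_) (volume_cap_le (W.orthogonalProjectionOnto z) ht0 ht)
        rintro w ⟨-, hw, hlt⟩
        refine ⟨hw, ?_⟩
        have e1 : inner ℝ (W.orthogonalProjectionOnto z) w = inner ℝ z (w : E) := by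
          simp
        rw [e1]
        refine lt_of_le_of_lt ?_ hlt
        have : ‖W.orthogonalProjectionOnto z‖ ≤ ‖z‖ := W.norm_orthogonalProjectionOnto_apply_le z
        gcongr
      · rw [Set.indicator_of_notMem hz]
        have : Prod.mk z ⁻¹' S = ∅ := by ext w; simp [hS, hz]
        rw [this]; simp
    refine (lintegral_mono this).trans ?_
    rw [lintegral_indicator (measurableSet_bandCone b ε), setLIntegral_const]
  have h3 : m * B ≤ (c * volume (bandCone b ε)) * B := by
    rw [← h1]; refine h2.trans_eq ?_; ring
  exact (ENNReal.mul_le_mul_iff_left hB0 hBt).1 h3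

/-- Stretching `V` by `1 / ρ` and then shrinking everything by `√2` maps the points of the band cone
with a short projection to `V` back into the band cone. The bound is the inverse of the determinant
of this map. -/
theorem volume_bandCone_small_projection_le {ι : Type*} (b : ι → E) {ε : ℝ} (hε : 0 ≤ ε)
    {ρ : ℝ} (hρ0 : 0 < ρ) (hρ1 : ρ ≤ 1) (V : Submodule ℝ E)
    (hV : ∀ w ∈ V, ∀ i, inner ℝ (b i) w = 0) :
    volume {z | z ∈ bandCone b ε ∧ ‖V.starProjection z‖ ≤ ρ * ‖z‖} ≤
      ENNReal.ofReal (√2 ^ finrank ℝ E * ρ ^ finrank ℝ V) * volume (bandCone b ε) := by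
  set P := V.starProjection with hP
  set T : E →ₗ[ℝ] E := (1 / √2) • (LinearMap.id + (1 / ρ - 1) • (P : E →L[ℝ] E).toLinearMap) with hT
  set S := {z | z ∈ bandCone b ε ∧ ‖P z‖ ≤ ρ * ‖z‖} with hS
  have h2 : (0 : ℝ) < √2 := by positivity
  have hdet : LinearMap.det T = (√2 ^ finrank ℝ E * ρ ^ finrank ℝ V)⁻¹ := by
    rw [hT, LinearMap.det_smul, det_id_add_smul_starProjection]
    rw [mul_inv, add_sub_cancel, one_div, one_div, inv_pow, inv_pow]
  have hTz : ∀ z, T z = (1 / √2) • (z + (1 / ρ - 1) • P z) := fun z => by simp [hT]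
  have hr : 0 ≤ 1 / ρ - 1 := by rw [sub_nonneg, le_div_iff₀ hρ0]; linarith
  have hnorm : ∀ z, ‖T z‖ ^ 2 = (1 / 2) * (‖z‖ ^ 2 + ((1 / ρ) ^ 2 - 1) * ‖P z‖ ^ 2) := by
    intro z
    have e : inner ℝ z (P z) = ‖P z‖ ^ 2 := by
      rw [real_inner_comm]
      exact Submodule.re_inner_starProjection_eq_normSq (𝕜 := ℝ) (K := V) z
    rw [hTz, norm_smul, mul_pow, norm_add_sq_real, inner_smul_right, norm_smul, e]
    simp only [Real.norm_eq_abs, abs_of_nonneg hr, abs_of_pos (one_div_pos.2 h2), mul_pow, div_pow,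
      Real.sq_sqrt zero_le_two]
    ring
  have hsub : T '' S ⊆ bandCone b ε := by
    rintro _ ⟨z, ⟨⟨hz1, hzb⟩, hzP⟩, rfl⟩
    rw [mem_ball_zero_iff] at hz1
    have hge : ‖z‖ ≤ √2 * ‖T z‖ := by
      rw [← abs_of_nonneg (norm_nonneg z), ← abs_of_nonneg (by positivity : 0 ≤ √2 * ‖T z‖)]
      refine sq_le_sq.1 ?_
      rw [mul_pow, hnorm, Real.sq_sqrt zero_le_two]
      have : 0 ≤ (1 / ρ) ^ 2 - 1 := by nlinarith
      nlinarith [mul_nonneg this (sq_nonneg ‖P z‖)]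
    refine ⟨?_, fun i => ?_⟩
    · rw [mem_ball_zero_iff]
      refine lt_of_le_of_lt ?_ hz1
      rw [← abs_of_nonneg (norm_nonneg z), ← abs_of_nonneg (norm_nonneg (T z))]
      refine sq_le_sq.1 ?_
      rw [hnorm]
      have h3 : (1 / ρ) ^ 2 * ‖P z‖ ^ 2 ≤ ‖z‖ ^ 2 := by
        rw [← mul_pow]
        refine pow_le_pow_left₀ (by positivity) ?_ 2
        rw [one_div, inv_mul_le_iff₀ hρ0]; exact hzP
      nlinarith [sq_nonneg ‖P z‖]
    · have hPi : inner ℝ (b i) (P z) = 0 := hV _ (Submodule.starProjection_apply_mem V z) i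
      rw [hTz, inner_smul_right, inner_add_right, inner_smul_right, hPi, mul_zero, add_zero,
        abs_mul, abs_of_pos (one_div_pos.2 h2), ← hTz, one_div, inv_mul_le_iff₀ h2]
      refine (hzb i).trans ?_
      calc ε * ‖z‖ ≤ ε * (√2 * ‖T z‖) := by gcongr
        _ = _ := by ring
  have h := (Measure.addHaar_image_linearMap volume T S).symm.trans_le (measure_mono hsub)
  have hpos : 0 < √2 ^ finrank ℝ E * ρ ^ finrank ℝ V := by positivity
  rw [hdet, abs_of_pos (inv_pos.2 hpos), ENNReal.ofReal_inv_of_pos hpos] at h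
  exact (ENNReal.inv_mul_le_iff (by simpa using hpos) ENNReal.ofReal_ne_top).1 h

end Cones

/-! ### The law of a hint -/

section Hints

open Module Metric
open scoped Pointwise

variable {d : ℕ}

theorem norm_starProjection_mono {U V : Submodule ℝ (Vec d)} (h : U ≤ V) (x : Vec d) :
    ‖U.starProjection x‖ ≤ ‖V.starProjection x‖ := by
  have h1 := Submodule.starProjection_comp_starProjection_of_le h
  have h2 : U.starProjection x = U.starProjection (V.starProjection x) :=
    (DFunLike.congr_fun h1 x).symm
  rw [h2]
  exact Submodule.norm_starProjection_apply_le _ _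

/-- The surface measure of a set of directions is the volume of the cone over it, up to the
factor `d`. -/
theorem surface_cone (hd : 0 < d) {Q : Vec d → Prop} (hQm : MeasurableSet {z | Q z})
    (hQ : ∀ (r : ℝ) (z : Vec d), 0 < r → (Q (r • z) ↔ Q z)) :
    surface d {y | Q y} = d * volume {z : Vec d | z ∈ ball (0 : Vec d) 1 ∧ Q z} := by
  have : Nonempty (Fin d) := ⟨⟨0, hd⟩⟩
  have hm : MeasurableSet {y : Sphere d | Q y} := measurable_subtype_coe hQm
  rw [surface, Measure.toSphere_apply' _ hm, finrank_euclideanSpace_fin]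
  congr 1
  have hset : Set.Ioo (0 : ℝ) 1 • (Subtype.val '' {y : Sphere d | Q y}) =
      {z : Vec d | z ∈ ball (0 : Vec d) 1 ∧ Q z} \ {0} := by
    ext z
    simp only [Set.mem_smul, Set.mem_image, Set.mem_ofPred_eq, Set.mem_sdiff,
      Set.mem_singleton_iff, mem_ball_zero_iff]
    constructor
    · rintro ⟨r, hr, _, ⟨y, hy, rfl⟩, rfl⟩
      have hy1 : ‖(y : Vec d)‖ = 1 := mem_sphere_zero_iff_norm.1 y.2
      refine ⟨⟨?_, (hQ r _ hr.1).2 hy⟩, ?_⟩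
      · rw [norm_smul, hy1, mul_one, Real.norm_eq_abs, abs_of_pos hr.1]; exact hr.2
      · intro h
        have := congrArg norm h
        rw [norm_smul, hy1, mul_one, norm_zero, Real.norm_eq_abs, abs_of_pos hr.1] at this
        exact hr.1.ne' this
    · rintro ⟨⟨h1, h2⟩, h3⟩
      have hz : 0 < ‖z‖ := norm_pos_iff.2 h3
      refine ⟨‖z‖, ⟨hz, h1⟩, ‖z‖⁻¹ • z, ⟨⟨‖z‖⁻¹ • z, ?_⟩, ?_, rfl⟩, ?_⟩
      · rw [mem_sphere_zero_iff_norm, norm_smul, norm_inv, norm_norm, inv_mul_cancel₀ hz.ne']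
      · exact (hQ _ _ (inv_pos.2 hz)).2 h2
      · rw [smul_smul, mul_inv_cancel₀ hz.ne', one_smul]
  rw [hset, measure_sdiff_null (measure_singleton _)]

/-- The Gram-Schmidt orthonormalization of a list. -/
noncomputable abbrev gs (xs : List (Vec d)) (r : Fin xs.length) : Vec d :=
  InnerProductSpace.gramSchmidtNormed ℝ xs.get r

/-- The span of a list of vectors. -/
abbrev listSpan (xs : List (Vec d)) : Submodule ℝ (Vec d) := Submodule.span ℝ {y | y ∈ xs}

theorem span_gs (xs : List (Vec d)) : Submodule.span ℝ (Set.range (gs xs)) = listSpan xs := by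
  rw [InnerProductSpace.span_gramSchmidtNormed_range, InnerProductSpace.span_gramSchmidt]
  congr 1
  ext y
  simp [List.mem_iff_get]

theorem gs_mem (xs : List (Vec d)) (r : Fin xs.length) : gs xs r ∈ listSpan xs := by
  rw [← span_gs]; exact Submodule.subset_span ⟨r, rfl⟩

theorem finrank_listSpan_le (xs : List (Vec d)) : finrank ℝ (listSpan xs) ≤ xs.length := by
  rw [← span_gs]
  exact (finrank_range_le_card (R := ℝ) (gs xs)).trans_eq (by simp)

theorem inner_gs_gs (xs : List (Vec d)) {i j : Fin xs.length} (h : i ≠ j) :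
    inner ℝ (gs xs i) (gs xs j) = 0 := by
  simp only [gs, InnerProductSpace.gramSchmidtNormed, inner_smul_left, inner_smul_right,
    InnerProductSpace.gramSchmidt_orthogonal ℝ xs.get h, mul_zero]

theorem norm_gs_le (xs : List (Vec d)) (i : Fin xs.length) : ‖gs xs i‖ ≤ 1 := by
  by_cases h : gs xs i = 0
  · rw [h, norm_zero]; exact zero_le_one
  · exact (InnerProductSpace.gramSchmidtNormed_unit_length' h).le

theorem starProjection_listSpan (xs : List (Vec d)) (y : Vec d) :
    (listSpan xs).starProjection y = ∑ i, (inner ℝ (gs xs i) y : ℝ) • gs xs i := by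
  refine Submodule.eq_starProjection_of_mem_of_inner_eq_zero
    (Submodule.sum_mem _ fun i _ => Submodule.smul_mem _ _ (gs_mem xs i)) ?_
  intro w hw
  rw [← span_gs] at hw
  induction hw using Submodule.span_induction with
  | mem w hw =>
    obtain ⟨j, rfl⟩ := hw
    rw [inner_sub_left, sum_inner, Finset.sum_eq_single j, inner_smul_left, real_inner_comm y]
    · by_cases h : gs xs j = 0
      · simp [h]
      · rw [real_inner_self_eq_norm_sq, InnerProductSpace.gramSchmidtNormed_unit_length' h]
        simp
    · intro i _ hij
      rw [inner_smul_left, inner_gs_gs xs hij, mul_zero]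
    · simp
  | zero => simp
  | add a b _ _ ha hb => rw [inner_add_right, ha, hb, add_zero]
  | smul a x _ hx => rw [inner_smul_right, hx, mul_zero]

theorem norm_starProjection_le_of_mem_band {xs : List (Vec d)} {y : Sphere d}
    (hy : y ∈ band d xs) :
    ‖(listSpan xs).starProjection (y : Vec d)‖ ≤ xs.length * (1 / (d : ℝ) ^ 3) := by
  rw [starProjection_listSpan]
  refine (norm_sum_le _ _).trans ?_
  refine (Finset.sum_le_card_nsmul _ _ (1 / (d : ℝ) ^ 3) fun i _ => ?_).trans_eq (by simp)
  rw [norm_smul, Real.norm_eq_abs]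
  have h1 := hy i
  have h2 := norm_gs_le xs i
  calc _ ≤ (1 / (d : ℝ) ^ 3) * 1 := by
        refine mul_le_mul h1 h2 (norm_nonneg _) (by positivity)
    _ = _ := mul_one _

theorem measurableSet_band (xs : List (Vec d)) : MeasurableSet (band d xs) := by
  have h : band d xs = ⋂ r, {z : Sphere d | |inner ℝ (gs xs r) (z : Vec d)| ≤ 1 / (d : ℝ) ^ 3} := by
    ext; simp [band]
  rw [h]
  exact MeasurableSet.iInter fun i => (isClosed_le (by fun_prop) (by fun_prop)).measurableSet

theorem exists_unit_orthogonal (V : Submodule ℝ (Vec d)) (h : finrank ℝ V < d) :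
    ∃ z : Vec d, ‖z‖ = 1 ∧ ∀ w ∈ V, inner ℝ w z = 0 := by
  have h1 := V.finrank_add_finrank_orthogonal
  rw [finrank_euclideanSpace_fin] at h1
  have : Nontrivial Vᗮ := (finrank_pos_iff (R := ℝ)).1 (by omega)
  obtain ⟨z, hz⟩ := exists_ne (0 : Vᗮ)
  have hz' : 0 < ‖(z : Vec d)‖ := norm_pos_iff.2 fun h => hz (Subtype.ext h)
  refine ⟨‖(z : Vec d)‖⁻¹ • (z : Vec d), ?_, fun w hw => ?_⟩
  · rw [norm_smul, norm_inv, norm_norm, inv_mul_cancel₀ hz'.ne']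
  · rw [inner_smul_right, Submodule.inner_right_of_mem_orthogonal hw z.2, mul_zero]

/-- A unit vector orthogonal to the list has a neighbourhood in the sphere that lies in the band. -/
theorem surface_band_ne_zero {xs : List (Vec d)} (h : xs.length < d) :
    surface d (band d xs) ≠ 0 := by
  obtain ⟨z, hz1, hz⟩ := exists_unit_orthogonal (listSpan xs)
    ((finrank_listSpan_le xs).trans_lt h)
  have hd : (0 : ℝ) < d := by exact_mod_cast (Nat.zero_le _).trans_lt h
  set U : Set (Sphere d) := ⋂ r, {z : Sphere d | |inner ℝ (gs xs r) (z : Vec d)| < 1 / (d : ℝ) ^ 3}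
  have hU : IsOpen U := isOpen_iInter_of_finite fun i => isOpen_lt (by fun_prop) (by fun_prop)
  have hUne : U.Nonempty := by
    refine ⟨⟨z, mem_sphere_zero_iff_norm.2 hz1⟩, Set.mem_iInter.2 fun i => ?_⟩
    simp only [Set.mem_ofPred_eq]
    rw [hz _ (gs_mem xs i), abs_zero]
    positivity
  have hsub : U ⊆ band d xs := fun y hy r => (Set.mem_iInter.1 hy r).le
  exact fun h0 => (hU.measure_ne_zero _ hUne) (measure_mono_null hsub h0)

theorem surface_band_eq (hd : 0 < d) (xs : List (Vec d)) :
    surface d (band d xs) = d * volume (bandCone (gs xs) (1 / (d : ℝ) ^ 3)) := by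
  have h : band d xs = {y : Sphere d | ∀ i, |inner ℝ (gs xs i) (y : Vec d)| ≤
      1 / (d : ℝ) ^ 3 * ‖(y : Vec d)‖} := by
    ext y
    simp [band]
  rw [h, surface_cone hd (Q := fun z => ∀ i, |inner ℝ (gs xs i) z| ≤ 1 / (d : ℝ) ^ 3 * ‖z‖)]
  · rfl
  · have : {z : Vec d | ∀ i, |inner ℝ (gs xs i) z| ≤ 1 / (d : ℝ) ^ 3 * ‖z‖} =
        ⋂ i, {z | |inner ℝ (gs xs i) z| ≤ 1 / (d : ℝ) ^ 3 * ‖z‖} := by ext; simp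
    rw [this]
    exact MeasurableSet.iInter fun i => (isClosed_le (by fun_prop) (by fun_prop)).measurableSet
  · intro r z hr
    refine forall_congr' fun i => ?_
    rw [inner_smul_right, norm_smul, abs_mul, Real.norm_eq_abs, mul_left_comm]
    exact mul_le_mul_iff_right₀ (abs_pos.2 hr.ne')

theorem surface_band_inter_eq (hd : 0 < d) (xs : List (Vec d)) {Q : Vec d → Prop}
    (hQm : MeasurableSet {z | Q z})
    (hQ : ∀ (r : ℝ) (z : Vec d), 0 < r → (Q (r • z) ↔ Q z)) :
    surface d (band d xs ∩ {y | Q y}) =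
      d * volume {z | z ∈ bandCone (gs xs) (1 / (d : ℝ) ^ 3) ∧ Q z} := by
  have h : band d xs ∩ {y | Q y} = {y : Sphere d | (∀ i, |inner ℝ (gs xs i) (y : Vec d)| ≤
      1 / (d : ℝ) ^ 3 * ‖(y : Vec d)‖) ∧ Q y} := by
    ext y
    simp [band]
  rw [h, surface_cone hd (Q := fun z => (∀ i, |inner ℝ (gs xs i) z| ≤ 1 / (d : ℝ) ^ 3 * ‖z‖) ∧ Q z)]
  · congr 2
    ext z
    simp only [bandCone, Set.mem_ofPred_eq, and_assoc]
  · have : {z : Vec d | (∀ i, |inner ℝ (gs xs i) z| ≤ 1 / (d : ℝ) ^ 3 * ‖z‖) ∧ Q z} =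
        (⋂ i, {z | |inner ℝ (gs xs i) z| ≤ 1 / (d : ℝ) ^ 3 * ‖z‖}) ∩ {z | Q z} := by ext; simp
    rw [this]
    exact (MeasurableSet.iInter fun i =>
      (isClosed_le (by fun_prop) (by fun_prop)).measurableSet).inter hQm
  · intro r z hr
    refine and_congr (forall_congr' fun i => ?_) (hQ r z hr)
    rw [inner_smul_right, norm_smul, abs_mul, Real.norm_eq_abs, mul_left_comm]
    exact mul_le_mul_iff_right₀ (abs_pos.2 hr.ne')

theorem hintLaw_eq {δ : ℝ} (D : Discretization d δ) {xs : List (Vec d)} (h : xs.length < d) :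
    hintLaw D xs =
      (PMF.ofFintype (fun i => ProbabilityTheory.cond (surface d) (band d xs) (D.cell i))
      (sum_cond_cell D (surface_band_ne_zero h))).map fun i => (D.rep i : Vec d) := by
  rw [hintLaw, dif_pos (surface_band_ne_zero h)]

/-- With no vectors to be orthogonal to, a hint is a uniformly random representative. -/
theorem hintLaw_nil {δ : ℝ} (hd : 0 < d) (D : Discretization d δ) :
    hintLaw D [] = D.uniform := by
  rw [hintLaw_eq D (by simpa using hd), Discretization.uniform]
  congr 1
  ext i
  have hb : band d [] = Set.univ := by
    ext z; simp [band]
  have hc : ∀ j, ProbabilityTheory.cond (surface d) (band d []) (D.cell j) =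
      ProbabilityTheory.cond (surface d) (band d []) (D.cell i) := by
    intro j
    rw [hb, ProbabilityTheory.cond_apply MeasurableSet.univ, Set.univ_inter, D.equal_area j i,
      ProbabilityTheory.cond_apply MeasurableSet.univ, Set.univ_inter]
  have hs := sum_cond_cell D (surface_band_ne_zero (xs := ([] : List (Vec d))) (by simpa using hd))
  simp only [hc, Finset.sum_const, Finset.card_univ, Fintype.card_fin, nsmul_eq_mul] at hs
  rw [PMF.ofFintype_apply, PMF.uniformOfFintype_apply, Fintype.card_fin]
  exact ENNReal.eq_inv_of_mul_eq_one_left (by rw [mul_comm]; exact hs)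

/-- A property `S` of a hint that implies a property `S'` of the points of the band in the same cell
is at most as probable as `S'` is for a uniform point of the band. -/
theorem hintLaw_toOuterMeasure_le {δ : ℝ} (D : Discretization d δ) {xs : List (Vec d)}
    (h : xs.length < d) (S : Set (Vec d)) (S' : Set (Sphere d)) {c : ENNReal}
    (hS : ∀ y ∈ band d xs, ∀ v ∈ S, ‖v - y‖ ≤ δ → y ∈ S')
    (hc : surface d (band d xs ∩ S') ≤ c * surface d (band d xs)) :
    (hintLaw D xs).toOuterMeasure S ≤ c := by
  rw [hintLaw_eq D h, PMF.toOuterMeasure_map_apply, PMF.toOuterMeasure_ofFintype_apply]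
  set I := (fun i => (D.rep i : Vec d)) ⁻¹' S with hI
  have h1 : ∑' i, I.indicator
      (fun i => ProbabilityTheory.cond (surface d) (band d xs) (D.cell i)) i =
      ProbabilityTheory.cond (surface d) (band d xs) (⋃ i : I, D.cell i) := by
    rw [measure_iUnion (fun i j hij => D.disjoint_cell fun e => hij (Subtype.ext e))
      fun i => D.measurableSet_cell i]
    exact (tsum_subtype I fun i =>
      ProbabilityTheory.cond (surface d) (band d xs) (D.cell i)).symm
  rw [h1, ProbabilityTheory.cond_apply (measurableSet_band xs)]
  have h2 : band d xs ∩ ⋃ i : I, D.cell i ⊆ band d xs ∩ S' := by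
    rintro y ⟨hy, hyU⟩
    obtain ⟨⟨i, hi⟩, hyi⟩ := Set.mem_iUnion.1 hyU
    refine ⟨hy, hS y hy _ hi ?_⟩
    rw [← dist_eq_norm]
    exact D.dist_le i _ (D.rep_mem i) _ hyi
  have hne := surface_band_ne_zero h
  have hnt : surface d (band d xs) ≠ ⊤ := measure_ne_top _ _
  calc _ ≤ (surface d (band d xs))⁻¹ * (c * surface d (band d xs)) := by
        gcongr
        exact (measure_mono h2).trans hc
    _ = c := by
        rw [mul_comm c, ← mul_assoc, ENNReal.inv_mul_cancel hne hnt, one_mul]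

theorem exists_band_of_mem_support {δ : ℝ} (D : Discretization d δ) {xs : List (Vec d)}
    (h : xs.length < d) {v : Vec d} (hv : v ∈ (hintLaw D xs).support) :
    ‖v‖ = 1 ∧ ∃ y ∈ band d xs, ‖v - y‖ ≤ δ := by
  rw [hintLaw_eq D h, PMF.support_map] at hv
  obtain ⟨i, hi, rfl⟩ := hv
  refine ⟨mem_sphere_zero_iff_norm.1 (D.rep i).2, ?_⟩
  rw [PMF.mem_support_iff, PMF.ofFintype_apply, ProbabilityTheory.cond_apply
    (measurableSet_band xs)] at hi
  have hi' : (band d xs ∩ D.cell i).Nonempty :=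
    nonempty_of_measure_ne_zero (right_ne_zero_of_mul hi)
  obtain ⟨y, hy, hyi⟩ := hi'
  exact ⟨y, hy, by rw [← dist_eq_norm]; exact D.dist_le i _ (D.rep_mem i) _ hyi⟩

/-- Hints are unit vectors that are nearly orthogonal to the submitted vectors. -/
theorem hintLaw_support (D : Discretization d (mesh d)) {xs : List (Vec d)}
    (h : xs.length < d) {v : Vec d} (hv : v ∈ (hintLaw D xs).support) :
    ‖v‖ = 1 ∧ ‖(listSpan xs).starProjection v‖ ≤ (xs.length + 1) / (d : ℝ) ^ 3 := by
  obtain ⟨h1, y, hy, hvy⟩ := exists_band_of_mem_support D h hv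
  refine ⟨h1, ?_⟩
  have h2 := norm_starProjection_le_of_mem_band hy
  have h3 : ‖(listSpan xs).starProjection (v - y)‖ ≤ mesh d :=
    (Submodule.norm_starProjection_apply_le _ _).trans hvy
  have h4 : (listSpan xs).starProjection v = (listSpan xs).starProjection (v - y) +
      (listSpan xs).starProjection (y : Vec d) := by rw [← map_add, sub_add_cancel]
  rw [h4]
  refine (norm_add_le _ _).trans ((add_le_add h3 h2).trans_eq ?_)
  rw [mesh]; ring

/-- A hint is unlikely to be correlated with a fixed vector. -/
theorem hintLaw_tail (D : Discretization d (mesh d)) {xs : List (Vec d)} (h : xs.length < d)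
    (X : Vec d) {s : ℝ} (hs0 : 0 ≤ s) (hs : s ^ 2 ≤ 1 / 2) :
    (hintLaw D xs).toOuterMeasure
      {v | (s + (xs.length + 1) / (d : ℝ) ^ 3) * ‖X‖ < inner ℝ v X} ≤
      ENNReal.ofReal (√(1 - s ^ 2) ^ (d - xs.length)) := by
  have hd : 0 < d := (Nat.zero_le _).trans_lt h
  set E := listSpan xs with hE
  set u := Eᗮ.starProjection X with hu
  have hX : X = E.starProjection X + u := (E.starProjection_add_starProjection_orthogonal X).symm
  have hEX : ‖E.starProjection X‖ ≤ ‖X‖ := Submodule.norm_starProjection_apply_le _ _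
  have huX : ‖u‖ ≤ ‖X‖ := Submodule.norm_starProjection_apply_le _ _
  have huE : u ∈ Eᗮ := Submodule.starProjection_apply_mem _ _
  have hself : ∀ y : Vec d, inner ℝ y (E.starProjection X) ≤ ‖E.starProjection y‖ * ‖X‖ := by
    intro y
    have : inner ℝ y (E.starProjection X) = inner ℝ (E.starProjection y) X :=
      (Submodule.inner_starProjection_left_eq_right E y X).symm
    rw [this]
    exact real_inner_le_norm _ _
  refine hintLaw_toOuterMeasure_le D h _ {y | s * ‖(y : Vec d)‖ * ‖u‖ < inner ℝ (y : Vec d) u} ?_ ?_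
  · intro y hy v hv hvy
    have hy1 : ‖(y : Vec d)‖ = 1 := mem_sphere_zero_iff_norm.1 y.2
    have h1 := norm_starProjection_le_of_mem_band hy
    have h2 : inner ℝ (v - y) X ≤ mesh d * ‖X‖ :=
      (real_inner_le_norm _ _).trans (by gcongr)
    rw [inner_sub_left] at h2
    have h3 := hself y
    have h4 : inner ℝ (y : Vec d) X =
        inner ℝ (y : Vec d) (E.starProjection X) + inner ℝ (y : Vec d) u := by
      rw [← inner_add_right, ← hX]
    have h5 : ‖E.starProjection (y : Vec d)‖ * ‖X‖ ≤ (xs.length * (1 / (d : ℝ) ^ 3)) * ‖X‖ := by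
      gcongr
    simp only [Set.mem_ofPred_eq] at hv ⊢
    rw [hy1, mul_one]
    have h6 : s * ‖u‖ ≤ s * ‖X‖ := by gcongr
    have h7 : (s + (xs.length + 1) / (d : ℝ) ^ 3) * ‖X‖ =
      s * ‖X‖ + xs.length * (1 / (d : ℝ) ^ 3) * ‖X‖ + mesh d * ‖X‖ := by rw [mesh]; ring
    linarith
  · rw [surface_band_eq hd, surface_band_inter_eq hd xs
      (Q := fun z => s * ‖z‖ * ‖u‖ < inner ℝ z u)]
    · rw [mul_left_comm]
      gcongr
      by_cases hu0 : u = 0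
      · simp [hu0]
      · refine (volume_bandCone_cap_le (gs xs) _ hs0 hs Eᗮ ?_ huE hu0).trans ?_
        · intro w hw i
          exact Submodule.inner_right_of_mem_orthogonal (gs_mem xs i) hw
        · gcongr ENNReal.ofReal ?_ * _
          refine pow_le_pow_of_le_one (Real.sqrt_nonneg _) ?_ ?_
          · refine Real.sqrt_le_one.2 ?_; nlinarith
          · have := E.finrank_add_finrank_orthogonal
            rw [finrank_euclideanSpace_fin] at this
            have : finrank ℝ E ≤ xs.length := finrank_listSpan_le xs
            omega
    · exact (isOpen_lt (by fun_prop) (by fun_prop)).measurableSet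
    · intro r z hr
      rw [norm_smul, inner_smul_left, Real.norm_eq_abs, abs_of_pos hr]
      have : s * (r * ‖z‖) * ‖u‖ = r * (s * ‖z‖ * ‖u‖) := by ring
      rw [this]
      exact mul_lt_mul_iff_right₀ hr

/-- A hint is unlikely to have a short projection to a fixed space of large dimension. -/
theorem hintLaw_small_projection (D : Discretization d (mesh d)) {xs : List (Vec d)}
    (h : xs.length < d) (V : Submodule ℝ (Vec d)) {ρ : ℝ} (hρ0 : 0 < ρ) (hρ1 : ρ ≤ 1) {N : ℕ}
    (hN : N + xs.length ≤ finrank ℝ V) :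
    (hintLaw D xs).toOuterMeasure {v | ‖V.starProjection v‖ < ρ - mesh d} ≤
      ENNReal.ofReal (√2 ^ d * ρ ^ N) := by
  have hd : 0 < d := (Nat.zero_le _).trans_lt h
  set E := listSpan xs with hE
  set V' := V ⊓ Eᗮ with hV'
  refine hintLaw_toOuterMeasure_le D h _
    {y | ‖V'.starProjection (y : Vec d)‖ ≤ ρ * ‖(y : Vec d)‖} ?_ ?_
  · intro y hy v hv hvy
    have hy1 : ‖(y : Vec d)‖ = 1 := mem_sphere_zero_iff_norm.1 y.2
    simp only [Set.mem_ofPred_eq] at hv ⊢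
    rw [hy1, mul_one]
    have h2 : ‖V'.starProjection (y : Vec d)‖ ≤ ‖V.starProjection (y : Vec d)‖ :=
      norm_starProjection_mono inf_le_left _
    have h3 : V.starProjection (y : Vec d) = V.starProjection v - V.starProjection (v - y) := by
      rw [← map_sub, sub_sub_cancel]
    have h4 : ‖V.starProjection (v - y)‖ ≤ mesh d :=
      (Submodule.norm_starProjection_apply_le _ _).trans hvy
    have h5 := norm_sub_le (V.starProjection v) (V.starProjection (v - y))
    rw [← h3] at h5
    linarith
  · rw [surface_band_eq hd, surface_band_inter_eq hd xs
      (Q := fun z => ‖V'.starProjection z‖ ≤ ρ * ‖z‖)]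
    · rw [mul_left_comm]
      gcongr
      refine (volume_bandCone_small_projection_le (gs xs) (by positivity) hρ0 hρ1 V' ?_).trans ?_
      · intro w hw i
        exact Submodule.inner_right_of_mem_orthogonal (gs_mem xs i) hw.2
      · rw [finrank_euclideanSpace_fin]
        gcongr ENNReal.ofReal (_ * ?_) * _
        refine pow_le_pow_of_le_one hρ0.le hρ1 ?_
        have h1 := E.finrank_add_finrank_orthogonal
        rw [finrank_euclideanSpace_fin] at h1
        have h2 : finrank ℝ E ≤ xs.length := finrank_listSpan_le xs
        have h3 := Submodule.finrank_sup_add_finrank_inf_eq V Eᗮ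
        have h4 : finrank ℝ ↥(V ⊔ Eᗮ) ≤ d := by
          simpa using Submodule.finrank_le (V ⊔ Eᗮ)
        have h5 : finrank ℝ V' = finrank ℝ ↥(V ⊓ Eᗮ) := rfl
        omega
    · exact (isClosed_le (by fun_prop) (by fun_prop)).measurableSet
    · intro r z hr
      rw [map_smul, norm_smul, norm_smul, Real.norm_eq_abs, mul_left_comm]
      exact mul_le_mul_iff_right₀ (abs_pos.2 hr.ne')

end Hints

/-! ### Numerical facts about the parameters -/

/-- The range of parameters in which there is at least one period. It forces `d` to be large and
`k` to be small compared to `d`. -/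
structure Regime (d k : ℕ) : Prop where
  one_le_k : 1 ≤ k
  k_le : (k : ℝ) ≤ (d : ℝ) / 3 - 1
  one_le_pMax : 1 ≤ pMax d k

namespace Regime

variable {d k : ℕ} (h : Regime d k)
include h

theorem six_le : (6 : ℝ) ≤ d := by
  have h1 : (1 : ℝ) ≤ k := by exact_mod_cast h.one_le_k
  linarith [h.k_le]

theorem d_pos : (0 : ℝ) < d := by linarith [h.six_le]

theorem one_le_log : 1 ≤ Real.log d := by
  rw [Real.le_log_iff_exp_le h.d_pos]
  linarith [Real.exp_one_lt_d9, h.six_le]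

theorem pMax_mul_add_one_le :
    (pMax d k : ℝ) * k + 1 ≤ d / (8100 * Real.log d ^ 2) := by
  have hk : (0 : ℝ) < k := by exact_mod_cast h.one_le_k
  have h1 := (Nat.le_floor_iff' (by have := h.one_le_pMax; omega)).1 (le_refl (pMax d k))
  have h2 := h1.trans (min_le_left _ _)
  rw [le_div_iff₀ hk] at h2
  have h3 : (1 / (90 ^ 2 * Real.log d ^ 2) * d : ℝ) = d / (8100 * Real.log d ^ 2) := by
    rw [one_div, mul_comm, ← div_eq_mul_inv]; norm_num
  rw [h3] at h2
  linarith

theorem pMax_add_one_pow_le :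
    ((pMax d k : ℝ) + 1) ^ 3 * k ≤ d / (81 ^ 3 * Real.log d ^ 2) := by
  have hk : (0 : ℝ) < k := by exact_mod_cast h.one_le_k
  have hL : 0 < Real.log d := zero_lt_one.trans_le h.one_le_log
  have hd := h.d_pos
  have h1 := (Nat.le_floor_iff' (by have := h.one_le_pMax; omega)).1 (le_refl (pMax d k))
  have h2 := h1.trans (min_le_right _ _)
  have h3 : (pMax d k : ℝ) + 1 ≤
    1 / (81 * Real.log d ^ (2 / 3 : ℝ)) * ((d : ℝ) / k) ^ (1 / 3 : ℝ) := by linarith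
  have h4 := pow_le_pow_left₀ (by positivity) h3 3
  have e1 : (((d : ℝ) / k) ^ (1 / 3 : ℝ)) ^ 3 = d / k := by
    rw [← Real.rpow_natCast, ← Real.rpow_mul (by positivity)]; norm_num
  have e2 : (Real.log d ^ (2 / 3 : ℝ)) ^ 3 = Real.log d ^ 2 := by
    rw [← Real.rpow_natCast, ← Real.rpow_mul hL.le, ← Real.rpow_natCast]; norm_num
  rw [mul_pow, div_pow, mul_pow, e1, e2, one_pow] at h4
  calc _ ≤ (1 / (81 ^ 3 * Real.log d ^ 2) * (d / k)) * k := by gcongr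
    _ = _ := by field_simp

theorem log_le : 8100 * (2 * Real.log d ^ 2) ≤ d := by
  have h1 := h.pMax_mul_add_one_le
  have h2 : (1 : ℝ) ≤ pMax d k := by exact_mod_cast h.one_le_pMax
  have h3 : (1 : ℝ) ≤ k := by exact_mod_cast h.one_le_k
  have h4 : (1 : ℝ) ≤ pMax d k * k := by nlinarith
  have hL : 0 < Real.log d := zero_lt_one.trans_le h.one_le_log
  rw [le_div_iff₀ (by positivity)] at h1
  nlinarith [sq_nonneg (Real.log d)]

theorem d_large : (16200 : ℝ) ≤ d := by
  nlinarith [h.log_le, h.one_le_log]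

theorem pMax_mul_add_one_le' : (pMax d k : ℝ) * k + 1 ≤ d / 8100 := by
  refine h.pMax_mul_add_one_le.trans ?_
  have := h.d_pos
  have := h.one_le_log
  gcongr
  nlinarith

theorem pMax_mul_add_one_le_nat : 8100 * (pMax d k * k + 1) ≤ d := by
  have := h.pMax_mul_add_one_le'
  have h2 : (8100 * (pMax d k * k + 1) : ℝ) ≤ d := by linarith
  exact_mod_cast h2

theorem pMax_le : 8100 * pMax d k ≤ d := by
  have h1 := h.pMax_mul_add_one_le_nat
  have h2 := Nat.le_mul_of_pos_right (pMax d k) h.one_le_k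
  omega

theorem k_le_nat : 8100 * k ≤ d := by
  have h1 := h.pMax_mul_add_one_le_nat
  have h2 := Nat.le_mul_of_pos_left k h.one_le_pMax
  omega

theorem sqrt_log_div_pos : 0 < √(Real.log d / d) := by
  have := h.d_pos
  have := h.one_le_log
  positivity

theorem inv_le_sqrt : 1 / (d : ℝ) ≤ √(Real.log d / d) := by
  have hd := h.d_pos
  have := h.one_le_log
  refine Real.le_sqrt_of_sq_le ?_
  rw [div_pow, one_pow, div_le_div_iff₀ (by positivity) hd]
  nlinarith [h.six_le]

theorem eta_pos : 0 < eta d := by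
  have := h.d_pos
  unfold eta; positivity

theorem gamma1_pos : 0 < gamma1 d := by
  have := h.sqrt_log_div_pos
  unfold gamma1; positivity

theorem gamma2_pos : 0 < gamma2 d := by
  have := h.gamma1_pos
  have := h.d_pos
  unfold gamma2; positivity

theorem gamma2_le : gamma2 d ≤ 1 := by
  have hd := h.d_large
  have hL := h.one_le_log
  have h1 : √(Real.log d / d) ≤ 1 := by
    rw [Real.sqrt_le_one, div_le_one h.d_pos]
    nlinarith [h.log_le]
  rw [gamma2, gamma1, div_le_one (by linarith)]
  linarith

/-- Within a period the levels `l γ₂` stay below `γ₁ / 4`. -/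
theorem gamma2_mul_le : (k : ℝ) * gamma2 d + gamma2 d / 2 ≤ gamma1 d / 4 := by
  have hd := h.d_pos
  have h1 := h.k_le
  have h2 := h.gamma1_pos
  have h3 : (k : ℝ) * gamma2 d + gamma2 d / 2 = (k + 1 / 2) / d * (gamma1 d / 4) := by
    unfold gamma2; field_simp
  rw [h3]
  refine mul_le_of_le_one_left (by positivity) ?_
  rw [div_le_one hd]; linarith

/-- The width of the bands and the mesh of the discretization are negligible compared to `γ₂`. -/
theorem hint_error_le : ((k : ℝ) + 1) / (d : ℝ) ^ 3 ≤ gamma2 d / 8 := by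
  have hd := h.d_pos
  have h1 := h.k_le
  have h2 := h.inv_le_sqrt
  have h3 : 3 / (d : ℝ) ^ 2 ≤ gamma2 d := by
    have : gamma2 d = 3 * √(Real.log d / d) / d := by unfold gamma2 gamma1; ring
    rw [this]
    calc 3 / (d : ℝ) ^ 2 = 3 * (1 / d) / d := by field_simp
      _ ≤ _ := by gcongr
  calc ((k : ℝ) + 1) / (d : ℝ) ^ 3 ≤ (d / 3) / (d : ℝ) ^ 3 := by gcongr; linarith
    _ = (3 / (d : ℝ) ^ 2) / 9 := by field_simp; norm_num
    _ ≤ gamma2 d / 8 := by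
        have := h.gamma2_pos
        linarith

theorem mesh_le : mesh d ≤ 1 / 8 := by
  have hd := h.d_large
  unfold mesh
  refine one_div_le_one_div_of_le (by norm_num) ?_
  calc (8 : ℝ) ≤ 2 ^ 3 := by norm_num
    _ ≤ (d : ℝ) ^ 3 := by gcongr; linarith

/-- The threshold of `hintLaw_tail` for `s = 4 √(log d / d)` is at most `γ₁ / 2`. -/
theorem tail_threshold_le {r : ℕ} (hr : r ≤ k) :
    4 * √(Real.log d / d) + ((r : ℝ) + 1) / (d : ℝ) ^ 3 ≤ gamma1 d / 2 := by
  have h1 := h.hint_error_le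
  have h2 := h.gamma2_mul_le
  have h3 : ((r : ℝ) + 1) / (d : ℝ) ^ 3 ≤ ((k : ℝ) + 1) / (d : ℝ) ^ 3 := by
    have := h.d_pos
    gcongr
  have h4 : gamma1 d = 12 * √(Real.log d / d) := rfl
  have h5 := h.gamma2_pos
  have h6 := h.sqrt_log_div_pos
  have h7 : (1 : ℝ) ≤ k := by exact_mod_cast h.one_le_k
  nlinarith

theorem tail_sq_le : (4 * √(Real.log d / d)) ^ 2 ≤ 1 / 2 := by
  have hL := h.one_le_log
  have hd := h.d_pos
  rw [mul_pow, Real.sq_sqrt (by positivity), ← mul_div_assoc, div_le_div_iff₀ hd two_pos]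
  nlinarith [h.log_le]

theorem tail_bound_le {r : ℕ} (hr : r ≤ k) :
    √(1 - (4 * √(Real.log d / d)) ^ 2) ^ (d - r) ≤ 1 / (d : ℝ) ^ 5 := by
  have hL := h.one_le_log
  have hd := h.d_pos
  set L := Real.log d with hLdef
  have h1 : √(1 - (4 * √(L / d)) ^ 2) ≤ Real.exp (-(8 * L / d)) := by
    refine Real.sqrt_le_iff.2 ⟨(Real.exp_pos _).le, ?_⟩
    rw [mul_pow, Real.sq_sqrt (by positivity), ← Real.exp_nat_mul]
    have := Real.add_one_le_exp (-(16 * (L / d)))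
    have e : ((2 : ℕ) : ℝ) * -(8 * L / d) = -(16 * (L / d)) := by push_cast; ring
    rw [e]
    linarith
  have h2 := pow_le_pow_left₀ (Real.sqrt_nonneg _) h1 (d - r)
  refine h2.trans ?_
  rw [← Real.exp_nat_mul]
  have hkd := h.k_le_nat
  have h3 : (2 / 3 : ℝ) * d ≤ ((d - r : ℕ) : ℝ) := by
    rw [Nat.cast_sub (by omega)]
    have h4 : (8100 * k : ℝ) ≤ d := by exact_mod_cast hkd
    have h5 : (r : ℝ) ≤ k := by exact_mod_cast hr
    linarith
  have h6 : ((d - r : ℕ) : ℝ) * -(8 * L / d) ≤ -(5 * L) := by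
    have : (2 / 3 * d) * (8 * L / d) ≤ ((d - r : ℕ) : ℝ) * (8 * L / d) := by gcongr
    have e : (2 / 3 * d) * (8 * L / d) = 16 / 3 * L := by field_simp; norm_num
    linarith
  calc _ ≤ Real.exp (-(5 * L)) := Real.exp_le_exp.2 h6
    _ = 1 / (d : ℝ) ^ 5 := by
      rw [Real.exp_neg, one_div]
      congr 1
      have : (5 : ℝ) * L = ((5 : ℕ) : ℝ) * L := by norm_num
      rw [this, Real.exp_nat_mul, hLdef, Real.exp_log hd]

theorem small_projection_bound_le {N : ℕ} (hN : d ≤ 2 * N) :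
    √2 ^ d * (1 / 4 : ℝ) ^ N ≤ 1 / (d : ℝ) ^ 4 := by
  have hL := h.one_le_log
  have hd := h.d_pos
  have h2 : (1 : ℝ) ≤ √2 := Real.one_le_sqrt.2 (by norm_num)
  have h4 : (1 / 4 : ℝ) ^ N = (√2 ^ (4 * N))⁻¹ := by
    rw [pow_mul, show (4 : ℕ) = 2 * 2 by norm_num, pow_mul √2, Real.sq_sqrt (by norm_num), one_div,
      inv_pow]
    norm_num
  have h5 : √2 ^ (2 * d) ≤ √2 ^ (4 * N) := pow_le_pow_right₀ h2 (by omega)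
  have h6 : (d : ℝ) ^ 4 ≤ √2 ^ d := by
    have e1 : (d : ℝ) ^ 4 = Real.exp (4 * Real.log d) := by
      have : (4 : ℝ) * Real.log d = ((4 : ℕ) : ℝ) * Real.log d := by norm_num
      rw [this, Real.exp_nat_mul, Real.exp_log hd]
    have e2 : √2 ^ d = Real.exp (d * (Real.log 2 / 2)) := by
      rw [Real.exp_nat_mul, ← Real.log_sqrt (by norm_num), Real.exp_log (by positivity)]
    rw [e1, e2, Real.exp_le_exp]
    have h7 := Real.log_two_gt_d9
    nlinarith [h.log_le]
  have hpos : (0 : ℝ) < √2 ^ d := by positivity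
  rw [h4, ← div_eq_mul_inv, div_le_div_iff₀ (by positivity) (by positivity), one_mul]
  calc √2 ^ d * (d : ℝ) ^ 4 ≤ √2 ^ d * √2 ^ d := by gcongr
    _ = √2 ^ (2 * d) := by rw [← pow_add, two_mul]
    _ ≤ _ := h5

/-- The depth reached by a combination of `N ≤ pMax * k + 1` nearly orthogonal vectors exceeds
`(pMax + 1) γ₁`. -/
theorem depth_lt {N : ℕ} (hN : N ≤ pMax d k * k + 1) :
    √N * (gamma1 d / 2) + √N * ((pMax d k + 1) * gamma1 d) < 1 / 8 := by
  have hL := h.one_le_log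
  have hd := h.d_pos
  set P : ℝ := ((pMax d k : ℕ) : ℝ) with hP
  have hP1 : 1 ≤ P := by rw [hP]; exact_mod_cast h.one_le_pMax
  have hk1 : (1 : ℝ) ≤ k := by exact_mod_cast h.one_le_k
  have hNr : (N : ℝ) ≤ P * k + 1 := by rw [hP]; exact_mod_cast hN
  have hg : gamma1 d ^ 2 = 144 * (Real.log d / d) := by
    rw [gamma1, mul_pow, Real.sq_sqrt (by positivity)]; norm_num
  have hg0 := h.gamma1_pos
  have hs0 := Real.sqrt_nonneg (N : ℝ)
  have hs2 : √(N : ℝ) ^ 2 = N := Real.sq_sqrt (by positivity)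
  have h1 := h.pMax_mul_add_one_le
  have h2 := h.pMax_add_one_pow_le
  have a1 : (√N * gamma1 d) ^ 2 ≤ (2 / 15) ^ 2 := by
    rw [mul_pow, hs2, hg]
    calc (N : ℝ) * (144 * (Real.log d / d))
        ≤ (d / (8100 * Real.log d ^ 2)) * (144 * (Real.log d / d)) := by
          gcongr; exact hNr.trans h1
      _ = (4 / 225) * (1 / Real.log d) := by field_simp; norm_num
      _ ≤ (4 / 225) * 1 := by
          gcongr; rw [div_le_one (by positivity)]; exact hL
      _ = _ := by norm_num
  have a2 : (√N * ((P + 1) * gamma1 d)) ^ 2 ≤ (1 / 50) ^ 2 := by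
    rw [mul_pow, mul_pow, hs2, hg]
    have hN2 : (N : ℝ) * (P + 1) ^ 2 ≤ (P + 1) ^ 3 * k := by
      have : (N : ℝ) ≤ (P + 1) * k := by nlinarith
      calc (N : ℝ) * (P + 1) ^ 2 ≤ ((P + 1) * k) * (P + 1) ^ 2 := by gcongr
        _ = _ := by ring
    calc (N : ℝ) * ((P + 1) ^ 2 * (144 * (Real.log d / d)))
        = ((N : ℝ) * (P + 1) ^ 2) * (144 * (Real.log d / d)) := by ring
      _ ≤ (d / (81 ^ 3 * Real.log d ^ 2)) * (144 * (Real.log d / d)) := by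
          gcongr; exact hN2.trans h2
      _ = (144 / 81 ^ 3) * (1 / Real.log d) := by field_simp
      _ ≤ (144 / 81 ^ 3) * 1 := by
          gcongr; rw [div_le_one (by positivity)]; exact hL
      _ ≤ _ := by norm_num
  have b1 := abs_le_of_sq_le_sq a1 (by norm_num)
  have b2 := abs_le_of_sq_le_sq a2 (by norm_num)
  linarith [(le_abs_self _).trans b1, (le_abs_self _).trans b2]

theorem pMax_mul_gamma1_lt : (pMax d k + 1) * gamma1 d < 1 := by
  have h1 := h.depth_lt (N := 1) (by omega)
  have := h.gamma1_pos
  simp only [Nat.cast_one, Real.sqrt_one, one_mul] at h1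
  linarith

/-- The required accuracy, divided by `η`, is at most half the distance between two periods. -/
theorem accuracy_le : 1 / (2 * √(d : ℝ)) ≤ gamma1 d / 2 := by
  have hd := h.d_pos
  have hL := h.one_le_log
  have h1 : 1 / √(d : ℝ) ≤ √(Real.log d / d) := by
    rw [Real.sqrt_div' _ hd.le]
    gcongr
    exact Real.one_le_sqrt.2 hL
  have h2 : 1 / (2 * √(d : ℝ)) = (1 / √(d : ℝ)) / 2 := by field_simp
  have h3 := h.sqrt_log_div_pos
  rw [h2, gamma1]
  linarith

/-- The labels `3 + Nat.pair p l` of the constructed vectors fit into `{1, …, d²}`. -/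
theorem pair_le {p l : ℕ} (hp : p ≤ pMax d k) (hl : l ≤ k) : Nat.pair p l + 3 ≤ d ^ 2 := by
  have h1 := h.pMax_le
  have h2 := h.k_le_nat
  have h3 := Nat.pair_lt_max_add_one_sq p l
  have h4 : max p l + 1 ≤ d - 3 := by
    have := h.one_le_k
    have := h.one_le_pMax
    omega
  have h5 : (max p l + 1) ^ 2 ≤ (d - 3) ^ 2 := Nat.pow_le_pow_left h4 2
  obtain ⟨e, rfl⟩ : ∃ e, d = e + 3 := ⟨d - 3, by omega⟩
  simp only [Nat.add_sub_cancel] at h5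
  nlinarith

end Regime

/-! ### The constructed function and its subgradients -/

section Objective

variable {d : ℕ} {A : SignMatrix d} {v₀ : Vec d}

theorem foldr_max_max (l : List ℝ) (a b : ℝ) :
    l.foldr max (max a b) = max a (l.foldr max b) := by
  induction l with
  | nil => rfl
  | cons c l ih => simp only [List.foldr_cons, ih, max_left_comm]

theorem objective_append (cuts : List (Cut d)) (c : Cut d) (x : Vec d) :
    objective A v₀ (cuts ++ [c]) x = max (objective A v₀ cuts x) (c.value x) := by
  simp only [objective, List.map_append, List.foldr_append, List.map_cons, List.map_nil,
    List.foldr_cons, List.foldr_nil]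
  rw [foldr_max_max, max_comm]

theorem le_objective_nil (x : Vec d) :
    supNorm A x - eta d ≤ objective A v₀ [] x ∧ eta d * inner ℝ v₀ x ≤ objective A v₀ [] x :=
  ⟨le_max_left _ _, le_max_right _ _⟩

theorem objective_nil_le (cuts : List (Cut d)) (x : Vec d) :
    objective A v₀ [] x ≤ objective A v₀ cuts x := by
  induction cuts using List.reverseRecOn with
  | nil => exact le_rfl
  | append_singleton cs c ih => rw [objective_append]; exact ih.trans (le_max_left _ _)

theorem value_le_objective {cuts : List (Cut d)} {c : Cut d} (hc : c ∈ cuts) (x : Vec d) :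
    c.value x ≤ objective A v₀ cuts x := by
  induction cuts using List.reverseRecOn with
  | nil => simp at hc
  | append_singleton cs c' ih =>
    rw [objective_append]
    rcases List.mem_append.1 hc with h | h
    · exact (ih h).trans (le_max_left _ _)
    · rw [List.mem_singleton.1 h]; exact le_max_right _ _

theorem objective_cases (cuts : List (Cut d)) (x : Vec d) :
    objective A v₀ cuts x = supNorm A x - eta d ∨ objective A v₀ cuts x = eta d * inner ℝ v₀ x ∨
      ∃ c ∈ cuts, c.value x = objective A v₀ cuts x := by
  induction cuts using List.reverseRecOn with
  | nil => exact (max_choice _ _).imp id Or.inl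
  | append_singleton cs c ih =>
    rw [objective_append]
    rcases le_total (c.value x) (objective A v₀ cs x) with h | h
    · rw [max_eq_left h]
      refine ih.imp id (Or.imp id ?_)
      rintro ⟨c', hc', e⟩
      exact ⟨c', List.mem_append_left _ hc', e⟩
    · rw [max_eq_right h]
      exact Or.inr (Or.inr ⟨c, by simp, rfl⟩)

theorem objective_le {cuts : List (Cut d)} {x : Vec d} {a : ℝ} (h1 : supNorm A x - eta d ≤ a)
    (h2 : eta d * inner ℝ v₀ x ≤ a) (h3 : ∀ c ∈ cuts, c.value x ≤ a) :
    objective A v₀ cuts x ≤ a := by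
  rcases objective_cases (A := A) (v₀ := v₀) cuts x with h | h | ⟨c, hc, h⟩
  · rwa [h]
  · rwa [h]
  · rw [← h]; exact h3 c hc

/-- Adding a cut that is not above the function at `x` does not change the answer at `x`: ties are
broken in favour of earlier cuts. -/
theorem answer_append {cuts : List (Cut d)} {c : Cut d} {x : Vec d}
    (h : c.value x ≤ objective A v₀ cuts x) :
    (objective A v₀ (cuts ++ [c]) x, subgrad A v₀ (cuts ++ [c]) x) =
      (objective A v₀ cuts x, subgrad A v₀ cuts x) := by
  have h1 : objective A v₀ (cuts ++ [c]) x = objective A v₀ cuts x := by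
    rw [objective_append, max_eq_left h]
  refine Prod.ext h1 ?_
  simp only [subgrad, h1]
  split_ifs with h2 h3
  · rfl
  · rfl
  · congr 2
    rw [List.find?_append]
    rcases objective_cases (A := A) (v₀ := v₀) cuts x with h | h | ⟨c', hc', h⟩
    · exact absurd h h2
    · exact absurd h h3
    · have : (cuts.find? fun c => decide (c.value x = objective A v₀ cuts x)).isSome := by
        rw [List.find?_isSome]
        exact ⟨c', hc', by simpa using h⟩
      obtain ⟨y, hy⟩ := Option.isSome_iff_exists.1 this
      rw [hy]; rfl

/-- Where `F_A` exceeds `η`, the matrix term dominates, whatever the other terms are. -/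
theorem answer_of_eta_lt {cuts : List (Cut d)} {x : Vec d} (hη : 0 ≤ eta d) (hg1 : 0 ≤ gamma1 d)
    (hg2 : 0 ≤ gamma2 d) (hx : ‖x‖ ≤ 1) (hv : ‖v₀‖ ≤ 1)
    (hc : ∀ c ∈ cuts, ‖c.v‖ ≤ 1) (h : eta d < objective A v₀ [] x) :
    (objective A v₀ cuts x, subgrad A v₀ cuts x) = (supNorm A x - eta d, rowSubgrad A x) := by
  have hin : ∀ v : Vec d, ‖v‖ ≤ 1 → inner ℝ v x ≤ 1 := fun v hv =>
    (real_inner_le_norm v x).trans (mul_le_one₀ hv (norm_nonneg _) hx)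
  have h1 : eta d * inner ℝ v₀ x ≤ eta d := mul_le_of_le_one_right hη (hin _ hv)
  have h2 : eta d < supNorm A x - eta d := by
    rcases lt_max_iff.1 (show eta d < max _ _ from h) with h | h
    · exact h
    · exact absurd h1 h.not_ge
  have h3 : objective A v₀ cuts x = supNorm A x - eta d := by
    refine le_antisymm (objective_le le_rfl (h1.trans h2.le) fun c hcc => ?_)
      ((le_objective_nil x).1.trans (objective_nil_le cuts x))
    refine le_trans ?_ h2.le
    refine mul_le_of_le_one_right hη ?_
    have := hin _ (hc c hcc)
    have : (0 : ℝ) ≤ c.p * gamma1 d := by positivity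
    have : (0 : ℝ) ≤ c.l * gamma2 d := by positivity
    linarith
  rw [subgrad, if_pos h3, h3]

theorem ne_zero_of_objective_neg {cuts : List (Cut d)} {x : Vec d}
    (h : objective A v₀ cuts x < 0) : x ≠ 0 := by
  rintro rfl
  have := (le_objective_nil (A := A) (v₀ := v₀) 0).2.trans (objective_nil_le cuts 0)
  rw [inner_zero_right, mul_zero] at this
  exact absurd h this.not_gt

theorem distToSpan_eq (xs : List (Vec d)) (x : Vec d) :
    distToSpan xs x = ‖(listSpan xs)ᗮ.starProjection x‖ := rfl

theorem distToSpan_mono {xs ys : List (Vec d)} (h : ∀ y ∈ xs, y ∈ ys) (x : Vec d) :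
    distToSpan ys x ≤ distToSpan xs x :=
  norm_starProjection_mono (Submodule.orthogonal_le (Submodule.span_mono h)) x

theorem distToSpan_of_mem {xs : List (Vec d)} {x : Vec d} (h : x ∈ xs) : distToSpan xs x = 0 := by
  rw [distToSpan_eq, norm_eq_zero, Submodule.starProjection_apply_eq_zero_iff,
    Submodule.orthogonal_orthogonal]
  exact Submodule.subset_span h

theorem distToSpan_nil (x : Vec d) : distToSpan [] x = ‖x‖ := by
  have h : listSpan ([] : List (Vec d)) = ⊥ := by
    rw [Submodule.span_eq_bot]; intro y hy; exact absurd hy List.not_mem_nil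
  have hx : x ∈ (listSpan ([] : List (Vec d)))ᗮ := by simp [h]
  rw [distToSpan_eq, Submodule.starProjection_eq_self_iff.2 hx]

/-- A unit vector that is nearly orthogonal to `xs` is nearly orthogonal to the points near the
span of `xs`. -/
theorem abs_inner_le_of_near {xs : List (Vec d)} {v x : Vec d} {κ τ : ℝ} (hv : ‖v‖ ≤ 1)
    (hvs : ‖(listSpan xs).starProjection v‖ ≤ κ) (hx : ‖x‖ ≤ 1) (hxs : distToSpan xs x ≤ τ) :
    |inner ℝ v x| ≤ κ + τ := by
  have h1 : inner ℝ v x = inner ℝ ((listSpan xs).starProjection v) x +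
      inner ℝ v ((listSpan xs)ᗮ.starProjection x) := by
    conv_lhs => rw [← (listSpan xs).starProjection_add_starProjection_orthogonal x]
    rw [inner_add_right, Submodule.inner_starProjection_left_eq_right]
  rw [h1]
  refine (abs_add_le _ _).trans (add_le_add ?_ ?_)
  · refine (abs_real_inner_le_norm _ _).trans ?_
    exact (mul_le_of_le_one_right (norm_nonneg _) hx).trans hvs
  · refine (abs_real_inner_le_norm _ _).trans ?_
    exact (mul_le_of_le_one_left (norm_nonneg _) hv).trans hxs

end Objective

/-! ### The procedure as a deterministic function of the hints -/

section Deterministic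

variable {d : ℕ}

open Classical in
/-- The vectors to which the next constructed vector has to be orthogonal, if the query `x` leads
to the construction of a vector. -/
noncomputable def hintRequest (k : ℕ) (A : SignMatrix d) (v₀ : Vec d) (t : ℕ) (s : ProcState d)
    (x : Vec d) : Option (List (Vec d)) :=
  if s.ended = true ∨ d ^ 2 < t then none
  else if eta d < objective A v₀ [] x then none
  else if objective A v₀ s.cuts x < -(eta d * (s.p * gamma1 d + s.l * gamma2 d + gamma2 d / 2)) then
    if (newExpl k A v₀ s x).length < k then some (newExpl k A v₀ s x)
    else if s.p + 1 ≤ pMax d k then some [x] else none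
  else none

open Classical in
/-- The state after the query `x`, where `v` is the constructed vector, if there is one. -/
noncomputable def procNext (k : ℕ) (A : SignMatrix d) (v₀ : Vec d) (t : ℕ) (s : ProcState d)
    (x v : Vec d) : ProcState d :=
  if s.ended = true ∨ d ^ 2 < t then { s with ended := true }
  else if eta d < objective A v₀ [] x then s
  else if objective A v₀ s.cuts x < -(eta d * (s.p * gamma1 d + s.l * gamma2 d + gamma2 d / 2)) then
    if (newExpl k A v₀ s x).length < k then
      ⟨s.p, s.l + 1, newExpl k A v₀ s x, s.cuts ++ [⟨s.p, s.l + 1, v⟩], false⟩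
    else if s.p + 1 ≤ pMax d k then ⟨s.p + 1, 1, [x], s.cuts ++ [⟨s.p + 1, 1, v⟩], false⟩
    else ⟨s.p, s.l, newExpl k A v₀ s x, s.cuts, true⟩
  else ⟨s.p, s.l, newExpl k A v₀ s x, s.cuts, false⟩

/-- Sampling a hint on request. -/
noncomputable def onRequest {α : Type} {δ : ℝ} (D : Discretization d δ) (r : Option (List (Vec d)))
    (f : Vec d → α) : PMF α :=
  match r with
  | none => pure (f 0)
  | some e => (hintLaw D e).bind fun v => pure (f v)

theorem procStep_eq (D : Discretization d (mesh d)) (k : ℕ) (A : SignMatrix d) (v₀ : Vec d)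
    (t : ℕ) (s : ProcState d) (x : Vec d) :
    procStep D k A v₀ t s x =
      onRequest D (hintRequest k A v₀ t s x) (procNext k A v₀ t s x) := by
  unfold procStep hintRequest procNext
  dsimp only
  split_ifs <;> rfl

variable {M : ℕ}

/-- The vectors to which the next constructed vector has to be orthogonal, if the next query of the
algorithm leads to the construction of a vector. -/
noncomputable def runRequest (k : ℕ) (alg : OptAlgorithm d M) (A : SignMatrix d) (v₀ : Vec d)
    (s : RunState d M) : Option (List (Vec d)) :=
  if s.stopped = true then none
  else hintRequest k A v₀ (s.transcript.length + 1) s.proc (alg.query s.mem)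

/-- The run after one more query, where `v` is the constructed vector, if there is one. -/
noncomputable def runNext (k : ℕ) (alg : OptAlgorithm d M) (A : SignMatrix d) (v₀ : Vec d)
    (s : RunState d M) (v : Vec d) : RunState d M :=
  if s.stopped = true then s
  else
    let x := alg.query s.mem
    let proc := procNext k A v₀ (s.transcript.length + 1) s.proc x v
    let resp := procResponse A v₀ proc x
    let tr := s.transcript ++ [(x, resp)]
    ⟨proc, alg.update s.mem x resp, tr, alg.halts tr⟩

theorem runStep_eq (D : Discretization d (mesh d)) (k : ℕ) (alg : OptAlgorithm d M)
    (A : SignMatrix d) (v₀ : Vec d) (s : RunState d M) :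
    runStep D k alg A v₀ s = onRequest D (runRequest k alg A v₀ s) (runNext k alg A v₀ s) := by
  unfold runStep runRequest runNext
  by_cases h : s.stopped = true
  · simp only [h, if_true, onRequest]
  · simp only [h, if_false, Bool.false_eq_true]
    rw [procStep_eq]
    unfold onRequest
    cases hintRequest k A v₀ (s.transcript.length + 1) s.proc (alg.query s.mem) with
    | none => exact PMF.pure_bind _ _
    | some e =>
      refine (PMF.bind_bind _ _ _).trans ?_
      refine congrArg _ (funext fun v => ?_)
      exact PMF.pure_bind _ _

end Deterministic

/-! ### Invariants of the procedure -/

section Invariant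

variable {d : ℕ}

/-- The event that a hint `v` for the list `e` is useful: it is nearly orthogonal to `e` and not
positively correlated with the vectors in `tests`. -/
structure GoodHint (k : ℕ) (e tests : List (Vec d)) (v : Vec d) : Prop where
  norm_eq : ‖v‖ = 1
  orth : ‖(listSpan e).starProjection v‖ ≤ ((k : ℝ) + 1) / (d : ℝ) ^ 3
  corr : ∀ x ∈ tests, inner ℝ v x ≤ gamma1 d / 2 * ‖x‖

open Classical in
/-- One step of the greedy selection of exploratory queries. It uses the responses only, so that
the player can carry it out in the second phase. -/
noncomputable def explStep (k : ℕ) (e : List (Vec d)) (q : Ball d × (ℝ × Vec d)) : List (Vec d) :=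
  if e.length < k ∧ q.2.1 ≤ -(eta d * gamma1 d / 2) ∧
      gamma2 d / 4 ≤ distToSpan e q.1 / ‖(q.1 : Vec d)‖
  then e ++ [(q.1 : Vec d)] else e

/-- The exploratory queries selected greedily from a transcript. -/
noncomputable def exploratory (k : ℕ) (tr : List (Ball d × (ℝ × Vec d))) : List (Vec d) :=
  tr.foldl (explStep k) []

/-- Some window of at most `m` consecutive queries contains `k` exploratory queries. -/
def HasFullWindow (k m : ℕ) (tr : List (Ball d × (ℝ × Vec d))) : Prop :=
  ∃ a c, c ≤ m ∧ a + c ≤ tr.length ∧ k ≤ (exploratory k ((tr.drop a).take c)).length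

theorem HasFullWindow.append {k m : ℕ} {tr : List (Ball d × (ℝ × Vec d))}
    (h : HasFullWindow k m tr) (tr' : List (Ball d × (ℝ × Vec d))) :
    HasFullWindow k m (tr ++ tr') := by
  obtain ⟨a, c, hc, hac, hk⟩ := h
  refine ⟨a, c, hc, by rw [List.length_append]; omega, ?_⟩
  rwa [List.drop_append_of_le_length (by omega), List.take_append_of_le_length]
  rw [List.length_drop]; omega

/-- What is known about an earlier query with answer `r` while the construction goes on. The first
case covers the queries of earlier periods and the queries with a large value; the other queries
are near the span of the exploratory queries of the period, or come at its end. -/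
def Past (k : ℕ) (s : ProcState d) (x : Vec d) (r : ℝ) : Prop :=
  -(eta d * ((s.p - 1 / 2) * gamma1 d)) ≤ r ∨
    (-(eta d * (s.p * gamma1 d + s.l * gamma2 d + gamma2 d / 2)) ≤ r ∧
      (distToSpan s.expl x ≤ gamma2 d / 4 ∨ k ≤ s.expl.length))

/-- The invariant of the procedure after the transcript `tr`, as long as all hints are good. The
answers given so far agree with the current function (`answers`). The latest vector of the current
period is nearly orthogonal to the first `l` exploratory queries of the period, at least (`last`).
Unless some window of `m` queries already contains `k` exploratory queries, each completed period
took at least `m` queries (`window`, `closed`); here the exploratory queries of the current period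
can be recovered from the queries since its beginning at time `a`. -/
structure Inv (k m : ℕ) (A : SignMatrix d) (v₀ : Vec d) (s : ProcState d)
    (tr : List (Ball d × (ℝ × Vec d))) : Prop where
  one_le_p : 1 ≤ s.p
  p_le : s.p ≤ pMax d k
  l_le : s.l ≤ k
  expl_le : s.expl.length ≤ k
  length_cuts : s.cuts.length + k ≤ s.p * k + s.l
  norm_cuts : ∀ c ∈ s.cuts, ‖c.v‖ = 1
  idx_cuts : ∀ c ∈ s.cuts, c.p ≤ pMax d k ∧ c.l ≤ k
  answers : ∀ q ∈ tr, q.2 = (objective A v₀ s.cuts q.1, subgrad A v₀ s.cuts q.1)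
  last : s.ended = false → ∃ e₀, e₀ <+: s.expl ∧ s.l ≤ e₀.length ∧ (1 ≤ s.l → ∃ c ∈ s.cuts,
    c.p = s.p ∧ c.l = s.l ∧
      ‖(listSpan e₀).starProjection c.v‖ ≤ ((k : ℝ) + 1) / (d : ℝ) ^ 3)
  past : s.ended = false → ∀ q ∈ tr, Past k s q.1 q.2.1
  window : s.ended = false → HasFullWindow k m tr ∨
    ∃ a ≤ tr.length, s.p * m ≤ a + m ∧ s.expl = exploratory k (tr.drop a)
  closed : s.ended = true → HasFullWindow k m tr ∨ pMax d k * m < tr.length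

variable {k m : ℕ} {A : SignMatrix d} {v₀ : Vec d} {s : ProcState d}
  {tr : List (Ball d × (ℝ × Vec d))}

theorem Inv.init (h : Regime d k) : Inv k m A v₀ (ProcState.init d) [] where
  one_le_p := le_rfl
  p_le := h.one_le_pMax
  l_le := Nat.zero_le _
  expl_le := Nat.zero_le _
  length_cuts := by simp [ProcState.init]
  norm_cuts := by simp [ProcState.init]
  idx_cuts := by simp [ProcState.init]
  answers := by simp
  last := fun _ => ⟨[], List.nil_prefix, le_rfl, fun h => absurd h (by simp [ProcState.init])⟩
  past := by simp
  window := fun _ => Or.inr ⟨0, le_rfl, by simp [ProcState.init], rfl⟩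
  closed := by simp [ProcState.init]

theorem exploratory_append (tr : List (Ball d × (ℝ × Vec d))) (q : Ball d × (ℝ × Vec d)) :
    exploratory k (tr ++ [q]) = explStep k (exploratory k tr) q := by
  simp [exploratory, List.foldl_append]

theorem newExpl_cases (x : Vec d) :
    (newExpl k A v₀ s x = s.expl ++ [x] ∧ s.expl.length < k) ∨ newExpl k A v₀ s x = s.expl := by
  unfold newExpl
  split_ifs with h
  · exact Or.inl ⟨rfl, h.1⟩
  · exact Or.inr rfl

theorem prefix_newExpl (x : Vec d) : s.expl <+: newExpl k A v₀ s x := by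
  rcases newExpl_cases (k := k) (A := A) (v₀ := v₀) (s := s) x with h | h
  · rw [h.1]; exact List.prefix_append _ _
  · rw [h]

theorem length_newExpl_le (hs : s.expl.length ≤ k) (x : Vec d) :
    (newExpl k A v₀ s x).length ≤ k := by
  rcases newExpl_cases (k := k) (A := A) (v₀ := v₀) (s := s) x with h | h
  · rw [h.1, List.length_append, List.length_singleton]; exact h.2
  · rwa [h]

/-- A query with a low value that is not added to an incomplete list is near its span. -/
theorem near_of_newExpl_eq {x : Vec d}
    (h0 : x ≠ 0) (hlow : objective A v₀ s.cuts x ≤ -(eta d * gamma1 d / 2))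
    (hk : s.expl.length < k) (he : newExpl k A v₀ s x = s.expl) :
    distToSpan s.expl x < gamma2 d / 4 * ‖x‖ := by
  unfold newExpl at he
  split_ifs at he with h
  · have := congrArg List.length he
    simp at this
  · have h1 : ¬ gamma2 d / 4 ≤ distToSpan s.expl x / ‖x‖ := fun h1 => h ⟨hk, hlow, h1⟩
    rwa [not_le, div_lt_iff₀ (norm_pos_iff.2 h0)] at h1

theorem near_or_full {x : Vec d} (hx : ‖x‖ ≤ 1) (hg : 0 ≤ gamma2 d) (h0 : x ≠ 0)
    (hlow : objective A v₀ s.cuts x ≤ -(eta d * gamma1 d / 2)) :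
    distToSpan (newExpl k A v₀ s x) x ≤ gamma2 d / 4 ∨ k ≤ s.expl.length := by
  by_cases hk : s.expl.length < k
  · left
    rcases newExpl_cases (k := k) (A := A) (v₀ := v₀) (s := s) x with h | h
    · rw [h.1, distToSpan_of_mem (by simp)]; positivity
    · have h1 := near_of_newExpl_eq h0 hlow hk h
      rw [h]
      exact h1.le.trans (mul_le_of_le_one_right (by positivity) hx)
  · exact Or.inr (not_lt.1 hk)

theorem explStep_eq_newExpl {x : Ball d} {r : ℝ × Vec d}
    (h : r.1 ≤ -(eta d * gamma1 d / 2) ↔ objective A v₀ s.cuts x ≤ -(eta d * gamma1 d / 2)) :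
    explStep k s.expl (x, r) = newExpl k A v₀ s x := by
  unfold explStep newExpl
  simp only [h]

theorem explStep_of_lt {e : List (Vec d)} {q : Ball d × (ℝ × Vec d)}
    (h : -(eta d * gamma1 d / 2) < q.2.1) : explStep k e q = e := by
  unfold explStep
  rw [if_neg]
  exact fun h' => absurd h'.2.1 h.not_ge

theorem Past.mono {s' : ProcState d} (hη : 0 < eta d) (hg : 0 ≤ gamma2 d) {x : Vec d} {r : ℝ}
    (hp : s'.p = s.p) (hl : s.l ≤ s'.l) (he : s.expl <+: s'.expl) (h : Past k s x r) :
    Past k s' x r := by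
  refine h.imp (fun h => by rwa [hp]) ?_
  rintro ⟨h1, h2⟩
  refine ⟨?_, h2.imp (fun h => (distToSpan_mono (fun y hy => he.subset hy) x).trans h)
    fun h => h.trans he.length_le⟩
  refine le_trans ?_ h1
  rw [hp, neg_le_neg_iff]
  have : (s.l : ℝ) ≤ s'.l := by exact_mod_cast hl
  gcongr

theorem Inv.window_append (hI : Inv k m A v₀ s tr) (he : s.ended = false)
    {q : Ball d × (ℝ × Vec d)} {e : List (Vec d)} (hq : explStep k s.expl q = e) :
    HasFullWindow k m (tr ++ [q]) ∨
      ∃ a ≤ tr.length, s.p * m ≤ a + m ∧ e = exploratory k ((tr ++ [q]).drop a) := by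
  refine (hI.window he).imp (fun h => h.append _) ?_
  rintro ⟨a, ha, hm, hexp⟩
  refine ⟨a, ha, hm, ?_⟩
  rw [List.drop_append_of_le_length ha, exploratory_append, ← hexp, hq]

/-- When the list of exploratory queries is full, either the period has been short, or all periods
up to this one took at least `m` queries each. -/
theorem Inv.fullWindow_of_full (hI : Inv k m A v₀ s tr) (he : s.ended = false)
    {q : Ball d × (ℝ × Vec d)} {e : List (Vec d)} (hq : explStep k s.expl q = e)
    (hk : k ≤ e.length) : HasFullWindow k m (tr ++ [q]) ∨ s.p * m ≤ tr.length := by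
  rcases hI.window_append he hq with h | ⟨a, ha, hm, hexp⟩
  · exact Or.inl h
  · by_cases hlt : tr.length + 1 ≤ a + m
    · refine Or.inl ⟨a, tr.length + 1 - a, by omega, by simp; omega, ?_⟩
      rw [List.take_of_length_le, ← hexp]
      · exact hk
      · simp
    · exact Or.inr (by omega)

/-- A new cut is not above the answer to an earlier query: for queries of earlier periods this is
due to the step `γ₁` between periods, and for those of the current period to the new vector being
nearly orthogonal to the exploratory queries, which these queries are close to. -/
theorem Inv.value_le (h : Regime d k) (hI : Inv k m A v₀ s tr) (he : s.ended = false)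
    {c : Cut d} (hv : ‖c.v‖ = 1) {q : Ball d × (ℝ × Vec d)} (hq : q ∈ tr)
    (hcorr : inner ℝ c.v (q.1 : Vec d) ≤ gamma1 d / 2)
    (hc : (c.p = s.p + 1) ∨ (c.p = s.p ∧ c.l = s.l + 1 ∧ s.expl.length < k ∧
      ‖(listSpan s.expl).starProjection c.v‖ ≤ ((k : ℝ) + 1) / (d : ℝ) ^ 3)) :
    c.value q.1 ≤ q.2.1 := by
  have hη := h.eta_pos
  have hg1 := h.gamma1_pos
  have hg2 := h.gamma2_pos
  have hgg := h.gamma2_mul_le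
  have hκ := h.hint_error_le
  have hl : (s.l : ℝ) * gamma2 d ≤ k * gamma2 d := by
    have : (s.l : ℝ) ≤ k := by exact_mod_cast hI.l_le
    gcongr
  have hqx : ‖(q.1 : Vec d)‖ ≤ 1 := mem_closedBall_zero_iff.1 q.1.2
  have hpos : (0 : ℝ) ≤ c.l * gamma2 d := by positivity
  have hpos' : (0 : ℝ) ≤ s.l * gamma2 d := by positivity
  have key : ∀ b : ℝ, b ≤ c.p * gamma1 d + c.l * gamma2 d - inner ℝ c.v (q.1 : Vec d) →
      -(eta d * b) ≤ q.2.1 → c.value q.1 ≤ q.2.1 := by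
    intro b hb hle
    refine le_trans ?_ hle
    rw [Cut.value, ← mul_neg]
    refine mul_le_mul_of_nonneg_left ?_ hη.le
    linarith
  rcases hc with hc | ⟨hcp, hcl, hlen, horth⟩
  · have hcp : (c.p : ℝ) = s.p + 1 := by rw [hc]; push_cast; ring
    rcases hI.past he q hq with hP | ⟨hP, -⟩
    · refine key _ ?_ hP
      rw [hcp]; nlinarith
    · refine key _ ?_ hP
      rw [hcp]; nlinarith
  · rcases hI.past he q hq with hP | ⟨hP, hn⟩
    · refine key _ ?_ hP
      rw [hcp]; nlinarith
    · rcases hn with hn | hn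
      · refine key _ ?_ hP
        have h1 := abs_inner_le_of_near hv.le horth hqx hn
        have h2 := (le_abs_self _).trans h1
        have hcl' : (c.l : ℝ) = s.l + 1 := by rw [hcl]; push_cast; ring
        rw [hcp, hcl']; nlinarith
      · omega

theorem Inv.answers_concat (hI : Inv k m A v₀ s tr) (x : Ball d) :
    ∀ q ∈ tr ++ [(x, (objective A v₀ s.cuts x, subgrad A v₀ s.cuts x))],
      q.2 = (objective A v₀ s.cuts q.1, subgrad A v₀ s.cuts q.1) := by
  intro q hq
  rcases List.mem_append.1 hq with hq | hq
  · exact hI.answers q hq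
  · rw [List.mem_singleton.1 hq]

theorem Inv.answers_append (hI : Inv k m A v₀ s tr) {c : Cut d}
    (hc : ∀ q ∈ tr, c.value q.1 ≤ q.2.1) :
    ∀ q ∈ tr, q.2 = (objective A v₀ (s.cuts ++ [c]) q.1, subgrad A v₀ (s.cuts ++ [c]) q.1) := by
  intro q hq
  have h1 := hI.answers q hq
  rw [answer_append, ← h1]
  have h2 := hc q hq
  rwa [h1] at h2

/-- An informative query is added to the list, or this list has grown since the last vector was
constructed. Hence a period has no more vectors than exploratory queries. -/
theorem Inv.l_lt_length (h : Regime d k) (hI : Inv k m A v₀ s tr) (he : s.ended = false)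
    {x : Vec d} (hx : ‖x‖ ≤ 1)
    (hlow : objective A v₀ s.cuts x < -(eta d * (s.p * gamma1 d + s.l * gamma2 d + gamma2 d / 2)))
    (hlow' : objective A v₀ s.cuts x ≤ -(eta d * gamma1 d / 2)) (h0 : x ≠ 0)
    (hk : s.expl.length < k) : s.l + 1 ≤ (newExpl k A v₀ s x).length := by
  have hη := h.eta_pos
  have hg2 := h.gamma2_pos
  have hκ := h.hint_error_le
  obtain ⟨e₀, hpre, hl, hc⟩ := hI.last he
  have hlen := hpre.length_le
  rcases newExpl_cases (k := k) (A := A) (v₀ := v₀) (s := s) x with hn | hn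
  · rw [hn.1, List.length_append, List.length_singleton]; omega
  · have hnear := near_of_newExpl_eq h0 hlow' hk hn
    rw [hn]
    by_contra hcon
    have heq : e₀ = s.expl := hpre.eq_of_length (by omega)
    rcases Nat.eq_zero_or_pos s.l with hl0 | hl0
    · have hnil : s.expl = [] := List.length_eq_zero_iff.1 (by omega)
      rw [hnil, distToSpan_nil] at hnear
      have := norm_pos_iff.2 h0
      have := h.gamma2_le
      nlinarith
    · obtain ⟨c, hcm, hcp, hcl, horth⟩ := hc hl0
      rw [heq] at horth
      have h1 := abs_inner_le_of_near (hI.norm_cuts c hcm).le horth hx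
        (hnear.le.trans (mul_le_of_le_one_right (by positivity) hx))
      have h2 := neg_le_of_abs_le h1
      have h3 := value_le_objective (A := A) (v₀ := v₀) hcm x
      rw [Cut.value, hcp, hcl] at h3
      have h4 := h3.trans_lt hlow
      rw [← mul_neg] at h4
      have h5 := lt_of_mul_lt_mul_left h4 hη.le
      linarith

end Invariant

section InvariantStep

variable {d : ℕ} {k m : ℕ} {A : SignMatrix d} {v₀ : Vec d} {s : ProcState d}
  {tr : List (Ball d × (ℝ × Vec d))}

/-- The bound `p γ₁ + l γ₂ + γ₂ / 2` on the depth is at least `γ₁ / 2`, as periods are numbered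
from `1`. -/
theorem Inv.low_of_informative (h : Regime d k) (hI : Inv k m A v₀ s tr) {r : ℝ}
    (hr : r < -(eta d * (s.p * gamma1 d + s.l * gamma2 d + gamma2 d / 2))) :
    r ≤ -(eta d * gamma1 d / 2) := by
  have hη := h.eta_pos
  have hg1 := h.gamma1_pos
  have hg2 := h.gamma2_pos
  have hp : (1 : ℝ) ≤ s.p := by exact_mod_cast hI.one_le_p
  refine hr.le.trans (neg_le_neg ?_)
  rw [mul_div_assoc]
  refine mul_le_mul_of_nonneg_left ?_ hη.le
  have : (0 : ℝ) ≤ s.l * gamma2 d := by positivity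
  nlinarith

theorem Inv.step_ended (hI : Inv k m A v₀ s tr) (he : s.ended = true) (x : Ball d) :
    Inv k m A v₀ s (tr ++ [(x, (objective A v₀ s.cuts x, subgrad A v₀ s.cuts x))]) where
  one_le_p := hI.one_le_p
  p_le := hI.p_le
  l_le := hI.l_le
  expl_le := hI.expl_le
  length_cuts := hI.length_cuts
  norm_cuts := hI.norm_cuts
  idx_cuts := hI.idx_cuts
  answers := hI.answers_concat x
  last := fun h => by simp [he] at h
  past := fun h => by simp [he] at h
  window := fun h => by simp [he] at h
  closed := fun _ => (hI.closed he).imp (fun h => h.append _) fun h => by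
    rw [List.length_append]; omega

theorem Inv.step_high (h : Regime d k) (hI : Inv k m A v₀ s tr) (he : s.ended = false) {x : Ball d}
    (hx : eta d < objective A v₀ [] x) :
    Inv k m A v₀ s (tr ++ [(x, (objective A v₀ s.cuts x, subgrad A v₀ s.cuts x))]) where
  one_le_p := hI.one_le_p
  p_le := hI.p_le
  l_le := hI.l_le
  expl_le := hI.expl_le
  length_cuts := hI.length_cuts
  norm_cuts := hI.norm_cuts
  idx_cuts := hI.idx_cuts
  answers := hI.answers_concat x
  last := hI.last
  past := by
    intro he q hq
    rcases List.mem_append.1 hq with hq | hq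
    · exact hI.past he q hq
    · rw [List.mem_singleton.1 hq]
      left
      have hη := h.eta_pos
      have hg1 := h.gamma1_pos
      have hp : (1 : ℝ) ≤ s.p := by exact_mod_cast hI.one_le_p
      have h1 := hx.trans_le (objective_nil_le (A := A) (v₀ := v₀) s.cuts x)
      have : 0 ≤ eta d * ((s.p - 1 / 2) * gamma1 d) :=
        mul_nonneg hη.le (mul_nonneg (by linarith) hg1.le)
      linarith
  window := by
    intro he
    have h1 := hx.trans_le (objective_nil_le (A := A) (v₀ := v₀) s.cuts x)
    have h2 : -(eta d * gamma1 d / 2) < objective A v₀ s.cuts x := by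
      have := mul_pos h.eta_pos h.gamma1_pos
      linarith [h.eta_pos]
    refine (hI.window_append he (explStep_of_lt h2)).imp id ?_
    rintro ⟨a, ha, hm⟩
    exact ⟨a, by rw [List.length_append]; omega, hm⟩
  closed := fun h => by simp [he] at h

/-- A query that does not lead to a new vector. -/
theorem Inv.step_uninformative (h : Regime d k) (hI : Inv k m A v₀ s tr) (he : s.ended = false)
    {x : Ball d} (hx : -(eta d * (s.p * gamma1 d + s.l * gamma2 d + gamma2 d / 2)) ≤
      objective A v₀ s.cuts x) :
    Inv k m A v₀ ⟨s.p, s.l, newExpl k A v₀ s x, s.cuts, false⟩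
      (tr ++ [(x, (objective A v₀ s.cuts x, subgrad A v₀ s.cuts x))]) where
  one_le_p := hI.one_le_p
  p_le := hI.p_le
  l_le := hI.l_le
  expl_le := length_newExpl_le hI.expl_le x
  length_cuts := hI.length_cuts
  norm_cuts := hI.norm_cuts
  idx_cuts := hI.idx_cuts
  answers := hI.answers_concat x
  last := by
    intro _
    obtain ⟨e₀, hpre, hl, hc⟩ := hI.last he
    exact ⟨e₀, hpre.trans (prefix_newExpl _), hl, hc⟩
  past := by
    intro _ q hq
    rcases List.mem_append.1 hq with hq | hq
    · exact Past.mono (s := s) h.eta_pos h.gamma2_pos.le rfl le_rfl (prefix_newExpl _)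
        (hI.past he q hq)
    · rw [List.mem_singleton.1 hq]
      have hη := h.eta_pos
      have hg1 := h.gamma1_pos
      rcases lt_or_ge (-(eta d * gamma1 d / 2)) (objective A v₀ s.cuts x) with hlt | hge
      · left
        refine le_trans ?_ hlt.le
        rw [mul_div_assoc, neg_le_neg_iff]
        have hp : (1 : ℝ) ≤ s.p := by exact_mod_cast hI.one_le_p
        refine mul_le_mul_of_nonneg_left ?_ hη.le
        nlinarith
      · right
        refine ⟨hx, ?_⟩
        have hneg : objective A v₀ s.cuts x < 0 := by
          have := mul_pos hη hg1
          linarith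
        exact (near_or_full (mem_closedBall_zero_iff.1 x.2) h.gamma2_pos.le
          (ne_zero_of_objective_neg hneg) hge).imp id
          fun hk => hk.trans (prefix_newExpl (x : Vec d)).length_le
  window := by
    intro _
    refine (hI.window_append he (explStep_eq_newExpl Iff.rfl)).imp id ?_
    rintro ⟨a, ha, hm⟩
    exact ⟨a, by rw [List.length_append]; omega, hm⟩
  closed := fun h => by simp at h

/-- A query that ends the construction. -/
theorem Inv.step_end (hI : Inv k m A v₀ s tr) (he : s.ended = false)
    {x : Ball d} (hk : k ≤ (newExpl k A v₀ s x).length) (hp : pMax d k < s.p + 1) :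
    Inv k m A v₀ ⟨s.p, s.l, newExpl k A v₀ s x, s.cuts, true⟩
      (tr ++ [(x, (objective A v₀ s.cuts x, subgrad A v₀ s.cuts x))]) where
  one_le_p := hI.one_le_p
  p_le := hI.p_le
  l_le := hI.l_le
  expl_le := length_newExpl_le hI.expl_le x
  length_cuts := hI.length_cuts
  norm_cuts := hI.norm_cuts
  idx_cuts := hI.idx_cuts
  answers := hI.answers_concat x
  last := fun h => by simp at h
  past := fun h => by simp at h
  window := fun h => by simp at h
  closed := by
    intro _
    refine (hI.fullWindow_of_full he (explStep_eq_newExpl Iff.rfl) hk).imp id fun hle => ?_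
    have : s.p = pMax d k := by have := hI.p_le; omega
    rw [List.length_append, List.length_singleton, ← this]
    omega

/-- A cut by a good hint does not raise the function above the threshold for exploratory queries. -/
theorem value_low (h : Regime d k) {c : Cut d} {x : Vec d} (hp : 1 ≤ c.p)
    (hc : inner ℝ c.v x ≤ gamma1 d / 2) : c.value x ≤ -(eta d * gamma1 d / 2) := by
  have hη := h.eta_pos
  have hg1 := h.gamma1_pos
  have hg2 := h.gamma2_pos
  rw [Cut.value, mul_div_assoc, ← mul_neg]
  refine mul_le_mul_of_nonneg_left ?_ hη.le
  have : (1 : ℝ) ≤ c.p := by exact_mod_cast hp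
  have : (0 : ℝ) ≤ c.l * gamma2 d := by positivity
  nlinarith

/-- Near the span of the list, a cut by a good hint lifts the function to the level at which no new
vector is sampled. -/
theorem le_value (h : Regime d k) {c : Cut d} {x : Vec d} {e : List (Vec d)} (hv : ‖c.v‖ = 1)
    (horth : ‖(listSpan e).starProjection c.v‖ ≤ ((k : ℝ) + 1) / (d : ℝ) ^ 3) (hx : ‖x‖ ≤ 1)
    (hn : distToSpan e x ≤ gamma2 d / 4) :
    -(eta d * (c.p * gamma1 d + c.l * gamma2 d + gamma2 d / 2)) ≤ c.value x := by
  have hη := h.eta_pos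
  have hg2 := h.gamma2_pos
  have hκ := h.hint_error_le
  have h1 := neg_le_of_abs_le (abs_inner_le_of_near hv.le horth hx hn)
  rw [Cut.value, ← mul_neg]
  refine mul_le_mul_of_nonneg_left ?_ hη.le
  linarith

/-- A query that leads to a new vector in the same period. -/
theorem Inv.step_cut (h : Regime d k) (hI : Inv k m A v₀ s tr) (he : s.ended = false)
    {x : Ball d} {v : Vec d}
    (hx : objective A v₀ s.cuts x < -(eta d * (s.p * gamma1 d + s.l * gamma2 d + gamma2 d / 2)))
    (hk : (newExpl k A v₀ s x).length < k)
    (hv : GoodHint k (newExpl k A v₀ s x) (tr.map (fun q => (q.1 : Vec d)) ++ [(x : Vec d)]) v)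
    {cuts' : List (Cut d)} (hcuts : cuts' = s.cuts ++ [⟨s.p, s.l + 1, v⟩]) :
    Inv k m A v₀ ⟨s.p, s.l + 1, newExpl k A v₀ s x, cuts', false⟩
      (tr ++ [(x, (objective A v₀ cuts' x, subgrad A v₀ cuts' x))]) := by
  have hη := h.eta_pos
  have hg1 := h.gamma1_pos
  have hg2 := h.gamma2_pos
  have hx1 : ∀ y : Ball d, ‖(y : Vec d)‖ ≤ 1 := fun y => mem_closedBall_zero_iff.1 y.2
  have hlow := hI.low_of_informative h hx
  have hpre : s.expl <+: newExpl k A v₀ s x := prefix_newExpl _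
  have hkexp : s.expl.length < k := hpre.length_le.trans_lt hk
  have hneg : objective A v₀ s.cuts x < 0 := by
    have := mul_pos hη hg1
    linarith
  have h0 := ne_zero_of_objective_neg hneg
  have hllen := hI.l_lt_length h he (hx1 x) hx hlow h0 hkexp
  have hcorr : ∀ y : Ball d, (y : Vec d) ∈ tr.map (fun q => (q.1 : Vec d)) ++ [(x : Vec d)] →
      inner ℝ v (y : Vec d) ≤ gamma1 d / 2 := fun y hy =>
    (hv.corr y hy).trans (mul_le_of_le_one_right (by positivity) (hx1 y))
  have hcorrx : inner ℝ v (x : Vec d) ≤ gamma1 d / 2 := hcorr x (by simp)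
  have hnear : distToSpan (newExpl k A v₀ s x) x ≤ gamma2 d / 4 :=
    (near_or_full (hx1 x) hg2.le h0 hlow).resolve_right (by omega)
  set c : Cut d := ⟨s.p, s.l + 1, v⟩ with hc
  have hvalold : ∀ q ∈ tr, c.value q.1 ≤ q.2.1 := by
    intro q hq
    refine hI.value_le (c := c) h he hv.norm_eq hq (hcorr q.1 ?_) (Or.inr ⟨rfl, rfl, hkexp, ?_⟩)
    · exact List.mem_append_left _ (List.mem_map.2 ⟨q, hq, rfl⟩)
    · exact (norm_starProjection_mono (Submodule.span_mono hpre.subset) v).trans hv.orth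
  have hobj : objective A v₀ cuts' x = max (objective A v₀ s.cuts x) (c.value x) := by
    rw [hcuts, objective_append]
  have hge := (le_value h (c := c) hv.norm_eq hv.orth (hx1 x) hnear).trans
    ((le_max_right _ _).trans hobj.ge)
  have hiff : objective A v₀ cuts' x ≤ -(eta d * gamma1 d / 2) ↔
      objective A v₀ s.cuts x ≤ -(eta d * gamma1 d / 2) := by
    refine iff_of_true ?_ hlow
    rw [hobj]
    exact max_le hlow (value_low h hI.one_le_p hcorrx)
  have hcm : ∀ c' ∈ cuts', c' ∈ s.cuts ∨ c' = c := by
    intro c' hc'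
    rw [hcuts] at hc'
    simpa using hc'
  refine ⟨hI.one_le_p, hI.p_le, ?_, hk.le, ?_, ?_, ?_, ?_, ?_, ?_, ?_, fun h => by simp at h⟩
  · exact hllen.trans hk.le
  · have := hI.length_cuts
    simp only [hcuts, List.length_append, List.length_singleton]; omega
  · intro c' hc'
    rcases hcm c' hc' with h | rfl
    · exact hI.norm_cuts c' h
    · exact hv.norm_eq
  · intro c' hc'
    rcases hcm c' hc' with h | rfl
    · exact hI.idx_cuts c' h
    · exact ⟨hI.p_le, hllen.trans hk.le⟩
  · intro q hq
    rcases List.mem_append.1 hq with hq | hq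
    · have := hI.answers_append hvalold q hq
      rw [this]; simp only [hcuts]
    · rw [List.mem_singleton.1 hq]
  · intro _
    exact ⟨_, List.prefix_rfl, hllen, fun _ => ⟨c, by simp [hcuts], rfl, rfl, hv.orth⟩⟩
  · intro _ q hq
    rcases List.mem_append.1 hq with hq | hq
    · exact Past.mono (s := s) hη hg2.le rfl (Nat.le_succ _) hpre (hI.past he q hq)
    · rw [List.mem_singleton.1 hq]
      exact Or.inr ⟨hge, Or.inl hnear⟩
  · intro _
    refine (hI.window_append he (explStep_eq_newExpl hiff)).imp id ?_
    rintro ⟨a, ha, hm⟩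
    exact ⟨a, by rw [List.length_append]; omega, hm⟩

/-- A query that starts a new period. -/
theorem Inv.step_period (h : Regime d k) (hI : Inv k m A v₀ s tr) (he : s.ended = false)
    {x : Ball d} {v : Vec d}
    (hx : objective A v₀ s.cuts x < -(eta d * (s.p * gamma1 d + s.l * gamma2 d + gamma2 d / 2)))
    (hk : k ≤ (newExpl k A v₀ s x).length) (hp : s.p + 1 ≤ pMax d k)
    (hv : GoodHint k [(x : Vec d)] (tr.map (fun q => (q.1 : Vec d)) ++ [(x : Vec d)]) v)
    {cuts' : List (Cut d)} (hcuts : cuts' = s.cuts ++ [⟨s.p + 1, 1, v⟩]) :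
    Inv k m A v₀ ⟨s.p + 1, 1, [(x : Vec d)], cuts', false⟩
      (tr ++ [(x, (objective A v₀ cuts' x, subgrad A v₀ cuts' x))]) := by
  have hη := h.eta_pos
  have hg1 := h.gamma1_pos
  have hg2 := h.gamma2_pos
  have hk1 := h.one_le_k
  have hx1 : ∀ y : Ball d, ‖(y : Vec d)‖ ≤ 1 := fun y => mem_closedBall_zero_iff.1 y.2
  have hlow := hI.low_of_informative h hx
  have hneg : objective A v₀ s.cuts x < 0 := by
    have := mul_pos hη hg1
    linarith
  have h0 := ne_zero_of_objective_neg hneg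
  have hcorr : ∀ y : Ball d, (y : Vec d) ∈ tr.map (fun q => (q.1 : Vec d)) ++ [(x : Vec d)] →
      inner ℝ v (y : Vec d) ≤ gamma1 d / 2 := fun y hy =>
    (hv.corr y hy).trans (mul_le_of_le_one_right (by positivity) (hx1 y))
  have hcorrx : inner ℝ v (x : Vec d) ≤ gamma1 d / 2 := hcorr x (by simp)
  have hnear : distToSpan [(x : Vec d)] x ≤ gamma2 d / 4 := by
    rw [distToSpan_of_mem (by simp)]; positivity
  set c : Cut d := ⟨s.p + 1, 1, v⟩ with hc
  have hvalold : ∀ q ∈ tr, c.value q.1 ≤ q.2.1 := by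
    intro q hq
    refine hI.value_le (c := c) h he hv.norm_eq hq (hcorr q.1 ?_) (Or.inl rfl)
    exact List.mem_append_left _ (List.mem_map.2 ⟨q, hq, rfl⟩)
  have hobj : objective A v₀ cuts' x = max (objective A v₀ s.cuts x) (c.value x) := by
    rw [hcuts, objective_append]
  have hge := (le_value h (c := c) hv.norm_eq hv.orth (hx1 x) hnear).trans
    ((le_max_right _ _).trans hobj.ge)
  have hlow' : objective A v₀ cuts' x ≤ -(eta d * gamma1 d / 2) := by
    rw [hobj]
    exact max_le hlow (value_low h (Nat.le_add_left 1 s.p) hcorrx)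
  have hexp : explStep k [] (x, (objective A v₀ cuts' x, subgrad A v₀ cuts' x)) =
      [(x : Vec d)] := by
    unfold explStep
    rw [if_pos, List.nil_append]
    refine ⟨hk1, hlow', ?_⟩
    rw [distToSpan_nil, div_self (norm_ne_zero_iff.2 h0)]
    linarith [h.gamma2_le]
  have hcm : ∀ c' ∈ cuts', c' ∈ s.cuts ∨ c' = c := by
    intro c' hc'
    rw [hcuts] at hc'
    simpa using hc'
  refine ⟨Nat.le_add_left 1 _, hp, hk1, hk1, ?_, ?_, ?_, ?_, ?_, ?_, ?_, fun h => by simp at h⟩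
  · have := hI.length_cuts
    have := hI.l_le
    simp only [hcuts, List.length_append, List.length_singleton, add_mul, one_mul]; omega
  · intro c' hc'
    rcases hcm c' hc' with h | rfl
    · exact hI.norm_cuts c' h
    · exact hv.norm_eq
  · intro c' hc'
    rcases hcm c' hc' with h | rfl
    · exact hI.idx_cuts c' h
    · exact ⟨hp, hk1⟩
  · intro q hq
    rcases List.mem_append.1 hq with hq | hq
    · have := hI.answers_append hvalold q hq
      rw [this]; simp only [hcuts]
    · rw [List.mem_singleton.1 hq]
  · intro _
    exact ⟨_, List.prefix_rfl, le_rfl, fun _ => ⟨c, by simp [hcuts], rfl, rfl, hv.orth⟩⟩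
  · intro _ q hq
    rcases List.mem_append.1 hq with hq | hq
    · left
      rcases hI.past he q hq with hP | ⟨hP, -⟩
      · refine le_trans ?_ hP
        rw [neg_le_neg_iff]
        push_cast
        gcongr
        linarith
      · refine le_trans ?_ hP
        rw [neg_le_neg_iff]
        push_cast
        refine mul_le_mul_of_nonneg_left ?_ hη.le
        have hgg := h.gamma2_mul_le
        have hl : (s.l : ℝ) * gamma2 d ≤ k * gamma2 d := by
          have : (s.l : ℝ) ≤ k := by exact_mod_cast hI.l_le
          gcongr
        linarith
    · rw [List.mem_singleton.1 hq]
      exact Or.inr ⟨hge, Or.inl hnear⟩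
  · intro _
    refine (hI.fullWindow_of_full he (explStep_eq_newExpl ?_) hk).imp id fun hle => ?_
    · exact iff_of_true hlow' hlow
    · refine ⟨tr.length, by simp, by rw [add_mul]; omega, ?_⟩
      rw [List.drop_left, exploratory, List.foldl_cons, List.foldl_nil, hexp]

/-- Every query preserves the invariant, provided that the hint sampled for it is good. -/
theorem Inv.step (h : Regime d k) (hv₀ : ‖v₀‖ = 1) (hI : Inv k m A v₀ s tr)
    (ht : tr.length + 1 ≤ d ^ 2) {x : Ball d} {v : Vec d}
    (hv : ∀ e, hintRequest k A v₀ (tr.length + 1) s x = some e →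
      GoodHint k e (tr.map (fun q => (q.1 : Vec d)) ++ [(x : Vec d)]) v) :
    Inv k m A v₀ (procNext k A v₀ (tr.length + 1) s x v)
      (tr ++ [(x, procResponse A v₀ (procNext k A v₀ (tr.length + 1) s x v) x)]) := by
  unfold hintRequest at hv
  unfold procNext
  have ht' : ¬ d ^ 2 < tr.length + 1 := not_lt.2 ht
  by_cases he : s.ended = true
  · have hs : ({ s with ended := true } : ProcState d) = s := by
      cases s; simp only at he; rw [he]
    rw [if_pos (Or.inl he), hs]
    have hr : procResponse A v₀ s x = (objective A v₀ s.cuts x, subgrad A v₀ s.cuts x) := by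
      unfold procResponse; rw [if_neg]; simp [he]
    rw [hr]
    exact hI.step_ended he x
  have he' : s.ended = false := by simpa using he
  have hne : ¬ (s.ended = true ∨ d ^ 2 < tr.length + 1) := by simp [he', ht']
  rw [if_neg hne] at hv ⊢
  by_cases hF : eta d < objective A v₀ [] x
  · rw [if_pos hF]
    have hr : procResponse A v₀ s x = (objective A v₀ s.cuts x, subgrad A v₀ s.cuts x) := by
      unfold procResponse
      rw [if_pos ⟨he', hF⟩]
      exact (answer_of_eta_lt h.eta_pos.le h.gamma1_pos.le h.gamma2_pos.le
        (mem_closedBall_zero_iff.1 x.2) hv₀.le (fun c hc => (hI.norm_cuts c hc).le) hF).symm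
    rw [hr]
    exact hI.step_high h he' hF
  rw [if_neg hF] at hv ⊢
  have hr : ∀ s' : ProcState d, procResponse A v₀ s' x =
      (objective A v₀ s'.cuts x, subgrad A v₀ s'.cuts x) := by
    intro s'
    unfold procResponse; rw [if_neg]; exact fun h => hF h.2
  rw [hr]
  split_ifs at hv ⊢ with h1 h2 h3
  · exact hI.step_cut h he' h1 h2 (hv _ rfl) rfl
  · exact hI.step_period h he' h1 (not_lt.1 h2) h3 (hv _ rfl) rfl
  · exact hI.step_end he' (not_lt.1 h2) (not_le.1 h3)
  · exact hI.step_uninformative h he' (not_lt.1 h1)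

end InvariantStep

/-! ### The constructed function has a deep minimum -/

section Depth

open Module

variable {d : ℕ}

/-- The span of the rows of `A` and of the vectors `ws`. -/
abbrev rowHintSpan (A : SignMatrix d) (ws : List (Vec d)) : Submodule ℝ (Vec d) :=
  Submodule.span ℝ (Set.range (row A) ∪ {y | y ∈ ws})

/-- The component of `v` orthogonal to the rows of `A` and to `ws`. -/
noncomputable def residual (A : SignMatrix d) (ws : List (Vec d)) (v : Vec d) : Vec d :=
  (rowHintSpan A ws)ᗮ.starProjection v

/-- The sum of the Gram-Schmidt orthonormalization of the projections of a list of vectors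
orthogonally to the rows of `A`. The vectors are listed from last to first. -/
noncomputable def gsSum (A : SignMatrix d) : List (Vec d) → Vec d
  | [] => 0
  | v :: ws => ‖residual A ws v‖⁻¹ • residual A ws v + gsSum A ws

/-- All vectors of the list (from last to first) have a long component orthogonal to the rows of
`A` and to the previous vectors, and are not negatively correlated with the sum of the previous
Gram-Schmidt vectors. -/
def DeepHints (A : SignMatrix d) : List (Vec d) → Prop
  | [] => True
  | v :: ws => (1 / 8 ≤ ‖residual A ws v‖ ∧
      inner ℝ v (-gsSum A ws) ≤ gamma1 d / 2 * ‖-gsSum A ws‖) ∧ DeepHints A ws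

variable {A : SignMatrix d}

theorem residual_mem (ws : List (Vec d)) (v : Vec d) :
    residual A ws v ∈ (rowHintSpan A ws)ᗮ := Submodule.starProjection_apply_mem _ _

theorem residual_mem_span (ws : List (Vec d)) (v : Vec d) :
    residual A ws v ∈ rowHintSpan A (v :: ws) := by
  have hle : rowHintSpan A ws ≤ rowHintSpan A (v :: ws) :=
    Submodule.span_mono (Set.union_subset_union_right _ fun y hy => List.mem_cons_of_mem _ hy)
  have h : residual A ws v = v - (rowHintSpan A ws).starProjection v :=
    eq_sub_of_add_eq' ((rowHintSpan A ws).starProjection_add_starProjection_orthogonal v)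
  rw [h]
  exact Submodule.sub_mem _ (Submodule.subset_span (Or.inr List.mem_cons_self))
    (hle (Submodule.starProjection_apply_mem _ _))

theorem gsSum_mem_span (ws : List (Vec d)) : gsSum A ws ∈ rowHintSpan A ws := by
  induction ws with
  | nil => exact Submodule.zero_mem _
  | cons v ws ih =>
    have hle : rowHintSpan A ws ≤ rowHintSpan A (v :: ws) :=
      Submodule.span_mono (Set.union_subset_union_right _ fun y hy => List.mem_cons_of_mem _ hy)
    exact Submodule.add_mem _ (Submodule.smul_mem _ _ (residual_mem_span ws v)) (hle ih)

theorem inner_row_gsSum (ws : List (Vec d)) (i : Fin (numRows d)) :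
    inner ℝ (row A i) (gsSum A ws) = 0 := by
  induction ws with
  | nil => exact inner_zero_right _
  | cons v ws ih =>
    have hi : row A i ∈ rowHintSpan A ws := Submodule.subset_span (Or.inl ⟨i, rfl⟩)
    rw [gsSum, inner_add_right, ih, inner_smul_right,
      Submodule.inner_right_of_mem_orthogonal hi (residual_mem ws v), mul_zero, add_zero]

theorem norm_gsSum_sq_le (ws : List (Vec d)) : ‖gsSum A ws‖ ^ 2 ≤ ws.length := by
  induction ws with
  | nil => simp [gsSum]
  | cons v ws ih =>
    have h1 : inner ℝ (‖residual A ws v‖⁻¹ • residual A ws v) (gsSum A ws) = 0 := by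
      rw [inner_smul_left, Submodule.inner_left_of_mem_orthogonal (gsSum_mem_span ws)
        (residual_mem ws v), mul_zero]
    have h2 : ‖‖residual A ws v‖⁻¹ • residual A ws v‖ ≤ 1 := by
      rw [norm_smul, norm_inv, norm_norm]
      exact inv_mul_le_one
    rw [gsSum, norm_add_sq_real, h1, List.length_cons]
    push_cast
    nlinarith [norm_nonneg (‖residual A ws v‖⁻¹ • residual A ws v)]

theorem norm_gsSum_le (ws : List (Vec d)) : ‖gsSum A ws‖ ≤ √ws.length :=
  Real.le_sqrt_of_sq_le (norm_gsSum_sq_le ws)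

theorem inner_residual (ws : List (Vec d)) (v : Vec d) :
    inner ℝ v (residual A ws v) = ‖residual A ws v‖ ^ 2 := by
  rw [real_inner_comm]
  exact Submodule.re_inner_starProjection_eq_normSq (𝕜 := ℝ) (K := (rowHintSpan A ws)ᗮ) v

/-- The sum of the Gram-Schmidt vectors is positively correlated with all vectors of the list:
the later Gram-Schmidt vectors are orthogonal to a vector, its own one contributes the norm of its
residual, and the contribution of the earlier ones is small. -/
theorem DeepHints.le_inner (hg : 0 ≤ gamma1 d) {L : List (Vec d)} (h : DeepHints A L) :
    ∀ v ∈ L, 1 / 8 - gamma1 d / 2 * √L.length ≤ inner ℝ v (gsSum A L) := by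
  induction L with
  | nil => intro v hv; simp at hv
  | cons u ws ih =>
    have hsq : √(ws.length : ℝ) ≤ √((u :: ws).length : ℝ) := by
      refine Real.sqrt_le_sqrt ?_
      rw [List.length_cons]; push_cast; linarith
    have hmul : gamma1 d / 2 * √(ws.length : ℝ) ≤ gamma1 d / 2 * √((u :: ws).length : ℝ) := by
      gcongr
    intro v hv
    rw [gsSum, inner_add_right, inner_smul_right]
    rcases List.mem_cons.1 hv with rfl | hv
    · have h1 := h.1.1
      have h2 := h.1.2
      rw [inner_neg_right, norm_neg] at h2
      have h3 : gamma1 d / 2 * ‖gsSum A ws‖ ≤ gamma1 d / 2 * √(ws.length : ℝ) := by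
        have := norm_gsSum_le (A := A) ws
        gcongr
      have h4 : ‖residual A ws v‖⁻¹ * inner ℝ v (residual A ws v) = ‖residual A ws v‖ := by
        rw [inner_residual]
        have : ‖residual A ws v‖ ≠ 0 := by linarith
        field_simp
      linarith
    · have hvs : v ∈ rowHintSpan A ws := Submodule.subset_span (Or.inr hv)
      rw [Submodule.inner_right_of_mem_orthogonal hvs (residual_mem ws u), mul_zero, zero_add]
      exact (sub_le_sub_left hmul _).trans (ih h.2 v hv)

theorem supNorm_eq_zero {x : Vec d} (h : ∀ i, inner ℝ (row A i) x = 0) : supNorm A x = 0 := by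
  have : (fun i : Fin (numRows d) => (inner ℝ (row A i) x : ℝ)) = 0 := funext h
  rw [supNorm, this, norm_zero]

/-- The normalized negative sum of the Gram-Schmidt vectors is orthogonal to the rows of `A` and
lies below the level of every period. -/
theorem exists_deep_point {k : ℕ} (h : Regime d k) {v₀ : Vec d} {cuts : List (Cut d)}
    {L : List (Vec d)} (hL : DeepHints A L) (hlen : L.length ≤ pMax d k * k + 1)
    (hv₀ : v₀ ∈ L) (hc : ∀ c ∈ cuts, c.v ∈ L) :
    ∃ x : Ball d, objective A v₀ cuts x ≤ -(eta d * ((pMax d k + 1) * gamma1 d)) := by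
  have hη := h.eta_pos
  have hg1 := h.gamma1_pos
  have hg2 := h.gamma2_pos
  have hN : 0 < L.length := List.length_pos_of_mem hv₀
  have hs : 0 < √(L.length : ℝ) := Real.sqrt_pos.2 (by exact_mod_cast hN)
  have hd := h.depth_lt hlen
  set x : Vec d := -((√(L.length : ℝ))⁻¹ • gsSum A L) with hx
  have hxn : ‖x‖ ≤ 1 := by
    rw [hx, norm_neg, norm_smul, norm_inv, Real.norm_eq_abs, abs_of_pos hs, inv_mul_le_iff₀ hs,
      mul_one]
    exact norm_gsSum_le L
  have hin : ∀ v ∈ L, inner ℝ v x ≤ -((pMax d k + 1) * gamma1 d) := by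
    intro v hv
    have h1 := hL.le_inner hg1.le v hv
    rw [hx, inner_neg_right, inner_smul_right, neg_le_neg_iff, ← div_eq_inv_mul, le_div_iff₀ hs]
    linarith
  refine ⟨⟨x, mem_closedBall_zero_iff.2 hxn⟩, objective_le ?_ ?_ fun c hcc => ?_⟩
  · have h0 : supNorm A x = 0 := by
      refine supNorm_eq_zero fun i => ?_
      rw [hx, inner_neg_right, inner_smul_right, inner_row_gsSum, mul_zero, neg_zero]
    have h1 := h.pMax_mul_gamma1_lt
    change supNorm A x - eta d ≤ _
    rw [h0]
    nlinarith
  · rw [← mul_neg]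
    exact mul_le_mul_of_nonneg_left (hin _ hv₀) hη.le
  · rw [← mul_neg]
    refine mul_le_mul_of_nonneg_left ?_ hη.le
    have h1 := hin _ (hc c hcc)
    have h2 : (0 : ℝ) ≤ c.p * gamma1 d := by positivity
    have h3 : (0 : ℝ) ≤ c.l * gamma2 d := by positivity
    change inner ℝ c.v x - _ - _ ≤ _
    linarith

/-- While the construction goes on, the values of all queries are too large for an answer of the
required accuracy. -/
theorem Inv.ended_of_accurate {k m : ℕ} (h : Regime d k) {v₀ : Vec d} {s : ProcState d}
    {tr : List (Ball d × (ℝ × Vec d))} (hI : Inv k m A v₀ s tr) {e : Ball d × (ℝ × Vec d)}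
    (he : e ∈ tr) (hacc : ∀ y : Ball d, objective A v₀ s.cuts e.1 ≤
      objective A v₀ s.cuts y + eta d / (2 * √(d : ℝ)))
    (hdeep : ∃ x : Ball d, objective A v₀ s.cuts x ≤ -(eta d * ((pMax d k + 1) * gamma1 d))) :
    s.ended = true := by
  by_contra hne
  have hη := h.eta_pos
  have hg1 := h.gamma1_pos
  have hg2 := h.gamma2_pos
  have hgg := h.gamma2_mul_le
  obtain ⟨x, hx⟩ := hdeep
  have h1 := (hacc x).trans (add_le_add_left hx _)
  have h2 : eta d / (2 * √(d : ℝ)) ≤ eta d * (gamma1 d / 2) := by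
    rw [div_eq_mul_one_div]
    exact mul_le_mul_of_nonneg_left h.accuracy_le hη.le
  have hp : (s.p : ℝ) ≤ pMax d k := by exact_mod_cast hI.p_le
  have hpg : (s.p : ℝ) * gamma1 d ≤ pMax d k * gamma1 d := by gcongr
  have hl : (s.l : ℝ) * gamma2 d ≤ k * gamma2 d := by
    have : (s.l : ℝ) ≤ k := by exact_mod_cast hI.l_le
    gcongr
  have h3 := hI.past (by simpa using hne) e he
  rw [hI.answers e he] at h3
  have key : ∀ b : ℝ, b ≤ pMax d k * gamma1 d + gamma1 d / 4 →
      ¬ -(eta d * b) ≤ objective A v₀ s.cuts e.1 := by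
    intro b hb hle
    have h4 : eta d * b ≤ eta d * (pMax d k * gamma1 d + gamma1 d / 4) :=
      mul_le_mul_of_nonneg_left hb hη.le
    have h5 := mul_pos hη hg1
    linarith
  rcases h3 with h3 | ⟨h3, -⟩
  · exact key _ (by linarith) h3
  · exact key _ (by linarith) h3

end Depth

/-! ### Encoding the answers of the second phase -/

section Encoding

variable {d : ℕ}

open Classical in
/-- The answer of the first-order oracle at `x`, encoded as a vector together with an integer that
tells which term of the function is active: `1` for a row of `A`, `2` for `v₀`, and
`3 + Nat.pair p l` for `v_{p,l}`. -/
noncomputable def encode (A : SignMatrix d) (v₀ : Vec d) (cuts : List (Cut d)) (x : Vec d) :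
    Vec d × ℕ :=
  if objective A v₀ cuts x = supNorm A x - eta d then (rowArg A x, 1)
  else if objective A v₀ cuts x = eta d * inner ℝ v₀ x then (v₀, 2)
  else ((cuts.find? fun c => decide (c.value x = objective A v₀ cuts x)).map
    fun c => (c.v, Nat.pair c.p c.l + 3)).getD (v₀, 2)

/-- Recovers the value and the subgradient at `x` from their encoding. -/
noncomputable def decode (x : Vec d) (a : Vec d × ℕ) : ℝ × Vec d :=
  if a.2 = 1 then (|inner ℝ a.1 x| - eta d, Real.sign (inner ℝ a.1 x) • a.1)
  else if a.2 = 2 then (eta d * inner ℝ a.1 x, eta d • a.1)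
  else ((Cut.mk (Nat.unpair (a.2 - 3)).1 (Nat.unpair (a.2 - 3)).2 a.1).value x, eta d • a.1)

theorem numRows_pos (hd : 0 < d) : 0 < numRows d :=
  Nat.ceil_pos.2 (by have : (0 : ℝ) < d := by exact_mod_cast hd
                     positivity)

theorem abs_inner_row_le (A : SignMatrix d) (x : Vec d) (i : Fin (numRows d)) :
    |inner ℝ (row A i) x| ≤ supNorm A x :=
  norm_le_pi_norm (fun i : Fin (numRows d) => (inner ℝ (row A i) x : ℝ)) i

theorem exists_rowArg (hd : 0 < d) (A : SignMatrix d) (x : Vec d) :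
    ∃ i, rowArg A x = row A i ∧ |inner ℝ (row A i) x| = supNorm A x := by
  classical
  have : Nonempty (Fin (numRows d)) := ⟨⟨0, numRows_pos hd⟩⟩
  obtain ⟨i₀, hi₀⟩ := Finite.exists_max fun i : Fin (numRows d) => |(inner ℝ (row A i) x : ℝ)|
  have h0 : |inner ℝ (row A i₀) x| = supNorm A x :=
    le_antisymm (abs_inner_row_le A x i₀) ((pi_norm_le_iff_of_nonneg (abs_nonneg _)).2 hi₀)
  have h1 : ((List.finRange (numRows d)).find? fun i =>
      decide (|inner ℝ (row A i) x| = supNorm A x)).isSome := by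
    rw [List.find?_isSome]
    exact ⟨i₀, List.mem_finRange _, by simpa using h0⟩
  obtain ⟨i, hi⟩ := Option.isSome_iff_exists.1 h1
  refine ⟨i, ?_, by simpa using List.find?_some hi⟩
  unfold rowArg
  convert (show ((some i).map (row A)).getD 0 = row A i from rfl) using 3

theorem exists_find_cut {A : SignMatrix d} {v₀ : Vec d} {cuts : List (Cut d)} {x : Vec d}
    (p : Cut d → Bool) (hp : ∀ c, p c = true ↔ c.value x = objective A v₀ cuts x)
    (h1 : objective A v₀ cuts x ≠ supNorm A x - eta d)
    (h2 : objective A v₀ cuts x ≠ eta d * inner ℝ v₀ x) :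
    ∃ c ∈ cuts, cuts.find? p = some c ∧ c.value x = objective A v₀ cuts x := by
  obtain ⟨c', hc', h⟩ :=
    ((objective_cases (A := A) (v₀ := v₀) cuts x).resolve_left h1).resolve_left h2
  have : (cuts.find? p).isSome := by
    rw [List.find?_isSome]
    exact ⟨c', hc', (hp c').2 h⟩
  obtain ⟨c, hc⟩ := Option.isSome_iff_exists.1 this
  exact ⟨c, List.mem_of_find?_eq_some hc, hc, (hp c).1 (List.find?_some hc)⟩

theorem decode_encode (hd : 0 < d) (A : SignMatrix d) (v₀ : Vec d) (cuts : List (Cut d))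
    (x : Vec d) :
    decode x (encode A v₀ cuts x) = (objective A v₀ cuts x, subgrad A v₀ cuts x) := by
  unfold encode subgrad
  split_ifs with h1 h2
  · obtain ⟨i, hi, hs⟩ := exists_rowArg hd A x
    rw [decode, if_pos rfl, h1]
    refine Prod.ext ?_ rfl
    simp only [hi, hs]
  · rw [decode, if_neg (by norm_num), if_pos rfl, h2]
  · obtain ⟨c, -, hc, hv⟩ := exists_find_cut _ (fun c => decide_eq_true_iff) h1 h2
    rw [hc]
    simp only [Option.map_some, Option.getD_some]
    rw [decode, if_neg (by simp), if_neg (by simp)]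
    simp only [Nat.add_sub_cancel, Nat.unpair_pair]
    exact Prod.ext hv rfl

theorem encode_mem {k : ℕ} (h : Regime d k) {A : SignMatrix d} {v₀ : Vec d} {cuts : List (Cut d)}
    {vs : List (Vec d)} (hv₀ : v₀ ∈ vs) (hc : ∀ c ∈ cuts, c.v ∈ vs)
    (hidx : ∀ c ∈ cuts, c.p ≤ pMax d k ∧ c.l ≤ k) (x : Vec d) :
    encode A v₀ cuts x ∈ answerSet A vs := by
  have hd : 0 < d := by exact_mod_cast h.d_pos
  have h3 : 3 ≤ d ^ 2 := (Nat.le_add_left 3 _).trans (h.pair_le (Nat.zero_le _) (Nat.zero_le k))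
  unfold encode answerSet
  split_ifs with h1 h2
  · obtain ⟨i, hi, -⟩ := exists_rowArg hd A x
    exact ⟨Or.inl ⟨i, hi.symm⟩, le_rfl, by change 1 ≤ d ^ 2; omega⟩
  · exact ⟨Or.inr hv₀, by norm_num, by change 2 ≤ d ^ 2; omega⟩
  · obtain ⟨c, hcm, hcf, -⟩ := exists_find_cut _ (fun c => decide_eq_true_iff) h1 h2
    rw [hcf]
    exact ⟨Or.inr (hc c hcm), by change 1 ≤ Nat.pair _ _ + 3; omega,
      h.pair_le (hidx c hcm).1 (hidx c hcm).2⟩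

end Encoding

/-! ### Properties of the exploratory queries -/

section Exploratory

variable {d : ℕ} {k : ℕ}

/-- The selected queries have low values, and each is far from the span of the previous ones. -/
theorem exploratory_spec (tr : List (Ball d × (ℝ × Vec d))) :
    (exploratory k tr).length ≤ k ∧
      ∀ i (hi : i < (exploratory k tr).length),
        (∃ q ∈ tr, (q.1 : Vec d) = (exploratory k tr)[i] ∧ q.2.1 ≤ -(eta d * gamma1 d / 2)) ∧
        gamma2 d / 4 ≤ distToSpan ((exploratory k tr).take i) (exploratory k tr)[i] /
          ‖(exploratory k tr)[i]‖ := by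
  induction tr using List.reverseRecOn with
  | nil => exact ⟨Nat.zero_le _, fun i hi => absurd hi (Nat.not_lt_zero _)⟩
  | append_singleton tr q ih =>
    obtain ⟨ih1, ih2⟩ := ih
    by_cases h : (exploratory k tr).length < k ∧ q.2.1 ≤ -(eta d * gamma1 d / 2) ∧
        gamma2 d / 4 ≤ distToSpan (exploratory k tr) q.1 / ‖(q.1 : Vec d)‖
    · have he : exploratory k (tr ++ [q]) = exploratory k tr ++ [(q.1 : Vec d)] := by
        rw [exploratory_append, explStep, if_pos h]
      rw [he]
      refine ⟨by rw [List.length_append, List.length_singleton]; exact h.1, fun i hi => ?_⟩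
      rcases Nat.lt_or_ge i (exploratory k tr).length with hlt | hge
      · obtain ⟨⟨q', hq', h1⟩, h2⟩ := ih2 i hlt
        simp only [List.getElem_append_left hlt, List.take_append_of_le_length hlt.le]
        exact ⟨⟨q', List.mem_append_left _ hq', h1⟩, h2⟩
      · have hi' : i = (exploratory k tr).length := by
          rw [List.length_append, List.length_singleton] at hi; omega
        subst hi'
        simp only [List.getElem_concat_length, List.take_left]
        exact ⟨⟨q, by simp, rfl, h.2.1⟩, h.2.2⟩
    · have he : exploratory k (tr ++ [q]) = exploratory k tr := by
        rw [exploratory_append, explStep, if_neg h]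
      rw [he]
      refine ⟨ih1, fun i hi => ?_⟩
      obtain ⟨⟨q', hq', h1⟩, h2⟩ := ih2 i hi
      exact ⟨⟨q', List.mem_append_left _ hq', h1⟩, h2⟩

theorem exploratory_append_of_full {tr : List (Ball d × (ℝ × Vec d))}
    (h : k ≤ (exploratory k tr).length) (tr' : List (Ball d × (ℝ × Vec d))) :
    exploratory k (tr ++ tr') = exploratory k tr := by
  induction tr' using List.reverseRecOn with
  | nil => rw [List.append_nil]
  | append_singleton tr' q ih =>
    rw [← List.append_assoc, exploratory_append, ih, explStep, if_neg]
    exact fun h' => absurd h'.1 (not_lt.2 h)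

theorem supNorm_smul (A : SignMatrix d) (c : ℝ) (x : Vec d) :
    supNorm A (c • x) = |c| * supNorm A x := by
  have : (fun i : Fin (numRows d) => (inner ℝ (row A i) (c • x) : ℝ)) =
      c • fun i : Fin (numRows d) => (inner ℝ (row A i) x : ℝ) := by
    ext i; simp [inner_smul_right]
  rw [supNorm, this, norm_smul, Real.norm_eq_abs]
  rfl

/-- The normalized vectors of a list. -/
noncomputable def normalized (k : ℕ) (e : List (Vec d)) (i : Fin k) : Vec d :=
  ‖e.getD i 0‖⁻¹ • e.getD i 0

/-- A complete list of exploratory queries wins the game. -/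
theorem wins_normalized (h : Regime d k) {A : SignMatrix d} {v₀ : Vec d} (hv₀ : ‖v₀‖ = 1)
    {cuts : List (Cut d)} {tr : List (Ball d × (ℝ × Vec d))}
    (htr : ∀ q ∈ tr, q.2 = (objective A v₀ cuts q.1, subgrad A v₀ cuts q.1))
    (hk : k ≤ (exploratory k tr).length) :
    Wins A (2 * eta d / gamma1 d) (gamma2 d / 4) (normalized k (exploratory k tr)) := by
  have hη := h.eta_pos
  have hg1 := h.gamma1_pos
  obtain ⟨-, hspec⟩ := exploratory_spec (k := k) tr
  set e := exploratory k tr with he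
  intro i
  have hi : (i : ℕ) < e.length := i.2.trans_le hk
  obtain ⟨⟨q, hq, hqe, hlow⟩, hdist⟩ := hspec i hi
  have hget : ∀ j : ℕ, (hj : j < e.length) → e.getD j 0 = e[j] := fun j hj =>
    List.getD_eq_getElem _ _ hj
  have hyi : normalized k e i = ‖e[(i : ℕ)]‖⁻¹ • e[(i : ℕ)] := by
    rw [normalized, hget _ hi]
  set x := e[(i : ℕ)] with hx
  have hobj : objective A v₀ cuts x ≤ -(eta d * gamma1 d / 2) := by
    rw [htr q hq] at hlow
    rwa [← hqe]
  have h1 := ((le_objective_nil x).1.trans (objective_nil_le cuts x)).trans hobj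
  have h2 := ((le_objective_nil x).2.trans (objective_nil_le cuts x)).trans hobj
  have hsup : supNorm A x ≤ eta d := by
    have := mul_pos hη hg1
    linarith
  have hnorm : gamma1 d / 2 ≤ ‖x‖ := by
    rw [mul_div_assoc, ← mul_neg] at h2
    have h3 := le_of_mul_le_mul_left h2 hη
    have h4 := neg_le_of_abs_le (abs_real_inner_le_norm v₀ x)
    rw [hv₀, one_mul] at h4
    linarith
  have hxpos : 0 < ‖x‖ := by linarith
  rw [hyi]
  refine ⟨?_, ?_, ?_⟩
  · rw [norm_smul, norm_inv, norm_norm, inv_mul_cancel₀ hxpos.ne']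
  · rw [supNorm_smul, abs_of_pos (inv_pos.2 hxpos), ← div_eq_inv_mul,
      div_le_div_iff₀ hxpos hg1]
    have h5 : supNorm A x * gamma1 d ≤ eta d * gamma1 d := by gcongr
    have h6 : eta d * (gamma1 d / 2) ≤ eta d * ‖x‖ := by gcongr
    linarith
  · have hle : Submodule.span ℝ (normalized k e '' Set.Iio i) ≤ listSpan (e.take i) := by
      refine Submodule.span_le.2 ?_
      rintro _ ⟨j, hj, rfl⟩
      have hji : (j : ℕ) < i := hj
      have hjl : (j : ℕ) < e.length := hji.trans hi
      rw [normalized, hget _ hjl]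
      refine Submodule.smul_mem _ _ (Submodule.subset_span ?_)
      exact List.mem_take_iff_getElem.2 ⟨j, by omega, rfl⟩
    refine le_trans ?_ (norm_starProjection_mono (Submodule.orthogonal_le hle) _)
    rw [map_smul, norm_smul, norm_inv, norm_norm, ← div_eq_inv_mul]
    exact hdist

end Exploratory

/-! ### The strategy of the player -/

section Strategy

variable {d M : ℕ}

/-- The run after one more query, unless a hint is needed for it. -/
noncomputable def detStep (k : ℕ) (alg : OptAlgorithm d M) (A : SignMatrix d) (v₀ : Vec d)
    (s : RunState d M) : RunState d M :=
  if runRequest k alg A v₀ s = none then runNext k alg A v₀ s 0 else s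

/-- The run up to the next query for which a hint is needed, or up to the `T`-th query. -/
noncomputable def advance (k T : ℕ) (alg : OptAlgorithm d M) (A : SignMatrix d) (v₀ : Vec d)
    (s : RunState d M) : RunState d M :=
  (detStep k alg A v₀)^[T - s.transcript.length] s

/-- The state in which a run of at most `T` queries starts. -/
def RunState.init (d M : ℕ) : RunState d M := ⟨ProcState.init d, fun _ => false, [], false⟩

/-- The run as far as it is determined by the sampled vectors, the first of which is `v₀`. -/
noncomputable def runOf (k T : ℕ) (alg : OptAlgorithm d M) (A : SignMatrix d) :
    List (Vec d) → RunState d M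
  | [] => RunState.init d M
  | v₀ :: ws => ws.foldl (fun s v => advance k T alg A v₀ (runNext k alg A v₀ s v))
      (advance k T alg A v₀ (RunState.init d M))

/-- The vectors submitted by the player. -/
noncomputable def playerHintQuery (k T : ℕ) (alg : OptAlgorithm d M) (A : SignMatrix d)
    (vs : List (Vec d)) : List (Vec d) :=
  match vs with
  | [] => []
  | v₀ :: ws => (runRequest k alg A v₀ (runOf k T alg A (v₀ :: ws))).getD []

theorem hintRequest_length_le {k : ℕ} (hk : 1 ≤ k) {A : SignMatrix d} {v₀ : Vec d} {t : ℕ}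
    {s : ProcState d} {x : Vec d} {e : List (Vec d)} (h : hintRequest k A v₀ t s x = some e) :
    e.length ≤ k := by
  unfold hintRequest at h
  split_ifs at h with h1 h2 h3 h4 h5
  · rw [← Option.some.inj h]; exact h4.le
  · rw [← Option.some.inj h]; exact hk

theorem runRequest_length_le {k : ℕ} (hk : 1 ≤ k) {alg : OptAlgorithm d M} {A : SignMatrix d}
    {v₀ : Vec d} {s : RunState d M} {e : List (Vec d)} (h : runRequest k alg A v₀ s = some e) :
    e.length ≤ k := by
  unfold runRequest at h
  split_ifs at h
  exact hintRequest_length_le hk h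

theorem playerHintQuery_length_le {k : ℕ} (hk : 1 ≤ k) (T : ℕ) (alg : OptAlgorithm d M)
    (A : SignMatrix d) (vs : List (Vec d)) : (playerHintQuery k T alg A vs).length ≤ k := by
  cases vs with
  | nil => exact Nat.zero_le _
  | cons v₀ ws =>
    rw [playerHintQuery]
    cases h : runRequest k alg A v₀ (runOf k T alg A (v₀ :: ws)) with
    | none => exact Nat.zero_le _
    | some e => exact runRequest_length_le hk h

open Classical in
/-- The function submitted by the player: the encoded answers for the function constructed at the
end of the run. (The second branch is never reached on the event of interest.) -/
noncomputable def playerSubmit (hd : 0 < d) (k T : ℕ) (alg : OptAlgorithm d M)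
    (A : SignMatrix d) (vs : List (Vec d)) (x : Ball d) : answerSet A vs :=
  if h : encode A (vs.headD 0) (runOf k T alg A vs).proc.cuts x ∈ answerSet A vs then
    ⟨encode A (vs.headD 0) (runOf k T alg A vs).proc.cuts x, h⟩
  else ⟨(row A ⟨0, numRows_pos hd⟩, 1), Or.inl ⟨_, rfl⟩, le_rfl, Nat.one_le_pow _ _ hd⟩

/-- The decoded transcript of the second phase. -/
noncomputable def decodeTranscript (h : List (Ball d × (Vec d × ℕ))) :
    List (Ball d × (ℝ × Vec d)) :=
  h.map fun q => (q.1, decode q.1 q.2)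

/-- The memory of the algorithm after a transcript, starting with the memory `μ`. -/
def memAfter (alg : OptAlgorithm d M) (μ : Fin M → Bool) (tr : List (Ball d × (ℝ × Vec d))) :
    Fin M → Bool :=
  tr.foldl (fun μ q => alg.update μ q.1 q.2) μ

/-- In the second phase the player emulates the algorithm. -/
noncomputable def playerQuery (alg : OptAlgorithm d M) (μ : Fin M → Bool)
    (h : List (Ball d × (Vec d × ℕ))) : Ball d :=
  alg.query (memAfter alg μ (decodeTranscript h))

/-- The player returns the normalized exploratory queries of the emulated part of the run. -/
noncomputable def playerOutput (k : ℕ) (h : List (Ball d × (Vec d × ℕ))) : Fin k → Vec d :=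
  normalized k (exploratory k (decodeTranscript h))

/-- The second phase for a given message and submitted function. -/
noncomputable def emulate (alg : OptAlgorithm d M) (g : Ball d → Vec d × ℕ) (μ : Fin M → Bool) :
    ℕ → List (Ball d × (Vec d × ℕ))
  | 0 => []
  | i + 1 => emulate alg g μ i ++
      [(playerQuery alg μ (emulate alg g μ i), g (playerQuery alg μ (emulate alg g μ i)))]

open Classical in
/-- The player sends some message that makes the emulation succeed, if there is one. (It will be
the memory of the algorithm at the beginning of a short period.) -/
noncomputable def playerMessage (hd : 0 < d) (k m T : ℕ) (alg : OptAlgorithm d M) (α β : ℝ)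
    (A : SignMatrix d) (vs : List (Vec d)) : Fin M → Bool :=
  if h : ∃ μ, Wins A α β (playerOutput k
      (emulate alg (fun x => (playerSubmit hd k T alg A vs x : Vec d × ℕ)) μ m))
  then h.choose else fun _ => false

/-- The strategy of the player. -/
noncomputable def playerStrategy (hd : 0 < d) {k : ℕ} (hk : 1 ≤ k) (m T : ℕ)
    (alg : OptAlgorithm d M) (α β : ℝ) : Strategy d k M where
  hintQuery := playerHintQuery k T alg
  length_hintQuery := playerHintQuery_length_le hk T alg
  message := playerMessage hd k m T alg α β
  submit := playerSubmit hd k T alg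
  query := playerQuery alg
  output _ h := playerOutput k h

theorem phaseTwo_playerStrategy (hd : 0 < d) {k : ℕ} (hk : 1 ≤ k) (m T : ℕ)
    (alg : OptAlgorithm d M) (α β : ℝ) (A : SignMatrix d) (vs : List (Vec d)) (i : ℕ) :
    phaseTwo (playerStrategy hd hk m T alg α β) A vs i =
      emulate alg (fun x => (playerSubmit hd k T alg A vs x : Vec d × ℕ))
        (playerMessage hd k m T alg α β A vs) i := by
  induction i with
  | zero => rfl
  | succ i ih =>
    rw [phaseTwo, emulate, ← ih]
    rfl

theorem wins_playerStrategy (hd : 0 < d) {k : ℕ} (hk : 1 ≤ k) {m T : ℕ}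
    {alg : OptAlgorithm d M} {α β : ℝ} {A : SignMatrix d} {vs : List (Vec d)}
    (h : ∃ μ, Wins A α β (playerOutput k
      (emulate alg (fun x => (playerSubmit hd k T alg A vs x : Vec d × ℕ)) μ m))) :
    Wins A α β ((playerStrategy hd hk m T alg α β).output
      ((playerStrategy hd hk m T alg α β).message A vs)
      (phaseTwo (playerStrategy hd hk m T alg α β) A vs m)) := by
  rw [phaseTwo_playerStrategy]
  have h1 : playerMessage hd k m T alg α β A vs = h.choose := by
    rw [playerMessage, dif_pos h]
  rw [h1]
  exact h.choose_spec

theorem emulate_add (alg : OptAlgorithm d M) (g : Ball d → Vec d × ℕ) (μ : Fin M → Bool)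
    (i j : ℕ) : ∃ l, emulate alg g μ (i + j) = emulate alg g μ i ++ l := by
  induction j with
  | zero => exact ⟨[], (List.append_nil _).symm⟩
  | succ j ih =>
    obtain ⟨l, hl⟩ := ih
    rw [← add_assoc, emulate]
    refine ⟨l ++ [(playerQuery alg μ (emulate alg g μ (i + j)),
      g (playerQuery alg μ (emulate alg g μ (i + j))))], ?_⟩
    rw [← List.append_assoc, ← hl]

/-- A transcript that may come from a run of the algorithm. -/
def IsTranscript (alg : OptAlgorithm d M) (tr : List (Ball d × (ℝ × Vec d))) : Prop :=
  ∀ i (hi : i < tr.length), tr[i].1 = alg.query (memAfter alg (fun _ => false) (tr.take i))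

/-- Starting with the memory after `a` queries, the player reproduces the run from there on. -/
theorem decodeTranscript_emulate {alg : OptAlgorithm d M} {tr : List (Ball d × (ℝ × Vec d))}
    (htr : IsTranscript alg tr) {g : Ball d → Vec d × ℕ} (hg : ∀ q ∈ tr, decode q.1 (g q.1) = q.2)
    {a c : ℕ} (hac : a + c ≤ tr.length) :
    decodeTranscript (emulate alg g (memAfter alg (fun _ => false) (tr.take a)) c) =
      (tr.drop a).take c := by
  induction c with
  | zero => simp [emulate, decodeTranscript]
  | succ c ih =>
    have ih := ih (by omega)
    have hlt : a + c < tr.length := by omega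
    have hq : playerQuery alg (memAfter alg (fun _ => false) (tr.take a))
        (emulate alg g (memAfter alg (fun _ => false) (tr.take a)) c) = tr[a + c].1 := by
      rw [htr (a + c) hlt, playerQuery, ih, List.take_add, memAfter, memAfter, memAfter,
        List.foldl_append]
    rw [emulate, hq]
    rw [decodeTranscript] at ih ⊢
    rw [List.map_append, ih, List.map_singleton, hg _ (List.getElem_mem hlt)]
    have hlt' : c < (tr.drop a).length := by rw [List.length_drop]; omega
    rw [List.take_succ_eq_append_getElem hlt', List.getElem_drop]

/-- A short window with `k` exploratory queries in the run lets the player win. -/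
theorem exists_message_wins {k m : ℕ} (h : Regime d k) {alg : OptAlgorithm d M} {A : SignMatrix d}
    {v₀ : Vec d} (hv₀ : ‖v₀‖ = 1) {cuts : List (Cut d)} {tr : List (Ball d × (ℝ × Vec d))}
    (htr : IsTranscript alg tr)
    (hans : ∀ q ∈ tr, q.2 = (objective A v₀ cuts q.1, subgrad A v₀ cuts q.1))
    {g : Ball d → Vec d × ℕ} (hg : ∀ x : Ball d, g x = encode A v₀ cuts x)
    (hw : HasFullWindow k m tr) :
    ∃ μ, Wins A (2 * eta d / gamma1 d) (gamma2 d / 4) (playerOutput k (emulate alg g μ m)) := by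
  have hd : 0 < d := by exact_mod_cast h.d_pos
  obtain ⟨a, c, hcm, hac, hk⟩ := hw
  refine ⟨memAfter alg (fun _ => false) (tr.take a), ?_⟩
  have h1 := decodeTranscript_emulate htr (g := g)
    (fun q hq => by rw [hg, decode_encode hd, ← hans q hq]) hac
  obtain ⟨l, hl⟩ := emulate_add alg g (memAfter alg (fun _ => false) (tr.take a)) c (m - c)
  rw [Nat.add_sub_cancel' hcm] at hl
  have h2 : exploratory k (decodeTranscript
      (emulate alg g (memAfter alg (fun _ => false) (tr.take a)) m)) =
      exploratory k ((tr.drop a).take c) := by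
    rw [hl, decodeTranscript, List.map_append]
    rw [decodeTranscript] at h1
    rw [h1]
    exact exploratory_append_of_full hk _
  rw [playerOutput, h2]
  exact wins_normalized h hv₀
    (fun q hq => hans q (List.mem_of_mem_drop (List.mem_of_mem_take hq))) hk

end Strategy

/-! ### Good hints along a run -/

section GoodRun

variable {d M : ℕ}

/-- The vectors with which the hint following `vs` must not be positively correlated: the queries
of the run so far. (As there are at most `d²` of them, the truncation is immaterial.) -/
noncomputable def queriesOf (k T : ℕ) (alg : OptAlgorithm d M) (A : SignMatrix d)
    (vs : List (Vec d)) : List (Vec d) :=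
  ((runOf k T alg A vs).transcript.map (fun q => (q.1 : Vec d)) ++
    [(alg.query (runOf k T alg A vs).mem : Vec d)]).take (d ^ 2 + 1)

/-- The hint `v` that follows the hints `vs` has all the properties used in the proof. -/
structure StepOK (k T : ℕ) (alg : OptAlgorithm d M) (A : SignMatrix d) (vs : List (Vec d))
    (v : Vec d) : Prop where
  good : GoodHint k (playerHintQuery k T alg A vs) (queriesOf k T alg A vs) v
  residual_ge : 1 / 8 ≤ ‖residual A vs.reverse v‖
  inner_le : inner ℝ v (-gsSum A vs.reverse) ≤ gamma1 d / 2 * ‖-gsSum A vs.reverse‖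

/-- All hints that may be used by the run are good. -/
def AllOK (k T : ℕ) (alg : OptAlgorithm d M) (A : SignMatrix d) (vs : List (Vec d)) : Prop :=
  ∀ ws v, ws ++ [v] <+: vs → ws.length ≤ pMax d k * k + 1 → StepOK k T alg A ws v

variable {k m T : ℕ} {alg : OptAlgorithm d M} {A : SignMatrix d} {v₀ : Vec d}

theorem AllOK.nil : AllOK k T alg A [] := by
  intro ws v h
  simp at h

theorem AllOK.of_prefix {vs vs' : List (Vec d)} (h : AllOK k T alg A vs') (hp : vs <+: vs') :
    AllOK k T alg A vs := fun ws v hw hl => h ws v (hw.trans hp) hl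

theorem AllOK.concat {vs : List (Vec d)} (h : AllOK k T alg A vs) {v : Vec d}
    (hv : vs.length ≤ pMax d k * k + 1 → StepOK k T alg A vs v) : AllOK k T alg A (vs ++ [v]) := by
  intro ws u hw hl
  rcases List.prefix_concat_iff.1 hw with he | hp
  · obtain ⟨rfl, he'⟩ := List.append_inj' he rfl
    rw [List.singleton_inj.1 he']
    exact hv hl
  · exact h ws u hp hl

theorem AllOK.deepHints {vs : List (Vec d)} (h : AllOK k T alg A vs)
    (hl : vs.length ≤ pMax d k * k + 1) : DeepHints A vs.reverse := by
  induction vs using List.reverseRecOn with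
  | nil => exact trivial
  | append_singleton vs v ih =>
    rw [List.length_append, List.length_singleton] at hl
    rw [List.reverse_append, List.reverse_singleton, List.singleton_append]
    have hs := h vs v List.prefix_rfl (by omega)
    exact ⟨⟨hs.residual_ge, hs.inner_le⟩, ih (h.of_prefix (List.prefix_append _ _)) (by omega)⟩

/-- The invariant of a run whose sampled vectors, in the order of sampling, are `vs`. -/
structure RunInv (k m : ℕ) (alg : OptAlgorithm d M) (A : SignMatrix d) (v₀ : Vec d)
    (vs : List (Vec d)) (s : RunState d M) : Prop where
  inv : Inv k m A v₀ s.proc s.transcript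
  mem : s.mem = memAfter alg (fun _ => false) s.transcript
  isTranscript : IsTranscript alg s.transcript
  sampled : vs = v₀ :: s.proc.cuts.map Cut.v

theorem RunInv.init (h : Regime d k) : RunInv k m alg A v₀ [v₀] (RunState.init d M) where
  inv := Inv.init h
  mem := rfl
  isTranscript := fun i hi => absurd hi (Nat.not_lt_zero i)
  sampled := rfl

theorem procNext_cuts (t : ℕ) (s : ProcState d) (x v : Vec d) :
    (hintRequest k A v₀ t s x = none → (procNext k A v₀ t s x v).cuts = s.cuts) ∧
      (hintRequest k A v₀ t s x ≠ none →
        (procNext k A v₀ t s x v).cuts.map Cut.v = s.cuts.map Cut.v ++ [v]) := by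
  unfold hintRequest procNext
  split_ifs <;> simp

theorem IsTranscript.concat {tr : List (Ball d × (ℝ × Vec d))} (h : IsTranscript alg tr)
    (r : ℝ × Vec d) :
    IsTranscript alg (tr ++ [(alg.query (memAfter alg (fun _ => false) tr), r)]) := by
  intro i hi
  rcases Nat.lt_or_ge i tr.length with hlt | hge
  · rw [List.getElem_append_left hlt, List.take_append_of_le_length hlt.le]
    exact h i hlt
  · have hi' : i = tr.length := by
      rw [List.length_append, List.length_singleton] at hi; omega
    subst hi'
    simp

/-- One query, without and with a hint being sampled for it. -/
theorem RunInv.step (h : Regime d k) (hv₀ : ‖v₀‖ = 1) {vs : List (Vec d)} {s : RunState d M}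
    (hI : RunInv k m alg A v₀ vs s) (hs : s.stopped = false)
    (ht : s.transcript.length + 1 ≤ d ^ 2) {v : Vec d}
    (hv : ∀ e, runRequest k alg A v₀ s = some e → GoodHint k e
      (s.transcript.map (fun q => (q.1 : Vec d)) ++ [(alg.query s.mem : Vec d)]) v) :
    (runRequest k alg A v₀ s = none → RunInv k m alg A v₀ vs (runNext k alg A v₀ s v)) ∧
      (runRequest k alg A v₀ s ≠ none →
        RunInv k m alg A v₀ (vs ++ [v]) (runNext k alg A v₀ s v)) := by
  have hreq : runRequest k alg A v₀ s =
      hintRequest k A v₀ (s.transcript.length + 1) s.proc (alg.query s.mem) := by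
    rw [runRequest, if_neg (by simp [hs])]
  have hnext : runNext k alg A v₀ s v =
      (let x := alg.query s.mem
       let proc := procNext k A v₀ (s.transcript.length + 1) s.proc x v
       let resp := procResponse A v₀ proc x
       let tr := s.transcript ++ [(x, resp)]
       ⟨proc, alg.update s.mem x resp, tr, alg.halts tr⟩) := by
    rw [runNext, if_neg (by simp [hs])]
  rw [hreq] at hv ⊢
  rw [hnext]
  have hstep := hI.inv.step h hv₀ ht hv
  have hmem : ∀ r : ℝ × Vec d, alg.update s.mem (alg.query s.mem) r =
      memAfter alg (fun _ => false) (s.transcript ++ [(alg.query s.mem, r)]) := by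
    intro r
    rw [hI.mem]
    simp [memAfter, List.foldl_append]
  have htr : ∀ r : ℝ × Vec d, IsTranscript alg (s.transcript ++ [(alg.query s.mem, r)]) := by
    intro r
    rw [hI.mem]
    exact hI.isTranscript.concat r
  have hcuts := procNext_cuts (k := k) (A := A) (v₀ := v₀) (s.transcript.length + 1) s.proc
    (alg.query s.mem) v
  refine ⟨fun hn => ⟨hstep, hmem _, htr _, ?_⟩, fun hn => ⟨hstep, hmem _, htr _, ?_⟩⟩
  · simp only [hcuts.1 hn]
    exact hI.sampled
  · simp only [hcuts.2 hn]
    rw [hI.sampled]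
    rfl

/-- Each of the at most `pMax` periods uses at most `k` vectors, and `v₀` is one more. -/
theorem RunInv.length_le (hI : RunInv k m alg A v₀ vs s) :
    vs.length ≤ pMax d k * k + 1 := by
  have h1 := hI.inv.length_cuts
  have h2 := hI.inv.l_le
  have h3 : s.proc.p * k ≤ pMax d k * k := Nat.mul_le_mul_right _ hI.inv.p_le
  rw [hI.sampled, List.length_cons, List.length_map]
  omega

theorem runOf_concat {vs : List (Vec d)} (v : Vec d) :
    runOf k T alg A (v₀ :: vs ++ [v]) =
      advance k T alg A v₀ (runNext k alg A v₀ (runOf k T alg A (v₀ :: vs)) v) := by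
  rw [List.cons_append, runOf, runOf, List.foldl_append, List.foldl_cons, List.foldl_nil]

theorem detStep_iterate_of_request {s : RunState d M} (h : runRequest k alg A v₀ s ≠ none) (n : ℕ) :
    (detStep k alg A v₀)^[n] s = s :=
  Function.iterate_fixed (by rw [detStep, if_neg h]) n

theorem runNext_of_stopped {s : RunState d M} (h : s.stopped = true) (v : Vec d) :
    runNext k alg A v₀ s v = s := by rw [runNext, if_pos h]

theorem detStep_iterate_of_stopped {s : RunState d M} (h : s.stopped = true) (n : ℕ) :
    (detStep k alg A v₀)^[n] s = s :=
  Function.iterate_fixed (by rw [detStep]; split_ifs <;> simp [runNext_of_stopped h]) n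

/-- A stopped run is not affected by further hints. -/
theorem runOf_append_of_stopped {vs : List (Vec d)}
    (h : (runOf k T alg A (v₀ :: vs)).stopped = true) (ws : List (Vec d)) :
    runOf k T alg A (v₀ :: vs ++ ws) = runOf k T alg A (v₀ :: vs) := by
  induction ws using List.reverseRecOn with
  | nil => rw [List.append_nil]
  | append_singleton ws w ih =>
    have := runOf_concat (k := k) (T := T) (alg := alg) (A := A) (v₀ := v₀) (vs := vs ++ ws) w
    rw [← List.append_assoc, List.cons_append, this, ← List.cons_append, ih,
      runNext_of_stopped h, advance, detStep_iterate_of_stopped h]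

/-- On the good event, the player wins whenever the algorithm succeeds. -/
theorem RunInv.wins (h : Regime d k) (hd : 0 < d) (hk : 1 ≤ k) (hv₀ : ‖v₀‖ = 1)
    {vs : List (Vec d)} {s : RunState d M} (hI : RunInv k m alg A v₀ vs s)
    (hok : AllOK k T alg A vs) (hrun : runOf k T alg A vs = s)
    (hlen : s.transcript.length ≤ m * pMax d k)
    (hsucc : Succeeds A v₀ (eta d / (2 * √(d : ℝ))) s) {ws : List (Vec d)} (hp : vs <+: ws) :
    Wins A (2 * eta d / gamma1 d) (gamma2 d / 4)
      ((playerStrategy hd hk m T alg (2 * eta d / gamma1 d) (gamma2 d / 4)).output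
        ((playerStrategy hd hk m T alg (2 * eta d / gamma1 d) (gamma2 d / 4)).message A ws)
        (phaseTwo (playerStrategy hd hk m T alg (2 * eta d / gamma1 d) (gamma2 d / 4))
          A ws m)) := by
  obtain ⟨hstopped, e, he, hacc⟩ := hsucc
  have hv₀m : v₀ ∈ vs := by rw [hI.sampled]; exact List.mem_cons_self
  have hcm : ∀ c ∈ s.proc.cuts, c.v ∈ vs := by
    intro c hc
    rw [hI.sampled]
    exact List.mem_cons_of_mem _ (List.mem_map_of_mem hc)
  have hdeep := exists_deep_point h (cuts := s.proc.cuts) (hok.deepHints hI.length_le)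
    (by rw [List.length_reverse]; exact hI.length_le) (List.mem_reverse.2 hv₀m)
    (fun c hc => List.mem_reverse.2 (hcm c hc))
  have hended := hI.inv.ended_of_accurate h (List.mem_of_getLast? he) hacc hdeep
  have hw : HasFullWindow k m s.transcript := by
    rcases hI.inv.closed hended with hw | hlt
    · exact hw
    · rw [mul_comm] at hlt; omega
  have hrun' : runOf k T alg A ws = s := by
    obtain ⟨us, rfl⟩ := hp
    have hvs := hI.sampled
    have h1 : (runOf k T alg A (v₀ :: s.proc.cuts.map Cut.v)).stopped = true := by
      rw [← hvs, hrun]; exact hstopped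
    have := runOf_append_of_stopped h1 us
    rw [← hvs, hrun] at this
    exact this
  have hhead : ws.headD 0 = v₀ := by
    obtain ⟨us, rfl⟩ := hp
    rw [hI.sampled]; rfl
  refine wins_playerStrategy hd hk (exists_message_wins h hv₀ hI.isTranscript hI.inv.answers ?_ hw)
  intro x
  have hmem : encode A (ws.headD 0) (runOf k T alg A ws).proc.cuts x ∈ answerSet A ws := by
    rw [hhead, hrun']
    exact encode_mem h (hp.subset hv₀m) (fun c hc => hp.subset (hcm c hc)) hI.inv.idx_cuts x
  rw [playerSubmit, dif_pos hmem]
  simp only [hhead, hrun']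

end GoodRun

/-! ### Coupling the run with the game -/

section Coupling

variable {d M : ℕ}

theorem toOuterMeasure_le_one {α : Type*} (p : PMF α) (S : Set α) : p.toOuterMeasure S ≤ 1 :=
  (p.toOuterMeasure.mono (Set.subset_univ S)).trans_eq
    ((p.toOuterMeasure_apply_eq_one_iff _).2 (Set.subset_univ _))

theorem toOuterMeasure_bind_le_bind {α β γ : Type*} (p : PMF α) {f : α → PMF β} {g : α → PMF γ}
    {S : Set β} {S' : Set γ}
    (h : ∀ a, (f a).toOuterMeasure S ≤ (g a).toOuterMeasure S') :
    (p.bind f).toOuterMeasure S ≤ (p.bind g).toOuterMeasure S' := by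
  rw [PMF.toOuterMeasure_bind_apply, PMF.toOuterMeasure_bind_apply]
  exact ENNReal.tsum_le_tsum fun a => mul_le_mul_right (h a) _

/-- The run of the algorithm from a given state on. -/
noncomputable def runFrom (D : Discretization d (mesh d)) (k : ℕ) (alg : OptAlgorithm d M)
    (A : SignMatrix d) (v₀ : Vec d) : ℕ → RunState d M → PMF (RunState d M)
  | 0, s => PMF.pure s
  | n + 1, s => (runStep D k alg A v₀ s).bind (runFrom D k alg A v₀ n)

/-- The first phase of the game from given responses on. -/
noncomputable def extendHints {k : ℕ} (D : Discretization d (mesh d)) (σ : Strategy d k M)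
    (A : SignMatrix d) : ℕ → List (Vec d) → PMF (List (Vec d))
  | 0, vs => PMF.pure vs
  | n + 1, vs => (hintLaw D (σ.hintQuery A vs)).bind fun v => extendHints D σ A n (vs ++ [v])

variable {k : ℕ} {D : Discretization d (mesh d)}

theorem runFrom_succ {alg : OptAlgorithm d M} {A : SignMatrix d} {v₀ : Vec d} (n : ℕ)
    (s : RunState d M) : runFrom D k alg A v₀ (n + 1) s =
      (runFrom D k alg A v₀ n s).bind (runStep D k alg A v₀) := by
  induction n generalizing s with
  | zero => simp [runFrom]
  | succ n ih =>
    rw [runFrom, runFrom, PMF.bind_bind]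
    exact congrArg _ (funext fun s' => ih s')

theorem run_eq_runFrom {alg : OptAlgorithm d M} {A : SignMatrix d} {v₀ : Vec d} (T : ℕ) :
    run D k alg A v₀ T = runFrom D k alg A v₀ T (RunState.init d M) := by
  induction T with
  | zero => rfl
  | succ T ih =>
    rw [runFrom_succ, ← ih]
    rfl

theorem extendHints_succ {σ : Strategy d k M} {A : SignMatrix d} (n : ℕ) (vs : List (Vec d)) :
    extendHints D σ A (n + 1) vs = (extendHints D σ A n vs).bind fun ws =>
      (hintLaw D (σ.hintQuery A ws)).bind fun v => PMF.pure (ws ++ [v]) := by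
  induction n generalizing vs with
  | zero => simp [extendHints]
  | succ n ih =>
    rw [extendHints, extendHints, PMF.bind_bind]
    exact congrArg _ (funext fun v => ih _)

theorem hints_eq_extendHints {σ : Strategy d k M} {A : SignMatrix d} (l : ℕ) :
    hints D σ A l = extendHints D σ A l [] := by
  induction l with
  | zero => rfl
  | succ l ih =>
    rw [extendHints_succ, ← ih]
    rfl

theorem prefix_of_mem_support_extendHints {σ : Strategy d k M} {A : SignMatrix d} {n : ℕ}
    {vs ws : List (Vec d)} (h : ws ∈ (extendHints D σ A n vs).support) : vs <+: ws := by
  induction n generalizing vs with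
  | zero =>
    rw [extendHints, PMF.support_pure, Set.mem_singleton_iff] at h
    rw [h]
  | succ n ih =>
    rw [extendHints, PMF.mem_support_bind_iff] at h
    obtain ⟨v, -, hv⟩ := h
    exact (List.prefix_append vs [v]).trans (ih hv)

theorem extendHints_eq_one {σ : Strategy d k M} {A : SignMatrix d} {n : ℕ} {vs : List (Vec d)}
    {S : Set (List (Vec d))} (h : ∀ ws, vs <+: ws → ws ∈ S) :
    (extendHints D σ A n vs).toOuterMeasure S = 1 :=
  (PMF.toOuterMeasure_apply_eq_one_iff _ _).2 fun ws hws =>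
    h ws (prefix_of_mem_support_extendHints hws)

theorem runFrom_of_stopped {alg : OptAlgorithm d M} {A : SignMatrix d} {v₀ : Vec d}
    {s : RunState d M} (h : s.stopped = true) (n : ℕ) :
    runFrom D k alg A v₀ n s = PMF.pure s := by
  induction n with
  | zero => rfl
  | succ n ih =>
    rw [runFrom, runStep, if_pos h]
    exact (PMF.pure_bind _ _).trans ih

variable {m T : ℕ} {alg : OptAlgorithm d M} {A : SignMatrix d} {v₀ : Vec d}

/-- The player wins, or some hint is bad. -/
def WinsOrBad (hd : 0 < d) (hk : 1 ≤ k) (m T : ℕ) (alg : OptAlgorithm d M) (A : SignMatrix d) :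
    Set (List (Vec d)) :=
  {ws | AllOK k T alg A ws → Wins A (2 * eta d / gamma1 d) (gamma2 d / 4)
    ((playerStrategy hd hk m T alg (2 * eta d / gamma1 d) (gamma2 d / 4)).output
      ((playerStrategy hd hk m T alg (2 * eta d / gamma1 d) (gamma2 d / 4)).message A ws)
      (phaseTwo (playerStrategy hd hk m T alg (2 * eta d / gamma1 d) (gamma2 d / 4)) A ws m))}

/-- The run and the first phase of the game sample the same vectors, until the run has stopped. -/
theorem toOuterMeasure_runFrom_le (h : Regime d k) (hd : 0 < d) (hk : 1 ≤ k) (hv₀ : ‖v₀‖ = 1)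
    (hT : T ≤ m * pMax d k) (hTd : T ≤ d ^ 2) (n : ℕ) {vs : List (Vec d)} {s : RunState d M}
    (hI : RunInv k m alg A v₀ vs s) (hok : AllOK k T alg A vs)
    (hrun : runOf k T alg A vs = (detStep k alg A v₀)^[n] s)
    (hlen : s.transcript.length ≤ T)
    (hn : s.stopped = false → s.transcript.length + n = T) :
    (runFrom D k alg A v₀ n s).toOuterMeasure
        {s' | Succeeds A v₀ (eta d / (2 * √(d : ℝ))) s'} ≤
      (extendHints D (playerStrategy hd hk m T alg (2 * eta d / gamma1 d) (gamma2 d / 4)) A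
        (d - vs.length) vs).toOuterMeasure (WinsOrBad hd hk m T alg A) := by
  induction n generalizing vs s with
  | zero =>
    rw [runFrom, PMF.toOuterMeasure_pure_apply]
    split_ifs with hs
    · rw [extendHints_eq_one]
      exact fun ws hp _ => hI.wins h hd hk hv₀ hok hrun (hlen.trans hT) hs hp
    · exact zero_le
  | succ n ih =>
    by_cases hs : s.stopped = true
    · rw [runFrom_of_stopped hs, PMF.toOuterMeasure_pure_apply]
      rw [detStep_iterate_of_stopped hs] at hrun
      split_ifs with hs'
      · rw [extendHints_eq_one]
        exact fun ws hp _ => hI.wins h hd hk hv₀ hok hrun (hlen.trans hT) hs' hp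
      · exact zero_le
    have hs' : s.stopped = false := by simpa using hs
    have hn' := hn hs'
    have hlen' : ∀ v, (runNext k alg A v₀ s v).transcript.length = s.transcript.length + 1 := by
      intro v
      rw [runNext, if_neg hs]
      simp
    rw [runFrom, runStep_eq]
    cases hreq : runRequest k alg A v₀ s with
    | none =>
      have hI' := (hI.step h hv₀ hs' (by omega) (v := 0)
        (fun e he => by rw [hreq] at he; simp at he)).1 hreq
      have hpure : (onRequest D none (runNext k alg A v₀ s)).bind (runFrom D k alg A v₀ n) =
          runFrom D k alg A v₀ n (runNext k alg A v₀ s 0) := PMF.pure_bind _ _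
      rw [hpure]
      refine ih hI' hok ?_ ?_ ?_
      · rw [hrun, Function.iterate_succ_apply, detStep, if_pos hreq]
      · rw [hlen']; omega
      · rw [hlen']; omega
    | some e =>
      have hne : runRequest k alg A v₀ s ≠ none := by rw [hreq]; simp
      rw [detStep_iterate_of_request hne] at hrun
      have hvlen := hI.length_le
      have hnum := h.pMax_mul_add_one_le_nat
      have hvs := hI.sampled
      have hquery : (playerStrategy hd hk m T alg (2 * eta d / gamma1 d) (gamma2 d / 4)).hintQuery
          A vs = e := by
        change playerHintQuery k T alg A vs = e
        rw [hvs, playerHintQuery, ← hvs, hrun, hreq, Option.getD_some]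
      have hbind : (onRequest D (some e) (runNext k alg A v₀ s)).bind (runFrom D k alg A v₀ n) =
          (hintLaw D e).bind fun v => runFrom D k alg A v₀ n (runNext k alg A v₀ s v) := by
        refine (PMF.bind_bind _ _ _).trans (congrArg _ (funext fun v => PMF.pure_bind _ _))
      obtain ⟨r, hr⟩ : ∃ r, d - vs.length = r + 1 := ⟨d - vs.length - 1, by omega⟩
      rw [hbind, hr, extendHints, hquery]
      refine toOuterMeasure_bind_le_bind _ fun v => ?_
      by_cases hok' : AllOK k T alg A (vs ++ [v])
      · have hr' : r = d - (vs ++ [v]).length := by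
          rw [List.length_append, List.length_singleton]; omega
        have hstep := hok' vs v List.prefix_rfl hvlen
        have hgood := hstep.good
        have hq : queriesOf k T alg A vs =
            s.transcript.map (fun q => (q.1 : Vec d)) ++ [(alg.query s.mem : Vec d)] := by
          rw [queriesOf, hrun, List.take_of_length_le]
          simp only [List.length_append, List.length_map, List.length_singleton]
          omega
        rw [show playerHintQuery k T alg A vs = e from hquery, hq] at hgood
        have hI' := (hI.step h hv₀ hs' (by omega) (v := v) (fun e' he' => by
          rw [hreq] at he'
          rw [← Option.some.inj he']
          exact hgood)).2 hne
        rw [hr']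
        refine ih hI' hok' ?_ ?_ ?_
        · have hconc := runOf_concat (k := k) (T := T) (alg := alg) (A := A) (v₀ := v₀)
            (vs := s.proc.cuts.map Cut.v) v
          rw [← hvs, hrun, advance, hlen'] at hconc
          rw [hconc]
          congr 1
          omega
        · rw [hlen']; omega
        · rw [hlen']; omega
      · rw [extendHints_eq_one]
        · exact toOuterMeasure_le_one _ _
        · exact fun ws hp hws => absurd (hws.of_prefix hp) hok'

/-! ### The probability of a bad hint -/

/-- The union bound over a list of events. -/
theorem toOuterMeasure_exists_mem_le {α β : Type*} (p : PMF α) (l : List β) (Q : β → α → Prop)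
    {b : ENNReal} (h : ∀ x, p.toOuterMeasure {v | Q x v} ≤ b) :
    p.toOuterMeasure {v | ∃ x ∈ l, Q x v} ≤ l.length * b := by
  induction l with
  | nil => simp
  | cons x l ih =>
    have hset : {v | ∃ y ∈ x :: l, Q y v} = {v | Q x v} ∪ {v | ∃ y ∈ l, Q y v} := by
      ext v; simp
    rw [hset, List.length_cons, Nat.cast_add, Nat.cast_one, add_mul, one_mul, add_comm]
    exact (measure_union_le _ _).trans (add_le_add (h x) ih)

theorem finrank_rowHintSpan_le (A : SignMatrix d) (ws : List (Vec d)) :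
    Module.finrank ℝ (rowHintSpan A ws) ≤ numRows d + ws.length := by
  rw [rowHintSpan, Submodule.span_union]
  refine (Submodule.finrank_add_le_finrank_add_finrank _ _).trans (add_le_add ?_ ?_)
  · exact (finrank_range_le_card (R := ℝ) (row A)).trans_eq (by simp)
  · exact finrank_listSpan_le ws

/-- A hint is good except with probability `3 / d³`. -/
theorem toOuterMeasure_not_stepOK_le (h : Regime d k) (D : Discretization d (mesh d)) (T : ℕ)
    (alg : OptAlgorithm d M) (A : SignMatrix d) {vs : List (Vec d)}
    (hvs : vs.length ≤ pMax d k * k + 1) :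
    (hintLaw D (playerHintQuery k T alg A vs)).toOuterMeasure {v | ¬ StepOK k T alg A vs v} ≤
      ENNReal.ofReal (3 / (d : ℝ) ^ 3) := by
  set e := playerHintQuery k T alg A vs with he
  have hd := h.d_pos
  have hek : e.length ≤ k := playerHintQuery_length_le h.one_le_k T alg A vs
  have hnum := h.pMax_mul_add_one_le_nat
  have hkn := h.k_le_nat
  have hdl : 16200 ≤ d := by exact_mod_cast h.d_large
  have hed : e.length < d := by omega
  have htail : ∀ X : Vec d, (hintLaw D e).toOuterMeasure
      {v | gamma1 d / 2 * ‖X‖ < inner ℝ v X} ≤ ENNReal.ofReal (1 / (d : ℝ) ^ 5) := by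
    intro X
    refine le_trans (measure_mono fun v hv => ?_)
      ((hintLaw_tail D hed X (by positivity) h.tail_sq_le).trans
        (ENNReal.ofReal_le_ofReal (h.tail_bound_le hek)))
    have hv' : gamma1 d / 2 * ‖X‖ < inner ℝ v X := hv
    refine lt_of_le_of_lt ?_ hv'
    gcongr
    exact h.tail_threshold_le hek
  have hsupp : (hintLaw D e).toOuterMeasure {v | ¬ (‖v‖ = 1 ∧
      ‖(listSpan e).starProjection v‖ ≤ ((k : ℝ) + 1) / (d : ℝ) ^ 3)} = 0 := by
    rw [PMF.toOuterMeasure_apply_eq_zero_iff, Set.disjoint_left]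
    intro v hv hnot
    obtain ⟨h1, h2⟩ := hintLaw_support D hed hv
    refine hnot ⟨h1, h2.trans ?_⟩
    gcongr
  have hsmall : (hintLaw D e).toOuterMeasure {v | ‖residual A vs.reverse v‖ < 1 / 8} ≤
      ENNReal.ofReal (1 / (d : ℝ) ^ 4) := by
    have hrows : 4 * numRows d ≤ d + 4 := by
      have h1 : (numRows d : ℝ) < (d : ℝ) / 4 + 1 := Nat.ceil_lt_add_one (by positivity)
      have h2 : (4 * numRows d : ℝ) < d + 4 := by linarith
      exact (Nat.cast_lt (α := ℝ).1 (by push_cast; exact h2)).le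
    have hfin := finrank_rowHintSpan_le A vs.reverse
    rw [List.length_reverse] at hfin
    have hsum := (rowHintSpan A vs.reverse).finrank_add_finrank_orthogonal
    rw [finrank_euclideanSpace_fin] at hsum
    -- The rows take up a quarter of the dimensions; the previous vectors and `e` take up few more.
    set N := d - numRows d - vs.length - k with hN
    refine le_trans (measure_mono fun v hv => ?_)
      ((hintLaw_small_projection D hed (rowHintSpan A vs.reverse)ᗮ (ρ := 1 / 4) (by norm_num)
        (by norm_num) (N := N) (by omega)).trans
        (ENNReal.ofReal_le_ofReal (h.small_projection_bound_le (by omega))))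
    have h1 : ‖residual A vs.reverse v‖ < 1 / 8 := hv
    change ‖residual A vs.reverse v‖ < 1 / 4 - mesh d
    linarith [h.mesh_le]
  have hqlen : (queriesOf k T alg A vs).length ≤ d ^ 2 + 1 := List.length_take_le _ _
  have htests := toOuterMeasure_exists_mem_le (hintLaw D e) (queriesOf k T alg A vs)
    (fun X v => gamma1 d / 2 * ‖X‖ < inner ℝ v X) htail
  have hsub : {v | ¬ StepOK k T alg A vs v} ⊆
      (({v | ¬ (‖v‖ = 1 ∧ ‖(listSpan e).starProjection v‖ ≤ ((k : ℝ) + 1) / (d : ℝ) ^ 3)} ∪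
        {v | ∃ X ∈ queriesOf k T alg A vs, gamma1 d / 2 * ‖X‖ < inner ℝ v X}) ∪
        {v | gamma1 d / 2 * ‖-gsSum A vs.reverse‖ < inner ℝ v (-gsSum A vs.reverse)}) ∪
        {v | ‖residual A vs.reverse v‖ < 1 / 8} := by
    intro v hv
    by_contra hnot
    simp only [Set.mem_union, not_or] at hnot
    obtain ⟨⟨⟨h1, h2⟩, h3⟩, h4⟩ := hnot
    have h1' := not_not.1 h1
    refine hv ⟨⟨h1'.1, h1'.2, fun X hX => ?_⟩, not_lt.1 h4, not_lt.1 h3⟩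
    exact not_lt.1 fun hlt => h2 ⟨X, hX, hlt⟩
  have hcast : ((queriesOf k T alg A vs).length : ENNReal) * ENNReal.ofReal (1 / (d : ℝ) ^ 5) ≤
      ENNReal.ofReal (((d : ℝ) ^ 2 + 1) * (1 / (d : ℝ) ^ 5)) := by
    rw [ENNReal.ofReal_mul (by positivity)]
    gcongr
    rw [← ENNReal.ofReal_natCast]
    refine ENNReal.ofReal_le_ofReal ?_
    exact_mod_cast hqlen
  calc _ ≤ 0 + ENNReal.ofReal (((d : ℝ) ^ 2 + 1) * (1 / (d : ℝ) ^ 5)) +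
        ENNReal.ofReal (1 / (d : ℝ) ^ 5) + ENNReal.ofReal (1 / (d : ℝ) ^ 4) := by
        refine (measure_mono hsub).trans ?_
        refine (measure_union_le _ _).trans (add_le_add ?_ hsmall)
        refine (measure_union_le _ _).trans (add_le_add ?_ (htail _))
        exact (measure_union_le _ _).trans (add_le_add hsupp.le (htests.trans hcast))
    _ = ENNReal.ofReal (((d : ℝ) ^ 2 + 1) * (1 / (d : ℝ) ^ 5) + 1 / (d : ℝ) ^ 5 +
          1 / (d : ℝ) ^ 4) := by
        rw [zero_add, ← ENNReal.ofReal_add (by positivity) (by positivity),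
          ← ENNReal.ofReal_add (by positivity) (by positivity)]
    _ ≤ _ := by
        refine ENNReal.ofReal_le_ofReal ?_
        have h1 : ((d : ℝ) ^ 2 + 1) * (1 / (d : ℝ) ^ 5) + 1 / (d : ℝ) ^ 5 + 1 / (d : ℝ) ^ 4 =
            ((d : ℝ) ^ 2 + d + 2) / (d : ℝ) ^ 5 := by field_simp; ring
        have h2 : 3 / (d : ℝ) ^ 3 = (3 * (d : ℝ) ^ 2) / (d : ℝ) ^ 5 := by field_simp
        rw [h1, h2]
        gcongr
        nlinarith [h.six_le]

/-- The union bound over the `n` hints that are still to be sampled. -/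
theorem toOuterMeasure_not_allOK_le (h : Regime d k) (D : Discretization d (mesh d))
    {σ : Strategy d k M} (hσ : ∀ vs, σ.hintQuery A vs = playerHintQuery k T alg A vs)
    (n : ℕ) {vs : List (Vec d)} (hok : AllOK k T alg A vs) :
    (extendHints D σ A n vs).toOuterMeasure {ws | ¬ AllOK k T alg A ws} ≤
      n * ENNReal.ofReal (3 / (d : ℝ) ^ 3) := by
  induction n generalizing vs with
  | zero =>
    rw [extendHints, PMF.toOuterMeasure_pure_apply, if_neg (fun hn => hn hok)]
    exact zero_le
  | succ n ih =>
    classical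
    rw [extendHints, PMF.toOuterMeasure_bind_apply, hσ]
    set p := hintLaw D (playerHintQuery k T alg A vs) with hp
    set b := ENNReal.ofReal (3 / (d : ℝ) ^ 3) with hb
    set B := {v | vs.length ≤ pMax d k * k + 1 ∧ ¬ StepOK k T alg A vs v} with hB
    have hpB : p.toOuterMeasure B ≤ b := by
      by_cases hl : vs.length ≤ pMax d k * k + 1
      · exact (measure_mono fun v hv => hv.2).trans (toOuterMeasure_not_stepOK_le h D T alg A hl)
      · have : B = ∅ := Set.eq_empty_of_forall_notMem fun v hv => hl hv.1
        rw [this]; simp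
    calc _ ≤ ∑' v, (B.indicator p v + p v * (n * b)) := by
          refine ENNReal.tsum_le_tsum fun v => ?_
          by_cases hv : v ∈ B
          · rw [Set.indicator_of_mem hv]
            exact (mul_le_of_le_one_right' (toOuterMeasure_le_one _ _)).trans le_self_add
          · rw [Set.indicator_of_notMem hv, zero_add]
            refine mul_le_mul_right (ih (hok.concat fun hl => ?_)) _
            by_contra hns
            exact hv ⟨hl, hns⟩
      _ = p.toOuterMeasure B + n * b := by
          rw [ENNReal.tsum_add, ENNReal.tsum_mul_right, PMF.tsum_coe, one_mul,
            PMF.toOuterMeasure_apply]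
      _ ≤ b + n * b := by gcongr
      _ = _ := by push_cast; ring

/-- The success probability of the algorithm is at most the winning probability of the player plus
the probability of a bad hint. -/
theorem successProb_le (h : Regime d k) (hd : 0 < d) (hk : 1 ≤ k) (hm : m ≤ d)
    (D : Discretization d (mesh d)) (alg : OptAlgorithm d M) :
    successProb D k alg (m * pMax d k) (eta d / (2 * √(d : ℝ))) ≤
      winProb D m (2 * eta d / gamma1 d) (gamma2 d / 4)
        (playerStrategy hd hk m (m * pMax d k) alg (2 * eta d / gamma1 d) (gamma2 d / 4)) +
      3 / (d : ℝ) ^ 2 := by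
  set T := m * pMax d k with hT
  set σ := playerStrategy hd hk m T alg (2 * eta d / gamma1 d) (gamma2 d / 4) with hσ
  have hdpos := h.d_pos
  have hTd : T ≤ d ^ 2 := by
    have h1 : pMax d k ≤ d := by have := h.pMax_le; omega
    calc T ≤ d * d := Nat.mul_le_mul hm h1
      _ = d ^ 2 := (sq d).symm
  set S : Set (SignMatrix d × List (Vec d)) :=
    {ω | Wins ω.1 (2 * eta d / gamma1 d) (gamma2 d / 4)
      (σ.output (σ.message ω.1 ω.2) (phaseTwo σ ω.1 ω.2 m))} with hS
  set B : Set (SignMatrix d × List (Vec d)) := {ω | ¬ AllOK k T alg ω.1 ω.2} with hB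
  have hgame : gameLaw D σ = (PMF.uniformOfFintype (SignMatrix d)).bind fun A =>
      (hints D σ A d).bind fun vs => PMF.pure (A, vs) := rfl
  have hproc : procLaw D k alg T = (PMF.uniformOfFintype (SignMatrix d)).bind fun A =>
      D.uniform.bind fun v₀ => (run D k alg A v₀ T).bind fun s => PMF.pure (A, v₀, s) := rfl
  have hpure : ∀ {α β : Type} (p : PMF α) (f : α → β) (s : Set β),
      (p.bind fun a => PMF.pure (f a)).toOuterMeasure s = p.toOuterMeasure (f ⁻¹' s) :=
    fun p f s => PMF.toOuterMeasure_map_apply f p s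
  have hbad : (gameLaw D σ).toOuterMeasure B ≤ ENNReal.ofReal (3 / (d : ℝ) ^ 2) := by
    have h1 : ∀ A, ((hints D σ A d).bind fun vs => PMF.pure (A, vs)).toOuterMeasure B ≤
        ENNReal.ofReal (3 / (d : ℝ) ^ 2) := by
      intro A
      rw [hpure, hints_eq_extendHints]
      refine (toOuterMeasure_not_allOK_le h D (fun _ => rfl) d AllOK.nil).trans_eq ?_
      rw [← ENNReal.ofReal_natCast, ← ENNReal.ofReal_mul (by positivity)]
      congr 1
      field_simp
    rw [hgame, PMF.toOuterMeasure_bind_apply]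
    calc _ ≤ ∑' A, PMF.uniformOfFintype (SignMatrix d) A * ENNReal.ofReal (3 / (d : ℝ) ^ 2) :=
          ENNReal.tsum_le_tsum fun A => mul_le_mul_right (h1 A) _
      _ = _ := by rw [ENNReal.tsum_mul_right, PMF.tsum_coe, one_mul]
  have hmain : (procLaw D k alg T).toOuterMeasure
      {ω | Succeeds ω.1 ω.2.1 (eta d / (2 * √(d : ℝ))) ω.2.2} ≤
      (gameLaw D σ).toOuterMeasure (S ∪ B) := by
    rw [hproc, hgame]
    refine toOuterMeasure_bind_le_bind _ fun A => ?_
    have hhints : hints D σ A d = D.uniform.bind fun v₀ => extendHints D σ A (d - 1) [v₀] := by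
      have h1 : hintLaw D (σ.hintQuery A []) = D.uniform := hintLaw_nil hd D
      have h2 : ∀ n, 0 < n →
          extendHints D σ A n [] = D.uniform.bind fun v₀ => extendHints D σ A (n - 1) [v₀] := by
        intro n hn
        obtain ⟨r, rfl⟩ := Nat.exists_eq_succ_of_ne_zero hn.ne'
        rw [extendHints, h1]
        rfl
      rw [hints_eq_extendHints, h2 d hd]
    rw [hhints, PMF.bind_bind]
    -- As the player's first request is empty, the first response plays the role of `v₀`.
    refine toOuterMeasure_bind_le_bind _ fun v₀ => ?_
    rw [hpure, hpure]
    have hset : (fun vs => (A, vs)) ⁻¹' (S ∪ B) = WinsOrBad hd hk m T alg A := by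
      ext vs
      simp only [Set.mem_preimage, Set.mem_union, WinsOrBad, hS, hB, Set.mem_ofPred_eq]
      tauto
    rw [hset]
    by_cases hok : AllOK k T alg A [v₀]
    · rw [run_eq_runFrom]
      have hv₀ : ‖v₀‖ = 1 := (hok [] v₀ List.prefix_rfl (Nat.zero_le _)).good.norm_eq
      exact toOuterMeasure_runFrom_le h hd hk hv₀ le_rfl hTd T (RunInv.init h) hok rfl
        (Nat.zero_le _) fun _ => Nat.zero_add _
    · rw [extendHints_eq_one]
      · exact toOuterMeasure_le_one _ _
      · exact fun ws hp hws => absurd (hws.of_prefix hp) hok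
  have htotal := hmain.trans ((measure_union_le S B).trans (add_le_add_right hbad _))
  have hfin : (gameLaw D σ).toOuterMeasure S ≠ ⊤ :=
    ((toOuterMeasure_le_one _ _).trans_lt ENNReal.one_lt_top).ne
  have hreal := ENNReal.toReal_mono (ENNReal.add_ne_top.2 ⟨hfin, ENNReal.ofReal_ne_top⟩) htotal
  rw [ENNReal.toReal_add hfin ENNReal.ofReal_ne_top, ENNReal.toReal_ofReal (by positivity)] at hreal
  exact hreal

/-- Without any query an algorithm does not stop. -/
theorem successProb_zero (D : Discretization d (mesh d)) (alg : OptAlgorithm d M) (ε : ℝ) :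
    successProb D k alg 0 ε = 0 := by
  rw [successProb, ENNReal.toReal_eq_zero_iff]
  left
  rw [PMF.toOuterMeasure_apply_eq_zero_iff, Set.disjoint_left]
  rintro ω hω ⟨hstopped, -⟩
  have hproc : procLaw D k alg 0 = (PMF.uniformOfFintype (SignMatrix d)).bind fun A =>
      D.uniform.bind fun v₀ => (PMF.pure (RunState.init d M)).bind fun s =>
        PMF.pure (A, v₀, s) := rfl
  simp only [hproc, PMF.pure_bind, PMF.mem_support_bind_iff, PMF.support_pure,
    Set.mem_singleton_iff] at hω
  obtain ⟨A, -, v₀, -, rfl⟩ := hω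
  simp [RunState.init] at hstopped

end Coupling

end HintGame

/-! ### The reduction -/

theorem mainTheorem4 :
    ∃ C : ℝ, 0 < C ∧
      ∀ (d k m M : ℕ), 1 ≤ k → (k : ℝ) ≤ (d : ℝ) / 3 - 1 → m ≤ d →
      ∀ (D : Discretization d (mesh d)) (alg : OptAlgorithm d M) (q : ℝ),
        q ≤ successProb D k alg (m * pMax d k) (eta d / (2 * √(d : ℝ))) →
        ∃ σ : Strategy d k M,
          q - C * √(Real.log d) / d ≤
            winProb D m (2 * eta d / gamma1 d) (gamma2 d / 4) σ := by
  refine ⟨3, by norm_num, fun d k m M hk hkd hm D alg q hq => ?_⟩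
  have hk' : (1 : ℝ) ≤ k := by exact_mod_cast hk
  have hd : 0 < d := (Nat.cast_pos (α := ℝ)).1 (by linarith)
  have hdpos : (0 : ℝ) < d := Nat.cast_pos.2 hd
  refine ⟨playerStrategy hd hk m (m * pMax d k) alg (2 * eta d / gamma1 d) (gamma2 d / 4), ?_⟩
  by_cases hp : 1 ≤ pMax d k
  · have h : Regime d k := ⟨hk, hkd, hp⟩
    have hbound : 3 / (d : ℝ) ^ 2 ≤ 3 * √(Real.log d) / d := by
      have h1 : 1 ≤ √(Real.log d) := Real.one_le_sqrt.2 h.one_le_log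
      have h2 : (1 : ℝ) ≤ d := by exact_mod_cast hd
      rw [div_le_div_iff₀ (by positivity) hdpos]
      nlinarith [mul_le_mul h1 h2 zero_le_one (by positivity), mul_pos hdpos hdpos]
    linarith [successProb_le h hd hk hm D alg]
  · -- Without a single period the algorithm is allowed no query, so `q ≤ 0`.
    rw [show pMax d k = 0 by omega, Nat.mul_zero, successProb_zero] at hq
    refine le_trans ?_ ENNReal.toReal_nonneg
    have : 0 ≤ 3 * √(Real.log d) / d := by positivity
    linarith
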